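/- Let $\mathcal C=D(\mathbb Z_4)$ be the $\mathbb Z_4$ toric code: the semisimple $\mathbb C$-linear category with simple objects $e^pm^q$ ($p,q\in\mathbb Z/4$), fusion $e^am^b\otimes e^cm^d=e^{a+c}m^{b+d}$, trivial associator, braiding $c_{e^am^b,\,e^cm^d}=i^{ad}$ and twist $\theta(e^pm^q)=i^{pq}$. It is a unitary modular category. Let $A=\mathbf 1\oplus e^2m^2$, with unit the inclusion of $\mathbf 1$ and multiplication given on each pair of summands by the canonical isomorphism $g\otimes h\cong gh$. Then $\theta_A=\mathrm{id}_A$, and $A$ is a 2d-condensable algebra, that is, a connected ($\dim\mathrm{Hom}(\mathbf 1,A)=1$) commutative algebra that carries the structure of a symmetric Frobenius algebra which is normalized-special ($\mu\circ\Delta=\mathrm{id}_A$ and $\varepsilon\circ\iota=\dim A$). Up to isomorphism, the simple right $A$-modules are $A$ itself and exactly seven others, whose underlying objects are $$e\oplus e^3m^2,\quad e^2\oplus m^2,\quad e^3\oplus em^2,\quad e^2m^3\oplus m,\quad em\oplus e^3m^3,\quad m^3\oplus e^2m,\quad e^3m\oplus em^3 .$$ A right $A$-module $(M,\mu_M)$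 is local if $\mu_M\circ c_{A,M}\circ c_{M,A}=\mu_M$. Exactly three of these seven modules are local, namely $e^2\oplus m^2$, $em\oplus e^3m^3$ and $e^3m\oplus em^3$. Hence the category $\mathcal C_A^{loc}$ of local right $A$-modules has, up to isomorphism, exactly the four simple objects $$\mathbf 1\oplus e^2m^2,\quad em\oplus e^3m^3,\quad e^2\oplus m^2,\quad e^3m\oplus em^3 .$$ With the tensor product $\otimes_A$ (the coequalizer of the two $A$-actions on $M\otimes N$), the unit $A$, and the associator, braiding and twist induced from $\mathcal C$, the category $\mathcal C_A^{loc}$ is a unitary modular category. It is equivalent, as a $\mathbb C$-linear ribbon category, to the doubled semion category, the product of the semion category and its complex conjugate: its simple objects are $1,s,\bar s,s\bar s$, with $s\otimes s=\bar s\otimes\bar s=1$, the associators of $(s,s,s)$ and of $(\bar s,\bar s,\bar s)$ are $-1$, the braidings are $c_{s,s}=i$, $c_{\bar s,\bar s}=-i$ and $c_{s,\bar s}=c_{\bar s,s}=1$, and the twists are $\theta(s)=i$, $\theta(\bar s)=-i$, $\theta(s\bar s)=1$. -/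

import Mathlib

open CategoryTheory MonoidalCategory Limits
open scoped MonObj ComonObj

noncomputable section

universe v u v₁ u₁ v₂ u₂

/-! ## Ribbon, modular and unitary structures -/

namespace Modular

section

variable {C : Type u} [Category.{v} C] [MonoidalCategory C] [BraidedCategory C]

/-- The quantum trace of an endomorphism `f` of `X` in a braided category with twist `θ`, computed
with a right dual `Y` of `X`:
`𝟙 ⟶ X ⊗ Y ⟶ X ⊗ Y ⟶ Y ⊗ X ⟶ 𝟙`, the maps being coevaluation, `(θ_X ∘ f) ⊗ Y`, braiding and
evaluation. -/
def qtrace (θ : ∀ X : C, X ≅ X) (X Y : C) [ExactPairing X Y] (f : X ⟶ X) : 𝟙_ C ⟶ 𝟙_ C :=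
  η_ X Y ≫ (f ≫ (θ X).hom) ▷ Y ≫ (β_ X Y).hom ≫ ε_ X Y

end

/-- `S 0, …, S (n - 1)` are simple, pairwise non-isomorphic, and every simple object is isomorphic
to one of them. -/
structure IsListOfSimples {C : Type u} [Category.{v} C] [HasZeroMorphisms C] {n : ℕ}
    (S : Fin n → C) : Prop where
  simple : ∀ i, Simple (S i)
  distinct : ∀ i j, Nonempty (S i ≅ S j) → i = j
  complete : ∀ X : C, Simple X → ∃ i, Nonempty (X ≅ S i)

/-- `θ` is a ribbon twist on a braided category with the given duals. -/
structure IsRibbonTwist {C : Type u} [Category.{v} C] [MonoidalCategory C] [BraidedCategory C]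
    [RigidCategory C] (θ : ∀ X : C, X ≅ X) : Prop where
  natural : ∀ {X Y : C} (f : X ⟶ Y), f ≫ (θ Y).hom = (θ X).hom ≫ f
  unit : (θ (𝟙_ C)).hom = 𝟙 (𝟙_ C)
  tensor : ∀ X Y : C,
    (θ (X ⊗ Y)).hom = ((θ X).hom ⊗ₘ (θ Y).hom) ≫ (β_ X Y).hom ≫ (β_ Y X).hom
  dual : ∀ X : C, (θ (Xᘁ)).hom = ((θ X).hom)ᘁ

/-- A `ℂ`-linear braided monoidal category with twist `θ` is a modular category: it is a
(split) semisimple `ℂ`-linear rigid monoidal category with finitely many simple objects, bilinear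
tensor product and simple unit, `θ` is a ribbon twist, and the matrix
`s i j = tr (c_{S j, S i} ∘ c_{S i, S j})`, indexed by the simple objects, is invertible. -/
structure IsModular (C : Type u) [Category.{v} C] [Preadditive C] [Linear ℂ C]
    [MonoidalCategory C] [BraidedCategory C] (θ : ∀ X : C, X ≅ X) : Prop where
  monoidalPreadditive : MonoidalPreadditive C
  monoidalLinear : MonoidalLinear ℂ C
  finiteDimensional : ∀ X Y : C, FiniteDimensional ℂ (X ⟶ Y)
  hasFiniteBiproducts : HasFiniteBiproducts C
  semisimple : ∀ X : C, ∃ (n : ℕ) (S : Fin n → C),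
    (∀ i, Simple (S i)) ∧ Nonempty (X ≅ ⨁ S)
  schur_self : ∀ X : C, Simple X → Module.finrank ℂ (X ⟶ X) = 1
  schur_ne : ∀ X Y : C, Simple X → Simple Y → IsEmpty (X ≅ Y) → ∀ f : X ⟶ Y, f = 0
  simple_unit : Simple (𝟙_ C)
  ribbon_nondegenerate : ∃ _ : RigidCategory C, IsRibbonTwist θ ∧
    ∃ (n : ℕ) (S : Fin n → C) (s : Matrix (Fin n) (Fin n) ℂ), IsListOfSimples S ∧
      (∀ i j, qtrace θ (S i ⊗ S j) ((S i ⊗ S j)ᘁ) ((β_ (S i) (S j)).hom ≫ (β_ (S j) (S i)).hom) =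
        s i j • 𝟙 (𝟙_ C)) ∧
      IsUnit s.det

/-- A unitary structure on a `ℂ`-linear braided monoidal category with twist `θ`: a positive
conjugate-linear dagger, compatible with the tensor product, for which all structure
isomorphisms are unitary, and for which duals can be chosen so that the dagger of the
coevaluation is the evaluation of the opposite pairing given by braiding and twist. -/
structure UnitaryStructure (C : Type u) [Category.{v} C] [Preadditive C] [Linear ℂ C]
    [MonoidalCategory C] [BraidedCategory C] (θ : ∀ X : C, X ≅ X) where
  dag : ∀ {X Y : C}, (X ⟶ Y) → (Y ⟶ X)
  dag_dag : ∀ {X Y : C} (f : X ⟶ Y), dag (dag f) = f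
  dag_id : ∀ X : C, dag (𝟙 X) = 𝟙 X
  dag_comp : ∀ {X Y Z : C} (f : X ⟶ Y) (g : Y ⟶ Z), dag (f ≫ g) = dag g ≫ dag f
  dag_add : ∀ {X Y : C} (f g : X ⟶ Y), dag (f + g) = dag f + dag g
  dag_smul : ∀ {X Y : C} (c : ℂ) (f : X ⟶ Y), dag (c • f) = (starRingEnd ℂ c) • dag f
  dag_pos : ∀ {X Y : C} (f : X ⟶ Y), f ≫ dag f = 0 → f = 0
  dag_tensor : ∀ {X Y X' Y' : C} (f : X ⟶ Y) (g : X' ⟶ Y'), dag (f ⊗ₘ g) = dag f ⊗ₘ dag g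
  dag_associator : ∀ X Y Z : C, dag (α_ X Y Z).hom = (α_ X Y Z).inv
  dag_leftUnitor : ∀ X : C, dag (λ_ X).hom = (λ_ X).inv
  dag_rightUnitor : ∀ X : C, dag (ρ_ X).hom = (ρ_ X).inv
  dag_braiding : ∀ X Y : C, dag (β_ X Y).hom = (β_ X Y).inv
  dag_twist : ∀ X : C, dag (θ X).hom = (θ X).inv
  dag_coevaluation : ∀ X : C, ∃ (Y : C) (_ : ExactPairing X Y),
    dag (η_ X Y) = (θ X).hom ▷ Y ≫ (β_ X Y).hom ≫ ε_ X Y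

/-- Equivalence of `ℂ`-linear ribbon categories: a `ℂ`-linear braided (strong) monoidal equivalence
that preserves the twists. -/
def RibbonEquivalent (C : Type u₁) [Category.{v₁} C] [Preadditive C] [Linear ℂ C]
    [MonoidalCategory C] [BraidedCategory C] (θ : ∀ X : C, X ≅ X)
    (D : Type u₂) [Category.{v₂} D] [Preadditive D] [Linear ℂ D]
    [MonoidalCategory D] [BraidedCategory D] (θ' : ∀ X : D, X ≅ X) : Prop :=
  ∃ (F : C ⥤ D) (_ : F.Braided) (_ : F.Additive),
    F.Linear ℂ ∧ F.IsEquivalence ∧ ∀ X : C, F.map (θ X).hom = (θ' (F.obj X)).hom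

/-! ## Condensable algebras -/

section

variable {C : Type u} [Category.{v} C] [MonoidalCategory C] [BraidedCategory C]

/-- The Frobenius relations between a multiplication and a comultiplication. -/
structure IsFrobenius (A : C) [MonObj A] [ComonObj A] : Prop where
  left : Δ[A] ▷ A ≫ (α_ A A A).hom ≫ A ◁ μ[A] = μ[A] ≫ Δ[A]
  right : A ◁ Δ[A] ≫ (α_ A A A).inv ≫ μ[A] ▷ A = μ[A] ≫ Δ[A]

/-- A Frobenius algebra is symmetric when the two maps from `A` to its dual induced by the pairing
`ε ∘ μ` agree; `Y` is a right dual of `A`, and it is a left dual through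
`(Y ⊗ θ_A) ∘ c_{A,Y} ∘ coev : 𝟙 ⟶ Y ⊗ A`. -/
def IsSymmetricFrobenius (θ : ∀ X : C, X ≅ X) (A : C) [MonObj A] [ComonObj A] : Prop :=
  ∀ (Y : C) [ExactPairing A Y],
    (ρ_ A).inv ≫ A ◁ η_ A Y ≫ (α_ A A Y).inv ≫ (μ[A] ≫ ε[A]) ▷ Y ≫ (λ_ Y).hom =
      (λ_ A).inv ≫ (η_ A Y ≫ (β_ A Y).hom ≫ Y ◁ (θ A).hom) ▷ A ≫ (α_ Y A A).hom ≫
        Y ◁ (μ[A] ≫ ε[A]) ≫ (ρ_ Y).hom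

/-- A special Frobenius algebra, normalized so that `μ ∘ Δ = id` and `ε ∘ ι = dim A`. -/
structure IsNormalizedSpecial (θ : ∀ X : C, X ≅ X) (A : C) [MonObj A] [ComonObj A] : Prop where
  comul_mul : Δ[A] ≫ μ[A] = 𝟙 A
  one_counit : ∀ (Y : C) [ExactPairing A Y], η[A] ≫ ε[A] = qtrace θ A Y (𝟙 A)

/-- 2d-condensable algebras: connected commutative algebras that carry the structure of a
symmetric normalized-special Frobenius algebra. -/
structure IsCondensable [Preadditive C] [Linear ℂ C] (θ : ∀ X : C, X ≅ X) (A : C) [MonObj A] :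
    Prop where
  connected : Module.finrank ℂ (𝟙_ C ⟶ A) = 1
  commutative : (β_ A A).hom ≫ μ[A] = μ[A]
  frobenius : ∃ _ : ComonObj A,
    IsFrobenius A ∧ IsSymmetricFrobenius θ A ∧ IsNormalizedSpecial θ A

end

/-! ## Right modules and local modules -/

/-- A right module over the algebra `A`. -/
structure RMod {C : Type u} [Category.{v} C] [MonoidalCategory C] (A : C) [MonObj A] where
  X : C
  act : X ⊗ A ⟶ X
  act_one : X ◁ η[A] ≫ act = (ρ_ X).hom
  act_assoc : act ▷ A ≫ act = (α_ X A A).hom ≫ X ◁ μ[A] ≫ act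

namespace RMod

section

variable {C : Type u} [Category.{v} C] [MonoidalCategory C] {A : C} [MonObj A]

/-- Module maps. -/
@[ext]
structure Hom (M N : RMod A) where
  hom : M.X ⟶ N.X
  linear : M.act ≫ hom = hom ▷ A ≫ N.act

instance : Category (RMod A) where
  Hom M N := Hom M N
  id M := ⟨𝟙 M.X, by simp⟩
  comp f g := ⟨f.hom ≫ g.hom, by
    rw [← Category.assoc, f.linear, Category.assoc, g.linear]; simp⟩
  id_comp f := Hom.ext (Category.id_comp _)
  comp_id f := Hom.ext (Category.comp_id _)
  assoc f g h := Hom.ext (Category.assoc _ _ _)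

@[ext]
theorem hom_ext {M N : RMod A} {f g : M ⟶ N} (h : f.hom = g.hom) : f = g := Hom.ext h

@[simp]
theorem id_hom (M : RMod A) : Hom.hom (𝟙 M) = 𝟙 M.X := rfl

@[simp]
theorem comp_hom {M N P : RMod A} (f : M ⟶ N) (g : N ⟶ P) :
    Hom.hom (f ≫ g) = f.hom ≫ g.hom := rfl

/-- The underlying object of a module. -/
@[simps]
def forget (A : C) [MonObj A] : RMod A ⥤ C where
  obj M := M.X
  map f := f.hom

/-- `A` as a module over itself. -/
@[simps]
def regular (A : C) [MonObj A] : RMod A where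
  X := A
  act := μ[A]
  act_one := MonObj.mul_one A
  act_assoc := MonObj.mul_assoc A

variable [Preadditive C] [MonoidalPreadditive C]

instance (M N : RMod A) : Zero (M ⟶ N) := ⟨⟨0, by simp⟩⟩

instance (M N : RMod A) : Add (M ⟶ N) :=
  ⟨fun f g => ⟨f.hom + g.hom, by simp [f.linear, g.linear]⟩⟩

instance (M N : RMod A) : Neg (M ⟶ N) :=
  ⟨fun f => ⟨-f.hom, by
    have h : (-f.hom) ▷ A = -(f.hom ▷ A) := (tensorRight A).map_neg
    rw [h]; simp [f.linear]⟩⟩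

@[simp]
theorem zero_hom (M N : RMod A) : Hom.hom (0 : M ⟶ N) = 0 := rfl

@[simp]
theorem add_hom {M N : RMod A} (f g : M ⟶ N) : Hom.hom (f + g) = f.hom + g.hom := rfl

@[simp]
theorem neg_hom {M N : RMod A} (f : M ⟶ N) : Hom.hom (-f) = -f.hom := rfl

instance (M N : RMod A) : AddCommGroup (M ⟶ N) where
  add_assoc _ _ _ := by ext; simp [add_assoc]
  zero_add _ := by ext; simp
  add_zero _ := by ext; simp
  nsmul := nsmulRec
  zsmul := zsmulRec
  neg_add_cancel _ := by ext; simp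
  add_comm _ _ := by ext; simp [add_comm]

instance : Preadditive (RMod A) where
  add_comp _ _ _ _ _ _ := by ext; simp
  comp_add _ _ _ _ _ _ := by ext; simp

variable [Linear ℂ C] [MonoidalLinear ℂ C]

instance (M N : RMod A) : SMul ℂ (M ⟶ N) :=
  ⟨fun c f => ⟨c • f.hom, by simp [f.linear]⟩⟩

@[simp]
theorem smul_hom {M N : RMod A} (c : ℂ) (f : M ⟶ N) : Hom.hom (c • f) = c • f.hom := rfl

instance (M N : RMod A) : Module ℂ (M ⟶ N) where
  one_smul _ := by ext; simp
  mul_smul _ _ _ := by ext; simp [mul_smul]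
  smul_zero _ := by ext; simp
  smul_add _ _ _ := by ext; simp
  add_smul _ _ _ := by ext; simp [add_smul]
  zero_smul _ := by ext; simp

instance : Linear ℂ (RMod A) where
  smul_comp _ _ _ _ _ _ := by ext; simp
  comp_smul _ _ _ _ _ _ := by ext; simp

end

section

variable {C : Type u} [Category.{v} C] [MonoidalCategory C] [BraidedCategory C]

/-- Local modules: the action is unchanged by the double braiding of the module with `A`. -/
def IsLocal (A : C) [MonObj A] : ObjectProperty (RMod A) :=
  fun M => (β_ M.X A).hom ≫ (β_ A M.X).hom ≫ M.act = M.act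

end

end RMod

section

variable {C : Type u} [Category.{v} C] [MonoidalCategory C] [BraidedCategory C]

/-- The category of local modules over `A` and module maps. -/
abbrev LocMod (A : C) [MonObj A] := (RMod.IsLocal A).FullSubcategory

/-- The underlying object of a local module. -/
abbrev LocMod.forget (A : C) [MonObj A] : LocMod A ⥤ C :=
  (RMod.IsLocal A).ι ⋙ RMod.forget A

/-- The braided monoidal structure and the twist of the category of local modules over a
commutative algebra `A`. The tensor product `M ⊗_A N` comes with a projection
`μ_{M,N} : M ⊗ N ⟶ M ⊗_A N` that is the coequalizer of the two actions of `A` on `M ⊗ N`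
(`A` acts on `N` from the left through the braiding), the action of `A` on `M ⊗_A N` is induced by
the one on `N`, the unit is `A`, and associator, unitors, braiding and twist are induced by
those of the ambient category: the forgetful functor, with the maps `μ_{M,N}`, is lax braided
monoidal and preserves twists. These conditions determine the structure up to a unique
isomorphism that is compatible with the projections. -/
structure LocModStructure (θ : ∀ X : C, X ≅ X) (A : C) [MonObj A] where
  monoidal : MonoidalCategory (LocMod A)
  braided : BraidedCategory (LocMod A)
  twist : ∀ M : LocMod A, M ≅ M
  laxBraided : (LocMod.forget A).LaxBraided
  act_tensor : ∀ M N : LocMod A,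
    (α_ M.obj.X N.obj.X A).hom ≫ M.obj.X ◁ N.obj.act ≫
        Functor.LaxMonoidal.μ (LocMod.forget A) M N =
      Functor.LaxMonoidal.μ (LocMod.forget A) M N ▷ A ≫ (M ⊗ N).obj.act
  balanced : ∀ M N : LocMod A,
    (M.obj.act ▷ N.obj.X) ≫ Functor.LaxMonoidal.μ (LocMod.forget A) M N =
      ((α_ M.obj.X A N.obj.X).hom ≫ M.obj.X ◁ ((β_ A N.obj.X).hom ≫ N.obj.act)) ≫
        Functor.LaxMonoidal.μ (LocMod.forget A) M N
  coequalizer : ∀ M N : LocMod A, Nonempty (IsColimit (Cofork.ofπ _ (balanced M N)))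
  unitIso : (𝟙_ (LocMod A)).obj ≅ RMod.regular A
  unit_comp : Functor.LaxMonoidal.ε (LocMod.forget A) ≫ unitIso.hom.hom = η[A]
  twist_hom : ∀ M : LocMod A, (twist M).hom.hom.hom = (θ M.obj.X).hom

end

end Modular

/-! ## Pointed anyon theories

The simple objects are the elements of a finite abelian group `G`, fusion is the addition of `G`,
and associator, braiding and twist of simple objects are powers of the imaginary unit `i`. -/

namespace Pointed

/-- `phase k = i ^ k`. -/
def phase (k : ZMod 4) : ℂ := Complex.I ^ k.val

theorem phase_zero : phase 0 = 1 := by simp [phase]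

theorem phase_add (a b : ZMod 4) : phase (a + b) = phase a * phase b := by
  rw [phase, phase, phase, ← pow_add, ZMod.val_add]
  exact (pow_eq_pow_mod _ Complex.I_pow_four).symm

/-- Associator, braiding and twist of a pointed theory, as exponents of `i`, subject to the
pentagon, triangle, hexagon and balancing equations. -/
structure AnyonData (G : Type) [AddCommGroup G] where
  F : G → G → G → ZMod 4
  R : G → G → ZMod 4
  T : G → ZMod 4
  triangle : ∀ a b, F a 0 b = 0
  pentagon : ∀ a b c d,
    F a b c + F a (b + c) d + F b c d = F (a + b) c d + F a b (c + d)
  hexagon : ∀ a b c, F a b c + R a (b + c) + F b c a = R a b + F b a c + R a c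
  hexagon' : ∀ a b c, -F a b c + R (a + b) c - F c a b = R b c - F a c b + R a c
  balancing : ∀ a b, T (a + b) = T a + T b + R a b + R b a

variable {G : Type} [AddCommGroup G]

/-- Objects are formal finite direct sums of simple objects: `idx` indexes the summands, and the
summand `i` is the simple object `deg i`. -/
structure AnyonCat (D : AnyonData G) where
  idx : Type
  [fintype : Fintype idx]
  [decEq : DecidableEq idx]
  deg : idx → G

namespace AnyonCat

attribute [instance] AnyonCat.fintype AnyonCat.decEq

variable {D : AnyonData G}

/-- A morphism is a complex matrix (rows indexed by the source) whose entries between different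
simple objects vanish. -/
@[ext]
structure Hom (X Y : AnyonCat D) where
  mat : Matrix X.idx Y.idx ℂ
  deg_eq : ∀ i j, mat i j ≠ 0 → X.deg i = Y.deg j

instance : Category (AnyonCat D) where
  Hom X Y := Hom X Y
  id X := ⟨1, fun i j h => by
    by_cases hij : i = j
    · rw [hij]
    · exact absurd (Matrix.one_apply_ne hij) h⟩
  comp f g := ⟨f.mat * g.mat, fun i j h => by
    rw [Matrix.mul_apply] at h
    obtain ⟨k, -, hk⟩ := Finset.exists_ne_zero_of_sum_ne_zero h
    exact (f.deg_eq i k (left_ne_zero_of_mul hk)).trans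
      (g.deg_eq k j (right_ne_zero_of_mul hk))⟩
  id_comp f := Hom.ext (Matrix.one_mul _)
  comp_id f := Hom.ext (Matrix.mul_one _)
  assoc f g h := Hom.ext (Matrix.mul_assoc _ _ _)

@[ext]
theorem hom_ext {X Y : AnyonCat D} {f g : X ⟶ Y} (h : f.mat = g.mat) : f = g := Hom.ext h

@[simp]
theorem id_mat (X : AnyonCat D) : Hom.mat (𝟙 X) = 1 := rfl

@[simp]
theorem comp_mat {X Y Z : AnyonCat D} (f : X ⟶ Y) (g : Y ⟶ Z) :
    Hom.mat (f ≫ g) = f.mat * g.mat := rfl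

/-! ### Linear structure -/

instance (X Y : AnyonCat D) : Zero (X ⟶ Y) := ⟨⟨0, fun _ _ h => absurd rfl h⟩⟩

instance (X Y : AnyonCat D) : Add (X ⟶ Y) :=
  ⟨fun f g => ⟨f.mat + g.mat, fun i j h => by
    by_contra hd
    exact h (by
      rw [Matrix.add_apply, not_imp_comm.1 (f.deg_eq i j) hd, not_imp_comm.1 (g.deg_eq i j) hd,
        add_zero])⟩⟩

instance (X Y : AnyonCat D) : SMul ℂ (X ⟶ Y) :=
  ⟨fun c f => ⟨c • f.mat, fun i j h => by
    by_contra hd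
    exact h (by rw [Matrix.smul_apply, not_imp_comm.1 (f.deg_eq i j) hd, smul_zero])⟩⟩

instance (X Y : AnyonCat D) : Neg (X ⟶ Y) :=
  ⟨fun f => ⟨-f.mat, fun i j h => f.deg_eq i j (by simpa using h)⟩⟩

@[simp]
theorem zero_mat (X Y : AnyonCat D) : Hom.mat (0 : X ⟶ Y) = 0 := rfl

@[simp]
theorem add_mat {X Y : AnyonCat D} (f g : X ⟶ Y) : Hom.mat (f + g) = f.mat + g.mat := rfl

@[simp]
theorem neg_mat {X Y : AnyonCat D} (f : X ⟶ Y) : Hom.mat (-f) = -f.mat := rfl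

@[simp]
theorem smul_mat {X Y : AnyonCat D} (c : ℂ) (f : X ⟶ Y) : Hom.mat (c • f) = c • f.mat := rfl

instance (X Y : AnyonCat D) : AddCommGroup (X ⟶ Y) where
  add_assoc _ _ _ := by ext : 1; simp [add_assoc]
  zero_add _ := by ext : 1; simp
  add_zero _ := by ext : 1; simp
  nsmul := nsmulRec
  zsmul := zsmulRec
  neg_add_cancel _ := by ext : 1; simp
  add_comm _ _ := by ext : 1; simp [add_comm]

instance (X Y : AnyonCat D) : Module ℂ (X ⟶ Y) where
  one_smul _ := by ext : 1; simp
  mul_smul _ _ _ := by ext : 1; simp [mul_smul]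
  smul_zero _ := by ext : 1; simp
  smul_add _ _ _ := by ext : 1; simp
  add_smul _ _ _ := by ext : 1; simp [add_smul]
  zero_smul _ := by ext : 1; simp

instance : Preadditive (AnyonCat D) where
  add_comp _ _ _ _ _ _ := by ext : 1; simp [Matrix.add_mul]
  comp_add _ _ _ _ _ _ := by ext : 1; simp [Matrix.mul_add]

instance : Linear ℂ (AnyonCat D) where
  smul_comp _ _ _ _ _ _ := by ext : 1; simp
  comp_smul _ _ _ _ _ _ := by ext : 1; simp

/-- The simple object labelled by `g`. -/
@[simps]
def simpleObj (D : AnyonData G) (g : G) : AnyonCat D where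
  idx := Unit
  deg _ := g

/-- The direct sum. -/
@[simps]
def sum (X Y : AnyonCat D) : AnyonCat D where
  idx := X.idx ⊕ Y.idx
  deg := Sum.elim X.deg Y.deg

theorem one_deg (X : AnyonCat D) (i j : X.idx) (h : (1 : Matrix X.idx X.idx ℂ) i j ≠ 0) :
    X.deg i = X.deg j :=
  Hom.deg_eq (𝟙 X) i j h

/-- The direct sum is a biproduct. -/
def sumBicone (X Y : AnyonCat D) : BinaryBicone X Y where
  pt := sum X Y
  fst := ⟨Matrix.fromRows (1 : Matrix X.idx X.idx ℂ) (0 : Matrix Y.idx X.idx ℂ), by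
    rintro (i | i) j h
    · exact one_deg X i j h
    · exact absurd rfl h⟩
  snd := ⟨Matrix.fromRows (0 : Matrix X.idx Y.idx ℂ) (1 : Matrix Y.idx Y.idx ℂ), by
    rintro (i | i) j h
    · exact absurd rfl h
    · exact one_deg Y i j h⟩
  inl := ⟨Matrix.fromCols (1 : Matrix X.idx X.idx ℂ) (0 : Matrix X.idx Y.idx ℂ), by
    rintro i (j | j) h
    · exact one_deg X i j h
    · exact absurd rfl h⟩
  inr := ⟨Matrix.fromCols (0 : Matrix Y.idx X.idx ℂ) (1 : Matrix Y.idx Y.idx ℂ), by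
    rintro i (j | j) h
    · exact absurd rfl h
    · exact one_deg Y i j h⟩
  inl_fst := Hom.ext ((Matrix.fromCols_mul_fromRows _ _ _ _).trans (by simp))
  inl_snd := Hom.ext ((Matrix.fromCols_mul_fromRows _ _ _ _).trans (by simp))
  inr_fst := Hom.ext ((Matrix.fromCols_mul_fromRows _ _ _ _).trans (by simp))
  inr_snd := Hom.ext ((Matrix.fromCols_mul_fromRows _ _ _ _).trans (by simp))

instance : HasBinaryBiproducts (AnyonCat D) where
  has_binary_biproduct X Y := HasBinaryBiproduct.mk
    { bicone := sumBicone X Y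
      isBilimit := isBinaryBilimitOfTotal _ (Hom.ext (by
        refine (congrArg₂ (· + ·) (Matrix.fromRows_mul_fromCols _ _ _ _)
          (Matrix.fromRows_mul_fromCols _ _ _ _)).trans ?_
        refine (Matrix.fromBlocks_add _ _ _ _ _ _ _ _).trans ?_
        refine Eq.trans ?_ Matrix.fromBlocks_one
        congr 1 <;> simp)) }

/-! ### Monoidal structure -/

/-- The isomorphism that matches the summands of `X` with those of `Y` along `e`, with the scalar
`i ^ φ` on each summand. -/
@[simps]
def monomial {X Y : AnyonCat D} (e : X.idx ≃ Y.idx) (he : ∀ i, X.deg i = Y.deg (e i))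
    (φ : X.idx → ZMod 4) : X ≅ Y where
  hom := ⟨Matrix.of fun i j => if e i = j then phase (φ i) else 0, fun i j h => by
    have h' : e i = j := by
      by_contra hne
      exact h (by simp [hne])
    rw [he, h']⟩
  inv := ⟨Matrix.of fun j i => if e i = j then phase (-φ i) else 0, fun j i h => by
    have h' : e i = j := by
      by_contra hne
      exact h (by simp [hne])
    rw [he, h']⟩
  hom_inv_id := by
    ext i j
    by_cases h : i = j
    · subst h
      simp [Matrix.mul_apply, ← phase_add, phase_zero]
    · simp [Matrix.mul_apply, h]
  inv_hom_id := by
    ext i j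
    obtain ⟨i, rfl⟩ := e.surjective i
    obtain ⟨j, rfl⟩ := e.surjective j
    by_cases h : i = j
    · subst h
      simp [Matrix.mul_apply, ← phase_add, phase_zero]
    · have h' : ¬ j = i := fun hh => h hh.symm
      simp [Matrix.mul_apply, h, h']

theorem monomial_comp {X Y Z : AnyonCat D} (e : X.idx ≃ Y.idx) (he) (φ) (g : Y ⟶ Z) (i j) :
    Hom.mat ((monomial e he φ).hom ≫ g) i j = phase (φ i) * g.mat (e i) j := by
  simp [Matrix.mul_apply]

theorem comp_monomial {X Y Z : AnyonCat D} (e : Y.idx ≃ Z.idx) (he) (φ) (g : X ⟶ Y) (i j) :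
    Hom.mat (g ≫ (monomial e he φ).hom) i (e j) = g.mat i j * phase (φ j) := by
  simp [Matrix.mul_apply]

/-- `f` is the morphism that matches the summands along `e`, with scalars `i ^ φ`. -/
def IsMonomial {X Y : AnyonCat D} (f : X ⟶ Y) (e : X.idx → Y.idx) (φ : X.idx → ZMod 4) : Prop :=
  ∀ i j, f.mat i j = if e i = j then phase (φ i) else 0

theorem isMonomial_hom {X Y : AnyonCat D} (e : X.idx ≃ Y.idx) (he) (φ) :
    IsMonomial (monomial e he φ).hom e φ := fun _ _ => rfl

theorem isMonomial_inv {X Y : AnyonCat D} (e : X.idx ≃ Y.idx) (he) (φ) :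
    IsMonomial (monomial (X := X) (Y := Y) e he φ).inv e.symm (fun i => -φ (e.symm i)) := by
  intro j i
  by_cases h : e i = j
  · subst h
    simp
  · have h' : ¬ e.symm j = i := fun hh => h (by rw [← hh, Equiv.apply_symm_apply])
    simp [h, h']

theorem IsMonomial.comp {X Y Z : AnyonCat D} {f : X ⟶ Y} {g : Y ⟶ Z} {e φ e' φ'}
    (hf : IsMonomial f e φ) (hg : IsMonomial g e' φ') :
    IsMonomial (f ≫ g) (fun i => e' (e i)) (fun i => φ i + φ' (e i)) := by
  intro i j
  rw [comp_mat, Matrix.mul_apply, Finset.sum_eq_single (e i)]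
  · rw [hf, hg, if_pos rfl, phase_add, mul_ite, mul_zero]
  · intro k _ hk
    rw [hf, if_neg hk.symm, zero_mul]
  · exact fun h => absurd (Finset.mem_univ _) h

theorem IsMonomial.ext {X Y : AnyonCat D} {f g : X ⟶ Y} {e φ e' φ'}
    (hf : IsMonomial f e φ) (hg : IsMonomial g e' φ') (h : ∀ i, e i = e' i)
    (h' : ∀ i, φ i = φ' i) : f = g := by
  ext i j
  rw [hf, hg, h, h']

theorem mat_eq_zero {X Y : AnyonCat D} (f : X ⟶ Y) {i j} (h : X.deg i ≠ Y.deg j) :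
    f.mat i j = 0 :=
  not_imp_comm.1 (f.deg_eq i j) h

/-- The tensor product of objects: it is distributive over direct sums, and `g ⊗ h = g + h` for
simple objects. -/
@[simps]
def tensor (X Y : AnyonCat D) : AnyonCat D where
  idx := X.idx × Y.idx
  deg p := X.deg p.1 + Y.deg p.2

/-- The tensor product of morphisms. -/
def tensorMap {X Y X' Y' : AnyonCat D} (f : X ⟶ Y) (g : X' ⟶ Y') :
    tensor X X' ⟶ tensor Y Y' :=
  ⟨Matrix.of fun p q => f.mat p.1 q.1 * g.mat p.2 q.2, fun p q h => by
    exact congrArg₂ (· + ·) (f.deg_eq p.1 q.1 (left_ne_zero_of_mul h))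
      (g.deg_eq p.2 q.2 (right_ne_zero_of_mul h))⟩

theorem tensorMap_mat {X Y X' Y' : AnyonCat D} (f : X ⟶ Y) (g : X' ⟶ Y') (p q) :
    Hom.mat (tensorMap f g) p q = f.mat p.1 q.1 * g.mat p.2 q.2 := rfl

/-- Reassociation of summands. -/
def assocEquiv (X Y Z : AnyonCat D) :
    (tensor (tensor X Y) Z).idx ≃ (tensor X (tensor Y Z)).idx := Equiv.prodAssoc _ _ _

theorem assocEquiv_deg (X Y Z : AnyonCat D) (p : (tensor (tensor X Y) Z).idx) :
    (tensor (tensor X Y) Z).deg p = (tensor X (tensor Y Z)).deg (assocEquiv X Y Z p) :=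
  add_assoc _ _ _

/-- The phase of the associator. -/
def assocPhase (X Y Z : AnyonCat D) (p : (tensor (tensor X Y) Z).idx) : ZMod 4 :=
  D.F (X.deg p.1.1) (Y.deg p.1.2) (Z.deg p.2)

/-- The object `𝟙 ⊗ X` has the same summands as `X`. -/
def leftEquiv (X : AnyonCat D) : (tensor (simpleObj D 0) X).idx ≃ X.idx := Equiv.punitProd _

theorem leftEquiv_deg (X : AnyonCat D) (p : (tensor (simpleObj D 0) X).idx) :
    (tensor (simpleObj D 0) X).deg p = X.deg (leftEquiv X p) := zero_add _

/-- The object `X ⊗ 𝟙` has the same summands as `X`. -/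
def rightEquiv (X : AnyonCat D) : (tensor X (simpleObj D 0)).idx ≃ X.idx := Equiv.prodPUnit _

theorem rightEquiv_deg (X : AnyonCat D) (p : (tensor X (simpleObj D 0)).idx) :
    (tensor X (simpleObj D 0)).deg p = X.deg (rightEquiv X p) := add_zero _

/-- Exchange of summands. -/
def swapEquiv (X Y : AnyonCat D) : (tensor X Y).idx ≃ (tensor Y X).idx := Equiv.prodComm _ _

theorem swapEquiv_deg (X Y : AnyonCat D) (p : (tensor X Y).idx) :
    (tensor X Y).deg p = (tensor Y X).deg (swapEquiv X Y p) := add_comm _ _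

/-- The phase of the braiding. -/
def swapPhase (X Y : AnyonCat D) (p : (tensor X Y).idx) : ZMod 4 := D.R (X.deg p.1) (Y.deg p.2)

instance : MonoidalCategoryStruct (AnyonCat D) where
  tensorObj := tensor
  tensorHom := tensorMap
  whiskerLeft X _ _ g := tensorMap (𝟙 X) g
  whiskerRight f Y := tensorMap f (𝟙 Y)
  tensorUnit := simpleObj D 0
  associator X Y Z := monomial (assocEquiv X Y Z) (assocEquiv_deg X Y Z) (assocPhase X Y Z)
  leftUnitor X := monomial (leftEquiv X) (leftEquiv_deg X) (fun _ => 0)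
  rightUnitor X := monomial (rightEquiv X) (rightEquiv_deg X) (fun _ => 0)

theorem tensorMap_id (X Y : AnyonCat D) : tensorMap (𝟙 X) (𝟙 Y) = 𝟙 (tensor X Y) := by
  ext p q
  rw [tensorMap_mat]
  obtain ⟨i, j⟩ := p
  obtain ⟨k, l⟩ := q
  change (1 : Matrix _ _ ℂ) i k * (1 : Matrix _ _ ℂ) j l =
    (1 : Matrix (X.idx × Y.idx) (X.idx × Y.idx) ℂ) (i, j) (k, l)
  by_cases h : i = k <;> by_cases h' : j = l <;> simp [Matrix.one_apply, h, h']

theorem tensorMap_comp {X₁ Y₁ Z₁ X₂ Y₂ Z₂ : AnyonCat D} (f₁ : X₁ ⟶ Y₁) (f₂ : X₂ ⟶ Y₂)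
    (g₁ : Y₁ ⟶ Z₁) (g₂ : Y₂ ⟶ Z₂) :
    tensorMap f₁ f₂ ≫ tensorMap g₁ g₂ = tensorMap (f₁ ≫ g₁) (f₂ ≫ g₂) := by
  ext p q
  simp only [comp_mat, tensorMap_mat, Matrix.mul_apply, Finset.sum_mul_sum]
  rw [← Finset.sum_product']
  exact Finset.sum_congr rfl fun _ _ => by ring

theorem IsMonomial.whiskerLeft (X : AnyonCat D) {Y Z : AnyonCat D} {f : Y ⟶ Z} {e φ}
    (hf : IsMonomial f e φ) :
    IsMonomial (X ◁ f) (fun p => (p.1, e p.2)) (fun p => φ p.2) := by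
  rintro ⟨i, j⟩ ⟨k, l⟩
  change (1 : Matrix _ _ ℂ) i k * f.mat j l =
    if ((i, e j) : X.idx × Z.idx) = (k, l) then phase (φ j) else 0
  rw [hf]
  by_cases h : i = k <;> by_cases h' : e j = l <;> simp [Matrix.one_apply, h, h']

theorem IsMonomial.whiskerRight {X Y : AnyonCat D} {f : X ⟶ Y} {e φ} (hf : IsMonomial f e φ)
    (Z : AnyonCat D) :
    IsMonomial (f ▷ Z) (fun p => (e p.1, p.2)) (fun p => φ p.1) := by
  rintro ⟨i, j⟩ ⟨k, l⟩
  change f.mat i k * (1 : Matrix _ _ ℂ) j l =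
    if ((e i, j) : Y.idx × Z.idx) = (k, l) then phase (φ i) else 0
  rw [hf]
  by_cases h : e i = k <;> by_cases h' : j = l <;> simp [Matrix.one_apply, h, h']

theorem isMonomial_associator (X Y Z : AnyonCat D) :
    IsMonomial (α_ X Y Z).hom (fun p => (p.1.1, p.1.2, p.2))
      (fun p => D.F (X.deg p.1.1) (Y.deg p.1.2) (Z.deg p.2)) := fun _ _ => rfl

theorem isMonomial_associator_inv (X Y Z : AnyonCat D) :
    IsMonomial (α_ X Y Z).inv (fun p => ((p.1, p.2.1), p.2.2))
      (fun p => -D.F (X.deg p.1) (Y.deg p.2.1) (Z.deg p.2.2)) :=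
  isMonomial_inv (assocEquiv X Y Z) (assocEquiv_deg X Y Z) (assocPhase X Y Z)

theorem isMonomial_leftUnitor (X : AnyonCat D) :
    IsMonomial (λ_ X).hom (fun p : Unit × X.idx => p.2) (fun _ => 0) := fun _ _ => rfl

theorem isMonomial_rightUnitor (X : AnyonCat D) :
    IsMonomial (ρ_ X).hom (fun p : X.idx × Unit => p.1) (fun _ => 0) := fun _ _ => rfl

instance : MonoidalCategory (AnyonCat D) := MonoidalCategory.ofTensorHom
  (id_tensorHom_id := tensorMap_id)
  (id_tensorHom := fun _ _ _ _ => rfl)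
  (tensorHom_id := fun _ _ => rfl)
  (tensorHom_comp_tensorHom := tensorMap_comp)
  (associator_naturality := fun {X₁ X₂ X₃ Y₁ Y₂ Y₃} f₁ f₂ f₃ => by
    change tensorMap (tensorMap f₁ f₂) f₃ ≫ (monomial (assocEquiv _ _ _) _ _).hom =
      (monomial (assocEquiv _ _ _) _ _).hom ≫ tensorMap f₁ (tensorMap f₂ f₃)
    ext p q
    obtain ⟨q, rfl⟩ := (assocEquiv _ _ _).surjective q
    rw [comp_monomial, monomial_comp]
    obtain ⟨⟨i, j⟩, k⟩ := p
    obtain ⟨⟨i', j'⟩, k'⟩ := q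
    change f₁.mat i i' * f₂.mat j j' * f₃.mat k k' *
        phase (D.F (Y₁.deg i') (Y₂.deg j') (Y₃.deg k')) =
      phase (D.F (X₁.deg i) (X₂.deg j) (X₃.deg k)) *
        (f₁.mat i i' * (f₂.mat j j' * f₃.mat k k'))
    by_cases h₁ : X₁.deg i = Y₁.deg i'
    · by_cases h₂ : X₂.deg j = Y₂.deg j'
      · by_cases h₃ : X₃.deg k = Y₃.deg k'
        · rw [h₁, h₂, h₃]; ring
        · rw [mat_eq_zero f₃ h₃]; ring
      · rw [mat_eq_zero f₂ h₂]; ring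
    · rw [mat_eq_zero f₁ h₁]; ring)
  (leftUnitor_naturality := fun {X Y} f => by
    change tensorMap (𝟙 (simpleObj D 0)) f ≫ (monomial (leftEquiv Y) _ _).hom =
      (monomial (leftEquiv X) _ _).hom ≫ f
    ext p q
    obtain ⟨q, rfl⟩ := (leftEquiv Y).surjective q
    rw [comp_monomial, monomial_comp, phase_zero, mul_one, one_mul, tensorMap_mat]
    exact (congrArg (· * _) (Matrix.one_apply_eq _)).trans (one_mul _))
  (rightUnitor_naturality := fun {X Y} f => by
    change tensorMap f (𝟙 (simpleObj D 0)) ≫ (monomial (rightEquiv Y) _ _).hom =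
      (monomial (rightEquiv X) _ _).hom ≫ f
    ext p q
    obtain ⟨q, rfl⟩ := (rightEquiv Y).surjective q
    rw [comp_monomial, monomial_comp, phase_zero, mul_one, one_mul, tensorMap_mat]
    exact (congrArg (_ * ·) (Matrix.one_apply_eq _)).trans (mul_one _))
  (pentagon := fun W X Y Z => IsMonomial.ext
    (((isMonomial_associator W X Y).whiskerRight Z).comp
      ((isMonomial_associator W (X ⊗ Y) Z).comp ((isMonomial_associator X Y Z).whiskerLeft W)))
    ((isMonomial_associator (W ⊗ X) Y Z).comp (isMonomial_associator W X (Y ⊗ Z)))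
    (fun _ => rfl)
    (fun p => (add_assoc _ _ _).symm.trans
      (D.pentagon (W.deg p.1.1.1) (X.deg p.1.1.2) (Y.deg p.1.2) (Z.deg p.2))))
  (triangle := fun X Y => IsMonomial.ext
    ((isMonomial_associator X (𝟙_ _) Y).comp ((isMonomial_leftUnitor Y).whiskerLeft X))
    ((isMonomial_rightUnitor X).whiskerRight Y) (fun _ => rfl)
    (fun _ => (add_zero _).trans (D.triangle _ _)))

instance : MonoidalPreadditive (AnyonCat D) where
  whiskerLeft_zero := Hom.ext (Matrix.ext fun _ _ => mul_zero _)
  zero_whiskerRight := Hom.ext (Matrix.ext fun _ _ => zero_mul _)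
  whiskerLeft_add _ _ := Hom.ext (Matrix.ext fun _ _ => mul_add _ _ _)
  add_whiskerRight _ _ := Hom.ext (Matrix.ext fun _ _ => add_mul _ _ _)

instance : MonoidalLinear ℂ (AnyonCat D) where
  whiskerLeft_smul _ _ _ _ _ := Hom.ext (Matrix.ext fun _ _ => mul_left_comm _ _ _)
  smul_whiskerRight _ _ _ _ _ := Hom.ext (Matrix.ext fun _ _ => mul_assoc _ _ _)

instance : BraidedCategory (AnyonCat D) where
  braiding X Y := monomial (swapEquiv X Y) (swapEquiv_deg X Y) (swapPhase X Y)
  braiding_naturality_right X Y Z f := by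
    change tensorMap (𝟙 X) f ≫ (monomial (swapEquiv X Z) _ _).hom =
      (monomial (swapEquiv X Y) _ _).hom ≫ tensorMap f (𝟙 X)
    ext p q
    obtain ⟨q, rfl⟩ := (swapEquiv _ _).surjective q
    rw [comp_monomial, monomial_comp]
    obtain ⟨i, j⟩ := p
    obtain ⟨i', j'⟩ := q
    change (1 : Matrix _ _ ℂ) i i' * f.mat j j' * phase (D.R (X.deg i') (Z.deg j')) =
      phase (D.R (X.deg i) (Y.deg j)) * (f.mat j j' * (1 : Matrix _ _ ℂ) i i')
    by_cases h : i = i'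
    · by_cases h' : Y.deg j = Z.deg j'
      · rw [h, h']; ring
      · rw [mat_eq_zero f h']; ring
    · rw [Matrix.one_apply_ne h]; ring
  braiding_naturality_left {X Y} f Z := by
    change tensorMap f (𝟙 Z) ≫ (monomial (swapEquiv Y Z) _ _).hom =
      (monomial (swapEquiv X Z) _ _).hom ≫ tensorMap (𝟙 Z) f
    ext p q
    obtain ⟨q, rfl⟩ := (swapEquiv _ _).surjective q
    rw [comp_monomial, monomial_comp]
    obtain ⟨i, j⟩ := p
    obtain ⟨i', j'⟩ := q
    change f.mat i i' * (1 : Matrix _ _ ℂ) j j' * phase (D.R (Y.deg i') (Z.deg j')) =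
      phase (D.R (X.deg i) (Z.deg j)) * ((1 : Matrix _ _ ℂ) j j' * f.mat i i')
    by_cases h : j = j'
    · by_cases h' : X.deg i = Y.deg i'
      · rw [h, h']; ring
      · rw [mat_eq_zero f h']; ring
    · rw [Matrix.one_apply_ne h]; ring
  hexagon_forward X Y Z := IsMonomial.ext
    ((isMonomial_associator X Y Z).comp
      ((isMonomial_hom (swapEquiv X (Y ⊗ Z)) (swapEquiv_deg X (Y ⊗ Z))
        (swapPhase X (Y ⊗ Z))).comp (isMonomial_associator Y Z X)))
    (((isMonomial_hom (swapEquiv X Y) (swapEquiv_deg X Y) (swapPhase X Y)).whiskerRight Z).comp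
      ((isMonomial_associator Y X Z).comp
        ((isMonomial_hom (swapEquiv X Z) (swapEquiv_deg X Z) (swapPhase X Z)).whiskerLeft Y)))
    (fun _ => rfl)
    (fun p => (add_assoc _ _ _).symm.trans ((D.hexagon (X.deg p.1.1) (Y.deg p.1.2)
      (Z.deg p.2)).trans (add_assoc _ _ _)))
  hexagon_reverse X Y Z := IsMonomial.ext
    ((isMonomial_associator_inv X Y Z).comp
      ((isMonomial_hom (swapEquiv (X ⊗ Y) Z) (swapEquiv_deg (X ⊗ Y) Z)
        (swapPhase (X ⊗ Y) Z)).comp (isMonomial_associator_inv Z X Y)))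
    (((isMonomial_hom (swapEquiv Y Z) (swapEquiv_deg Y Z) (swapPhase Y Z)).whiskerLeft X).comp
      ((isMonomial_associator_inv X Z Y).comp
        ((isMonomial_hom (swapEquiv X Z) (swapEquiv_deg X Z) (swapPhase X Z)).whiskerRight Y)))
    (fun _ => rfl)
    (fun p => by
      have h := D.hexagon' (X.deg p.1) (Y.deg p.2.1) (Z.deg p.2.2)
      rw [sub_eq_add_neg, sub_eq_add_neg] at h
      exact (add_assoc _ _ _).symm.trans (h.trans (add_assoc _ _ _)))

theorem isMonomial_braiding (X Y : AnyonCat D) :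
    IsMonomial (β_ X Y).hom (fun p => (p.2, p.1))
      (fun p => D.R (X.deg p.1) (Y.deg p.2)) := fun _ _ => rfl

/-- The twist: the scalar `i ^ T g` on a simple object `g`. -/
def twist (D : AnyonData G) (X : AnyonCat D) : X ≅ X :=
  monomial (Equiv.refl _) (fun _ => rfl) (fun i => D.T (X.deg i))

end AnyonCat

/-! ### The toric code and the doubled semion theory -/

/-- The `ℤ/4` toric code `D(ℤ/4)`: the element `(p, q)` is the anyon `e^p m^q`, the associator is
trivial, the braiding of `e^a m^b` with `e^c m^d` is `i^(ad)`, and the twist is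
`θ(e^p m^q) = i^(pq)`. -/
def toricData : AnyonData (ZMod 4 × ZMod 4) where
  F _ _ _ := 0
  R x y := x.1 * y.2
  T x := x.1 * x.2
  triangle _ _ := rfl
  pentagon _ _ _ _ := rfl
  hexagon _ _ _ := by simp; ring
  hexagon' _ _ _ := by simp; ring
  balancing _ _ := by simp; ring

/-- The modular category of the `ℤ/4` toric code. -/
abbrev ToricCode := AnyonCat toricData

/-- The anyon `e^p m^q`. -/
abbrev anyon (p q : ZMod 4) : ToricCode := AnyonCat.simpleObj toricData (p, q)

/-- The doubled semion theory, the product of the semion theory and its complex conjugate: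
`(1, 0)`, `(0, 1)`, `(1, 1)` are the anyons `s`, `s̄`, `s s̄`. The associator of three semions `s`
is `-1`, the braiding and the twist of `s` are `i`, and those of `s̄` are the complex
conjugates. -/
def doubledSemionData : AnyonData (ZMod 2 × ZMod 2) where
  F x y z := 2 * ((x.1.val * y.1.val * z.1.val + x.2.val * y.2.val * z.2.val : ℕ) : ZMod 4)
  R x y := ((x.1.val * y.1.val : ℕ) : ZMod 4) - ((x.2.val * y.2.val : ℕ) : ZMod 4)
  T x := ((x.1.val : ℕ) : ZMod 4) - ((x.2.val : ℕ) : ZMod 4)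
  triangle := by decide
  pentagon := by decide
  hexagon := by decide
  hexagon' := by decide
  balancing := by decide

/-- The doubled semion modular category. -/
abbrev DoubledSemion := AnyonCat doubledSemionData

/-! ### The algebra `1 ⊕ e²m²` -/

/-- The object `1 ⊕ e²m²`; the summands are indexed by `ZMod 2`. -/
abbrev condensate : ToricCode where
  idx := ZMod 2
  deg k := (2 * (k.val : ZMod 4), 2 * (k.val : ZMod 4))

/-- The unit of `1 ⊕ e²m²`: the inclusion of the summand `1`. -/
def condensateUnit : 𝟙_ ToricCode ⟶ condensate :=
  ⟨Matrix.of fun _ k => if 0 = k then phase 0 else 0, fun _ k h => by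
    have hk : 0 = k := by
      by_contra hne
      exact h (by simp [hne])
    subst hk
    rfl⟩

/-- The multiplication of `1 ⊕ e²m²`: the canonical isomorphism `g ⊗ h ≅ g + h` on each pair of
summands. -/
def condensateMul : condensate ⊗ condensate ⟶ condensate :=
  ⟨Matrix.of fun p k => if p.1 + p.2 = k then phase 0 else 0, fun p k h => by
    have hk : p.1 + p.2 = k := by
      by_contra hne
      exact h (by simp [hne])
    subst hk
    have key : ∀ i j : ZMod 2, condensate.deg i + condensate.deg j = condensate.deg (i + j) := by
      decide
    exact key p.1 p.2⟩

theorem isMonomial_condensateUnit :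
    AnyonCat.IsMonomial condensateUnit (fun _ => (0 : ZMod 2)) (fun _ => 0) := fun _ _ => rfl

theorem isMonomial_condensateMul :
    AnyonCat.IsMonomial condensateMul (fun p => (p.1 + p.2 : ZMod 2)) (fun _ => 0) :=
  fun _ _ => rfl

instance : MonObj condensate where
  one := condensateUnit
  mul := condensateMul
  one_mul := AnyonCat.IsMonomial.ext
    ((isMonomial_condensateUnit.whiskerRight condensate).comp isMonomial_condensateMul)
    (AnyonCat.isMonomial_leftUnitor _) (fun p => zero_add (p.2 : ZMod 2)) (fun _ => rfl)
  mul_one := AnyonCat.IsMonomial.ext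
    ((isMonomial_condensateUnit.whiskerLeft condensate).comp isMonomial_condensateMul)
    (AnyonCat.isMonomial_rightUnitor _) (fun p => add_zero (p.1 : ZMod 2)) (fun _ => rfl)
  mul_assoc := AnyonCat.IsMonomial.ext
    ((isMonomial_condensateMul.whiskerRight condensate).comp isMonomial_condensateMul)
    ((AnyonCat.isMonomial_associator _ _ _).comp
      ((isMonomial_condensateMul.whiskerLeft condensate).comp isMonomial_condensateMul))
    (fun p => add_assoc (p.1.1 : ZMod 2) p.1.2 p.2) (fun _ => rfl)

end Pointed

end

open Modular Pointed

noncomputable section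

universe v u v₁ u₁ v₂ u₂

namespace Pointed

/-! ## Phases -/

theorem phase_ne_zero (k : ZMod 4) : phase k ≠ 0 := pow_ne_zero _ Complex.I_ne_zero

theorem phase_mul_neg (k : ZMod 4) : phase k * phase (-k) = 1 := by
  rw [← phase_add, add_neg_cancel, phase_zero]

theorem conj_phase (k : ZMod 4) : (starRingEnd ℂ) (phase k) = phase (-k) := by
  have h : (starRingEnd ℂ) (phase k) * phase k = 1 := by
    rw [phase, map_pow, Complex.conj_I, ← mul_pow]
    simp
  exact mul_right_cancel₀ (phase_ne_zero k) (h.trans (by rw [mul_comm, phase_mul_neg]))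

theorem phase_eq_one_iff (k : ZMod 4) : phase k = 1 ↔ k = 0 := by
  refine ⟨fun h => ?_, fun h => h ▸ phase_zero⟩
  revert h
  fin_cases k
  · exact fun _ => rfl
  · intro h
    have h1 : Complex.I = 1 := by simpa [phase, ZMod.val] using h
    simpa using congrArg Complex.re h1
  · intro h
    have h1 : Complex.I ^ 2 = 1 := by simpa [phase, ZMod.val] using h
    rw [Complex.I_sq] at h1
    norm_num at h1
  · intro h
    have h1 : Complex.I ^ 3 = 1 := by simpa [phase, ZMod.val] using h
    rw [pow_succ, Complex.I_sq] at h1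
    simpa using congrArg Complex.re h1

/-! ## Consequences of the coherence equations -/

namespace AnyonData

variable {G : Type} [AddCommGroup G] (D : AnyonData G)

theorem F_zero_left (b c : G) : D.F 0 b c = 0 := by
  have h := D.pentagon 0 0 b c
  have h' := D.pentagon 0 0 0 b
  simp only [zero_add, D.triangle] at h h'
  simpa using h

theorem F_zero_right (a b : G) : D.F a b 0 = 0 := by
  simpa [D.triangle] using D.pentagon a b 0 0

theorem F_neg (g : G) : -D.F (-g) g (-g) = D.F g (-g) g := by
  have h := D.pentagon g (-g) g (-g)
  simp only [neg_add_cancel, add_neg_cancel, D.triangle, F_zero_left, F_zero_right, add_zero] at h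
  exact (eq_neg_of_add_eq_zero_left h).symm

theorem R_zero : D.R 0 0 = 0 := by
  simpa [D.triangle] using D.hexagon 0 0 0

theorem T_zero : D.T 0 = 0 := by
  simpa [R_zero] using D.balancing 0 0

/-- The exponent of the double braiding. -/
def monodromy (g h : G) : ZMod 4 := D.R g h + D.R h g

theorem monodromy_comm (g h : G) : D.monodromy g h = D.monodromy h g := add_comm _ _

/-- All simple objects have quantum dimension `1`, twists are invariant under duality, and the
double braiding is a nondegenerate bicharacter. -/
structure IsNondegenerate : Prop where
  dim : ∀ g, D.T g + D.R g (-g) = D.F g (-g) g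
  twist_neg : ∀ g, D.T (-g) = D.T g
  monodromy_add : ∀ g g' h, D.monodromy (g + g') h = D.monodromy g h + D.monodromy g' h
  nondegenerate : ∀ g, (∀ h, D.monodromy g h = 0) → g = 0

end AnyonData

namespace AnyonCat

variable {G : Type} [AddCommGroup G] {D : AnyonData G}

/-! ## Matrix entries -/

/-- The entry of the matrix of a morphism. -/
def entry {X Y : AnyonCat D} (f : X ⟶ Y) (i : X.idx) (j : Y.idx) : ℂ := Hom.mat f i j

/-- The summand of `X ⊗ Y` given by summands of `X` and `Y`. -/
def pair {X Y : AnyonCat D} (i : X.idx) (j : Y.idx) : (X ⊗ Y).idx := (i, j)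

/-- The summand of the unit. -/
def pt : (𝟙_ (AnyonCat D)).idx := ()

theorem forall_pair {X Y : AnyonCat D} {p : (X ⊗ Y).idx → Prop} :
    (∀ q, p q) ↔ ∀ i j, p (pair i j) := Prod.forall

theorem forall_pt {p : (𝟙_ (AnyonCat D)).idx → Prop} : (∀ q, p q) ↔ p pt :=
  ⟨fun h => h _, fun h _ => h⟩

theorem sum_pair {X Y : AnyonCat D} (f : (X ⊗ Y).idx → ℂ) :
    ∑ p, f p = ∑ i, ∑ j, f (pair i j) := Fintype.sum_prod_type f

theorem sum_pt (f : (𝟙_ (AnyonCat D)).idx → ℂ) : ∑ p, f p = f pt :=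
  Finset.sum_eq_single _ (fun _ _ h => absurd rfl h) fun h => absurd (Finset.mem_univ _) h

theorem pair_inj {X Y : AnyonCat D} {i i' : X.idx} {j j' : Y.idx} :
    pair i j = pair i' j' ↔ i = i' ∧ j = j' := Prod.mk_inj

@[simp]
theorem deg_pair {X Y : AnyonCat D} (i : X.idx) (j : Y.idx) :
    (X ⊗ Y).deg (pair i j) = X.deg i + Y.deg j := rfl

@[simp]
theorem deg_pt : (𝟙_ (AnyonCat D)).deg pt = 0 := rfl

theorem entry_ext {X Y : AnyonCat D} {f g : X ⟶ Y} (h : ∀ i j, entry f i j = entry g i j) :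
    f = g :=
  Hom.ext (Matrix.ext h)

theorem deg_eq_of_entry {X Y : AnyonCat D} {f : X ⟶ Y} {i j} (h : entry f i j ≠ 0) :
    X.deg i = Y.deg j :=
  Hom.deg_eq f i j h

theorem entry_eq_zero {X Y : AnyonCat D} (f : X ⟶ Y) {i j} (h : X.deg i ≠ Y.deg j) :
    entry f i j = 0 :=
  mat_eq_zero f h

theorem IsMonomial.entry_eq {X Y : AnyonCat D} {f : X ⟶ Y} {e φ} (hf : IsMonomial f e φ)
    (i j) : entry f i j = if e i = j then phase (φ i) else 0 := hf i j

theorem IsMonomial.entry_comp {X Y Z : AnyonCat D} {f : X ⟶ Y} {e φ} (hf : IsMonomial f e φ)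
    (g : Y ⟶ Z) (i j) : entry (f ≫ g) i j = phase (φ i) * entry g (e i) j := by
  unfold entry
  rw [comp_mat, Matrix.mul_apply, Finset.sum_eq_single (e i)]
  · rw [hf, if_pos rfl]
  · intro k _ hk
    rw [hf, if_neg hk.symm, zero_mul]
  · exact fun h => absurd (Finset.mem_univ _) h

theorem entry_comp {X Y Z : AnyonCat D} (f : X ⟶ Y) (g : Y ⟶ Z) (i k) :
    entry (f ≫ g) i k = ∑ j, entry f i j * entry g j k := rfl

theorem entry_id (X : AnyonCat D) (i j) : entry (𝟙 X) i j = if i = j then 1 else 0 := rfl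

@[simp]
theorem entry_zero {X Y : AnyonCat D} (i j) : entry (0 : X ⟶ Y) i j = 0 := rfl

@[simp]
theorem entry_add {X Y : AnyonCat D} (f g : X ⟶ Y) (i j) :
    entry (f + g) i j = entry f i j + entry g i j := rfl

@[simp]
theorem entry_smul {X Y : AnyonCat D} (c : ℂ) (f : X ⟶ Y) (i j) :
    entry (c • f) i j = c * entry f i j := rfl

theorem entry_tensorHom {X Y X' Y' : AnyonCat D} (f : X ⟶ Y) (g : X' ⟶ Y') (i i') (j j') :
    entry (f ⊗ₘ g) (pair i i') (pair j j') = entry f i j * entry g i' j' := rfl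

theorem entry_whiskerLeft (X : AnyonCat D) {Y Z : AnyonCat D} (f : Y ⟶ Z) (i k : X.idx) (j l) :
    entry (X ◁ f) (pair i j) (pair k l) = if i = k then entry f j l else 0 := by
  change (if i = k then (1 : ℂ) else 0) * entry f j l = _
  split_ifs <;> simp

theorem entry_whiskerRight {X Y : AnyonCat D} (f : X ⟶ Y) (Z : AnyonCat D) (i k) (j l : Z.idx) :
    entry (f ▷ Z) (pair i j) (pair k l) = if j = l then entry f i k else 0 := by
  change entry f i k * (if j = l then (1 : ℂ) else 0) = _
  split_ifs <;> simp

theorem entry_whiskerLeft_comp (X : AnyonCat D) {Y Z W : AnyonCat D} (f : Y ⟶ Z)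
    (g : X ⊗ Z ⟶ W) (i : X.idx) (j k) :
    entry (X ◁ f ≫ g) (pair i j) k = ∑ l, entry f j l * entry g (pair i l) k := by
  rw [entry_comp, sum_pair, Finset.sum_eq_single i]
  · simp only [entry_whiskerLeft, if_true]
  · intro b _ hb
    simp [entry_whiskerLeft, hb.symm]
  · exact fun h => absurd (Finset.mem_univ _) h

theorem entry_whiskerRight_comp {X Y : AnyonCat D} (f : X ⟶ Y) (Z : AnyonCat D)
    {W : AnyonCat D} (g : Y ⊗ Z ⟶ W) (i) (j : Z.idx) (k) :
    entry (f ▷ Z ≫ g) (pair i j) k = ∑ l, entry f i l * entry g (pair l j) k := by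
  rw [entry_comp, sum_pair]
  refine Finset.sum_congr rfl fun l _ => ?_
  rw [Finset.sum_eq_single j]
  · simp only [entry_whiskerRight, if_true]
  · intro b _ hb
    simp [entry_whiskerRight, hb.symm]
  · exact fun h => absurd (Finset.mem_univ _) h

theorem isMonomial_id (X : AnyonCat D) : IsMonomial (𝟙 X) (fun i => i) (fun _ => 0) := by
  intro i j
  rw [phase_zero]
  rfl

theorem isMonomial_leftUnitor_inv (X : AnyonCat D) :
    IsMonomial (λ_ X).inv (fun i => ((), i)) (fun _ => 0) := by
  intro i j
  refine (isMonomial_inv (leftEquiv X) (leftEquiv_deg X) (fun _ => 0) i j).trans ?_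
  simp only [neg_zero]
  rfl

theorem isMonomial_rightUnitor_inv (X : AnyonCat D) :
    IsMonomial (ρ_ X).inv (fun i => (i, ())) (fun _ => 0) := by
  intro i j
  refine (isMonomial_inv (rightEquiv X) (rightEquiv_deg X) (fun _ => 0) i j).trans ?_
  simp only [neg_zero]
  rfl

theorem isMonomial_twist (X : AnyonCat D) :
    IsMonomial (twist D X).hom (fun i => i) (fun i => D.T (X.deg i)) := fun _ _ => rfl

theorem entry_associator_comp (X Y Z : AnyonCat D) {W : AnyonCat D} (f : X ⊗ Y ⊗ Z ⟶ W)
    (i : X.idx) (j : Y.idx) (k : Z.idx) (l) :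
    entry ((α_ X Y Z).hom ≫ f) (pair (pair i j) k) l =
      phase (D.F (X.deg i) (Y.deg j) (Z.deg k)) * entry f (pair i (pair j k)) l :=
  (isMonomial_associator X Y Z).entry_comp f _ _

theorem entry_associator_inv_comp (X Y Z : AnyonCat D) {W : AnyonCat D} (f : (X ⊗ Y) ⊗ Z ⟶ W)
    (i : X.idx) (j : Y.idx) (k : Z.idx) (l) :
    entry ((α_ X Y Z).inv ≫ f) (pair i (pair j k)) l =
      phase (-D.F (X.deg i) (Y.deg j) (Z.deg k)) * entry f (pair (pair i j) k) l :=
  (isMonomial_associator_inv X Y Z).entry_comp f _ _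

theorem entry_associator_inv (X Y Z : AnyonCat D) (i i' : X.idx) (j j' : Y.idx) (k k' : Z.idx) :
    entry (α_ X Y Z).inv (pair i (pair j k)) (pair (pair i' j') k') =
      if i = i' ∧ j = j' ∧ k = k' then phase (-D.F (X.deg i) (Y.deg j) (Z.deg k)) else 0 := by
  refine ((isMonomial_associator_inv X Y Z).entry_eq _ _).trans ?_
  change (if pair (pair i j) k = pair (pair i' j') k' then
    phase (-D.F (X.deg i) (Y.deg j) (Z.deg k)) else 0) = _
  simp only [pair_inj, and_assoc]

theorem entry_leftUnitor (X : AnyonCat D) (i j : X.idx) :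
    entry (λ_ X).hom (pair pt i) j = if i = j then 1 else 0 := by
  rw [← phase_zero]
  rfl

theorem entry_rightUnitor (X : AnyonCat D) (i j : X.idx) :
    entry (ρ_ X).hom (pair i pt) j = if i = j then 1 else 0 := by
  rw [← phase_zero]
  rfl

theorem entry_leftUnitor_comp (X : AnyonCat D) {W : AnyonCat D} (f : X ⟶ W) (i : X.idx) (j) :
    entry ((λ_ X).hom ≫ f) (pair pt i) j = entry f i j :=
  ((isMonomial_leftUnitor X).entry_comp f _ _).trans (by rw [phase_zero, one_mul]; rfl)

theorem entry_rightUnitor_comp (X : AnyonCat D) {W : AnyonCat D} (f : X ⟶ W) (i : X.idx) (j) :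
    entry ((ρ_ X).hom ≫ f) (pair i pt) j = entry f i j :=
  ((isMonomial_rightUnitor X).entry_comp f _ _).trans (by rw [phase_zero, one_mul]; rfl)

theorem entry_leftUnitor_inv (X : AnyonCat D) (i j : X.idx) :
    entry (λ_ X).inv i (pair pt j) = if i = j then 1 else 0 := by
  refine ((isMonomial_leftUnitor_inv X).entry_eq _ _).trans ?_
  change (if pair pt i = pair pt j then phase 0 else 0) = _
  simp [pair_inj, phase_zero]

theorem entry_rightUnitor_inv (X : AnyonCat D) (i j : X.idx) :
    entry (ρ_ X).inv i (pair j pt) = if i = j then 1 else 0 := by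
  refine ((isMonomial_rightUnitor_inv X).entry_eq _ _).trans ?_
  change (if pair i pt = pair j pt then phase 0 else 0) = _
  simp [pair_inj, phase_zero]

theorem entry_leftUnitor_inv_comp (X : AnyonCat D) {W : AnyonCat D} (f : 𝟙_ _ ⊗ X ⟶ W)
    (i : X.idx) (j) : entry ((λ_ X).inv ≫ f) i j = entry f (pair pt i) j :=
  ((isMonomial_leftUnitor_inv X).entry_comp f _ _).trans (by rw [phase_zero, one_mul]; rfl)

theorem entry_rightUnitor_inv_comp (X : AnyonCat D) {W : AnyonCat D} (f : X ⊗ 𝟙_ _ ⟶ W)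
    (i : X.idx) (j) : entry ((ρ_ X).inv ≫ f) i j = entry f (pair i pt) j :=
  ((isMonomial_rightUnitor_inv X).entry_comp f _ _).trans (by rw [phase_zero, one_mul]; rfl)

theorem entry_braiding_comp (X Y : AnyonCat D) {W : AnyonCat D} (f : Y ⊗ X ⟶ W)
    (i : X.idx) (j : Y.idx) (k) :
    entry ((β_ X Y).hom ≫ f) (pair i j) k =
      phase (D.R (X.deg i) (Y.deg j)) * entry f (pair j i) k :=
  (isMonomial_braiding X Y).entry_comp f _ _

theorem entry_braiding (X Y : AnyonCat D) (i i' : X.idx) (j j' : Y.idx) :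
    entry (β_ X Y).hom (pair i j) (pair j' i') =
      if i = i' ∧ j = j' then phase (D.R (X.deg i) (Y.deg j)) else 0 := by
  change (if pair j i = pair j' i' then phase (D.R (X.deg i) (Y.deg j)) else 0) = _
  simp [pair_inj, and_comm]

theorem entry_twist_comp {X Y : AnyonCat D} (f : X ⟶ Y) (i j) :
    entry ((twist D X).hom ≫ f) i j = phase (D.T (X.deg i)) * entry f i j :=
  (isMonomial_twist X).entry_comp f _ _

theorem entry_comp_twist {X Y : AnyonCat D} (f : X ⟶ Y) (i j) :
    entry (f ≫ (twist D Y).hom) i j = entry f i j * phase (D.T (Y.deg j)) :=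
  comp_monomial (Equiv.refl _) _ _ _ _ _

theorem entry_twist (X : AnyonCat D) (i j) :
    entry (twist D X).hom i j = if i = j then phase (D.T (X.deg i)) else 0 := rfl

/-! ## Simple objects -/

theorem end_unit_eq (f : 𝟙_ (AnyonCat D) ⟶ 𝟙_ (AnyonCat D)) :
    f = entry f pt pt • 𝟙 (𝟙_ (AnyonCat D)) := by
  apply entry_ext
  rw [forall_pt, forall_pt]
  simp [entry_id]

/-- The index of the only summand of a simple object. -/
def only (g : G) : (simpleObj D g).idx := ()

theorem sum_only {g : G} (f : (simpleObj D g).idx → ℂ) : ∑ p, f p = f (only g) :=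
  Finset.sum_eq_single _ (fun _ _ h => absurd rfl h) fun h => absurd (Finset.mem_univ _) h

/-- The inclusion of a summand. -/
def incl (X : AnyonCat D) (i : X.idx) : simpleObj D (X.deg i) ⟶ X :=
  ⟨Matrix.of fun _ j => if i = j then 1 else 0, fun _ j h => by
    by_contra hne
    exact h (if_neg fun hij : i = j => hne (hij ▸ rfl))⟩

/-- The projection to a summand. -/
def proj (X : AnyonCat D) (i : X.idx) : X ⟶ simpleObj D (X.deg i) :=
  ⟨Matrix.of fun j _ => if j = i then 1 else 0, fun j _ h => by
    by_contra hne
    exact h (if_neg fun hij : j = i => hne (hij ▸ rfl))⟩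

theorem entry_incl (X : AnyonCat D) (i j : X.idx) (k) :
    entry (incl X i) k j = if i = j then 1 else 0 := rfl

theorem entry_proj (X : AnyonCat D) (i j : X.idx) (k) :
    entry (proj X i) j k = if j = i then 1 else 0 := rfl

theorem simpleObj_hom_ext {g h : G} {f f' : simpleObj D g ⟶ simpleObj D h}
    (e : entry f (only g) (only h) = entry f' (only g) (only h)) : f = f' :=
  entry_ext fun _ _ => e

theorem incl_proj (X : AnyonCat D) (i : X.idx) : incl X i ≫ proj X i = 𝟙 _ := by
  apply simpleObj_hom_ext
  simp [entry_comp, entry_incl, entry_proj, entry_id]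

theorem incl_proj_ne (X : AnyonCat D) {i j : X.idx} (h : i ≠ j) : incl X i ≫ proj X j = 0 := by
  apply simpleObj_hom_ext
  simp [entry_comp, entry_incl, entry_proj, h]

theorem id_simpleObj_ne_zero (g : G) : 𝟙 (simpleObj D g) ≠ 0 := fun h => by
  have h' := congrArg (fun f => entry f (only g) (only g)) h
  simp [entry_id] at h'

instance simple_simpleObj (g : G) : Simple (simpleObj D g) where
  mono_isIso_iff_nonzero {Y} f _ := by
    constructor
    · intro _ h0
      apply id_simpleObj_ne_zero (D := D) g
      rw [← IsIso.inv_hom_id f]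
      exact (congrArg (fun t => inv f ≫ t) h0).trans comp_zero
    · intro h0
      obtain ⟨i, hi⟩ : ∃ i, entry f i (only g) ≠ 0 := by
        by_contra! hall
        exact h0 (entry_ext fun i _ => hall i)
      let s : simpleObj D g ⟶ Y :=
        ⟨Matrix.of fun _ j => if i = j then (entry f i (only g))⁻¹ else 0, fun _ j h => by
          by_cases hij : i = j
          · rw [← hij]; exact (deg_eq_of_entry hi).symm
          · exact absurd (if_neg hij) h⟩
      have hs : s ≫ f = 𝟙 _ := by
        apply simpleObj_hom_ext
        rw [entry_comp]
        change ∑ j, (if i = j then (entry f i (only g))⁻¹ else 0) * entry f j (only g) = 1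
        simp [hi]
      have : IsSplitEpi f := IsSplitEpi.mk' ⟨s, hs⟩
      exact isIso_of_mono_of_isSplitEpi f

theorem exists_iso_simpleObj (X : AnyonCat D) [Simple X] : ∃ g, Nonempty (X ≅ simpleObj D g) := by
  have hX : Nonempty X.idx := by
    by_contra h
    rw [not_nonempty_iff] at h
    exact id_nonzero X (entry_ext fun i => h.elim i)
  obtain ⟨i⟩ := hX
  have : Mono (incl X i) := by
    have : IsSplitMono (incl X i) := IsSplitMono.mk' ⟨proj X i, incl_proj X i⟩
    infer_instance
  have : IsIso (incl X i) := isIso_of_mono_of_nonzero fun h => by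
    apply id_simpleObj_ne_zero (D := D) (X.deg i)
    rw [← incl_proj, h, zero_comp]
  exact ⟨_, ⟨(asIso (incl X i)).symm⟩⟩

theorem hom_simpleObj_eq_zero {g h : G} (hgh : g ≠ h) (f : simpleObj D g ⟶ simpleObj D h) :
    f = 0 :=
  simpleObj_hom_ext (entry_eq_zero f hgh)

theorem eq_of_iso_simpleObj {g h : G} (e : simpleObj D g ≅ simpleObj D h) : g = h := by
  by_contra hgh
  apply id_simpleObj_ne_zero (D := D) g
  rw [← e.hom_inv_id, hom_simpleObj_eq_zero hgh e.hom, zero_comp]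

theorem isListOfSimples {n : ℕ} (e : Fin n ≃ G) :
    IsListOfSimples (fun i => simpleObj D (e i)) where
  simple _ := inferInstance
  distinct _ _ h := e.injective (eq_of_iso_simpleObj h.some)
  complete X _ := by
    obtain ⟨g, h⟩ := exists_iso_simpleObj X
    exact ⟨e.symm g, by simpa using h⟩

/-! ## Semisimplicity -/

/-- The matrix entries of a morphism, as a linear map. -/
def entryLinear (X Y : AnyonCat D) : (X ⟶ Y) →ₗ[ℂ] (X.idx → Y.idx → ℂ) where
  toFun f := entry f
  map_add' _ _ := rfl
  map_smul' _ _ := rfl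

theorem entry_sum {X Y : AnyonCat D} {κ : Type*} (s : Finset κ) (f : κ → (X ⟶ Y)) (i j) :
    entry (∑ k ∈ s, f k) i j = ∑ k ∈ s, entry (f k) i j := by
  have h := map_sum (entryLinear X Y) f s
  have h' := congrFun (congrFun h i) j
  rw [Finset.sum_apply, Finset.sum_apply] at h'
  exact h'

instance (X Y : AnyonCat D) : FiniteDimensional ℂ (X ⟶ Y) :=
  FiniteDimensional.of_injective (entryLinear X Y) fun _ _ h => Hom.ext h

/-- The zero object. -/
def zeroObj (D : AnyonData G) : AnyonCat D where
  idx := Empty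
  deg := Empty.elim

theorem isZero_zeroObj : IsZero (zeroObj D) := by
  rw [IsZero.iff_id_eq_zero]
  exact entry_ext fun i => i.elim

instance : HasZeroObject (AnyonCat D) := ⟨⟨_, isZero_zeroObj⟩⟩

instance : HasFiniteBiproducts (AnyonCat D) := by
  have : HasFiniteProducts (AnyonCat D) := hasFiniteProducts_of_has_binary_and_terminal
  exact HasFiniteBiproducts.of_hasFiniteProducts

theorem exists_iso_biproduct (X : AnyonCat D) : ∃ (n : ℕ) (S : Fin n → AnyonCat D),
    (∀ i, Simple (S i)) ∧ Nonempty (X ≅ ⨁ S) := by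
  let e : Fin (Fintype.card X.idx) ≃ X.idx := (Fintype.equivFin X.idx).symm
  let S : Fin (Fintype.card X.idx) → AnyonCat D := fun i => simpleObj D (X.deg (e i))
  let b : Bicone S := Bicone.mk X (fun i => proj X (e i)) (fun i => incl X (e i)) fun i j => by
    by_cases h : i = j
    · subst h
      simpa using incl_proj X (e i)
    · simpa [h] using incl_proj_ne X (e.injective.ne h)
  have hb : b.IsBilimit := isBilimitOfTotal b (by
    refine entry_ext (X := X) (Y := X) fun i j => ?_
    refine (entry_sum (X := X) (Y := X) _ _ i j).trans ?_
    have h : ∀ k, entry (proj X (e k) ≫ incl X (e k)) i j =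
        (if i = e k then 1 else 0) * (if e k = j then 1 else 0) := fun k => by
      rw [entry_comp, sum_only, entry_proj, entry_incl]
    refine (Finset.sum_congr rfl fun k _ => h k).trans ?_
    rw [e.sum_comp (fun k => (if i = k then (1 : ℂ) else 0) * (if k = j then 1 else 0))]
    refine Eq.trans ?_ (entry_id X i j).symm
    simp)
  exact ⟨_, S, fun _ => simple_simpleObj _, ⟨biproduct.uniqueUpToIso S hb⟩⟩

/-! ## Duals and traces -/

/-- The dual object. -/
@[simps]
def dual (X : AnyonCat D) : AnyonCat D where
  idx := X.idx
  deg i := -X.deg i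

/-- The summand of the dual object that is dual to a given one. -/
def dualIdx {X : AnyonCat D} (i : X.idx) : (dual X).idx := i

theorem forall_dualIdx {X : AnyonCat D} {p : (dual X).idx → Prop} :
    (∀ q, p q) ↔ ∀ i : X.idx, p (dualIdx i) := Iff.rfl

theorem sum_dualIdx {X : AnyonCat D} (f : (dual X).idx → ℂ) :
    ∑ p, f p = ∑ i : X.idx, f (dualIdx i) := rfl

theorem dualIdx_inj {X : AnyonCat D} {i j : X.idx} : dualIdx i = dualIdx j ↔ i = j := Iff.rfl

theorem deg_dualIdx {X : AnyonCat D} (i : X.idx) : (dual X).deg (dualIdx i) = -X.deg i := rfl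

/-- Coevaluation. -/
def coev (X : AnyonCat D) : 𝟙_ (AnyonCat D) ⟶ X ⊗ dual X :=
  ⟨Matrix.of fun _ (p : X.idx × X.idx) => if p.1 = p.2 then 1 else 0, fun _ p h => by
    have h' : p.1 = p.2 := by
      by_contra hne
      exact h (if_neg hne)
    change 0 = X.deg p.1 + -X.deg p.2
    rw [h', add_neg_cancel]⟩

/-- Evaluation. -/
def ev (X : AnyonCat D) : dual X ⊗ X ⟶ 𝟙_ (AnyonCat D) :=
  ⟨Matrix.of fun (p : X.idx × X.idx) _ =>
      if p.1 = p.2 then phase (-D.F (X.deg p.1) (-X.deg p.1) (X.deg p.1)) else 0, fun p _ h => by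
    have h' : p.1 = p.2 := by
      by_contra hne
      exact h (if_neg hne)
    change -X.deg p.1 + X.deg p.2 = 0
    rw [h', neg_add_cancel]⟩

theorem entry_coev (X : AnyonCat D) (i j : X.idx) :
    entry (coev X) pt (pair i (dualIdx j)) = if i = j then 1 else 0 := rfl

theorem entry_ev (X : AnyonCat D) (i j : X.idx) :
    entry (ev X) (pair (dualIdx i) j) pt =
      if i = j then phase (-D.F (X.deg i) (-X.deg i) (X.deg i)) else 0 := rfl

instance exactPairingDual (X : AnyonCat D) : ExactPairing X (dual X) where
  coevaluation' := coev X
  evaluation' := ev X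
  coevaluation_evaluation' := by
    apply entry_ext
    simp only [forall_pair, forall_pt, forall_dualIdx]
    intro j k
    rw [entry_whiskerLeft_comp, entry_rightUnitor_comp, entry_leftUnitor_inv, sum_pair]
    simp only [sum_dualIdx, entry_associator_inv_comp, entry_whiskerRight, entry_coev, entry_ev,
      dualIdx_inj, deg_dualIdx]
    rw [Finset.sum_eq_single j]
    · rw [Finset.sum_eq_single j]
      · simp [D.F_neg, phase_mul_neg]
      · intro i _ hi
        simp [hi.symm]
      · exact fun h => absurd (Finset.mem_univ _) h
    · intro i _ hi
      simp [hi.symm]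
    · exact fun h => absurd (Finset.mem_univ _) h
  evaluation_coevaluation' := by
    apply entry_ext
    simp only [forall_pair, forall_pt]
    intro j k
    rw [entry_whiskerRight_comp, entry_leftUnitor_comp, entry_rightUnitor_inv, sum_pair]
    simp only [sum_dualIdx, entry_associator_comp, entry_whiskerLeft, entry_coev, entry_ev,
      deg_dualIdx]
    rw [Finset.sum_eq_single j]
    · rw [Finset.sum_eq_single j]
      · simp [phase_mul_neg]
      · intro i _ hi
        simp [hi.symm]
      · exact fun h => absurd (Finset.mem_univ _) h
    · intro i _ hi
      simp [hi]
    · exact fun h => absurd (Finset.mem_univ _) h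

instance (X : AnyonCat D) : HasRightDual X where
  rightDual := dual X

instance : RightRigidCategory (AnyonCat D) where

instance : RigidCategory (AnyonCat D) := BraidedCategory.rigidCategoryOfRightRigidCategory

theorem pairing_sum (X Y : AnyonCat D) [ExactPairing X Y] (i j : X.idx) :
    ∑ y, entry (η_ X Y) pt (pair i y) * entry (ε_ X Y) (pair y j) pt =
      if i = j then phase (-D.F (X.deg i) (-X.deg i) (X.deg i)) else 0 := by
  have h := congrArg (fun f => entry f (pair pt j) (pair i pt))
    (ExactPairing.evaluation_coevaluation X Y)
  rw [entry_whiskerRight_comp, entry_leftUnitor_comp, entry_rightUnitor_inv, sum_pair] at h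
  simp only [entry_associator_comp, entry_whiskerLeft] at h
  rw [Finset.sum_eq_single i] at h
  · simp only [if_true] at h
    by_cases hdeg : X.deg i = X.deg j
    · have key : ∀ y, entry (η_ X Y) pt (pair i y) * entry (ε_ X Y) (pair y j) pt =
          phase (-D.F (X.deg i) (-X.deg i) (X.deg i)) * (entry (η_ X Y) pt (pair i y) *
            (phase (D.F (X.deg i) (Y.deg y) (X.deg j)) * entry (ε_ X Y) (pair y j) pt)) := by
        intro y
        by_cases hy : entry (η_ X Y) pt (pair i y) = 0
        · simp [hy]
        · have hdy : (0 : G) = X.deg i + Y.deg y := deg_eq_of_entry hy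
          rw [← hdeg, eq_neg_of_add_eq_zero_right hdy.symm]
          linear_combination (-(entry (η_ X Y) pt (pair i y) * entry (ε_ X Y) (pair y j) pt)) *
            phase_mul_neg (D.F (X.deg i) (-X.deg i) (X.deg i))
      rw [Finset.sum_congr rfl fun y _ => key y, ← Finset.mul_sum, h]
      simp [eq_comm]
    · rw [if_neg fun e : i = j => hdeg (e ▸ rfl)]
      refine Finset.sum_eq_zero fun y _ => ?_
      by_cases hy : entry (η_ X Y) pt (pair i y) = 0
      · rw [hy, zero_mul]
      · have hdy : (0 : G) = X.deg i + Y.deg y := deg_eq_of_entry hy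
        rw [entry_eq_zero (ε_ X Y), mul_zero]
        intro he
        have he' : Y.deg y + X.deg j = 0 := he
        apply hdeg
        rw [eq_neg_of_add_eq_zero_right he', eq_neg_of_add_eq_zero_left hdy.symm]
  · intro b _ hb
    simp [hb]
  · exact fun h => absurd (Finset.mem_univ _) h

theorem qtrace_eq (hD : ∀ g, D.T g + D.R g (-g) = D.F g (-g) g) (X Y : AnyonCat D)
    [ExactPairing X Y] (f : X ⟶ X) :
    qtrace (twist D) X Y f = (∑ i, entry f i i) • 𝟙 (𝟙_ (AnyonCat D)) := by
  rw [end_unit_eq (qtrace (twist D) X Y f)]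
  congr 1
  rw [qtrace, entry_comp, sum_pair]
  simp only [entry_whiskerRight_comp, entry_braiding_comp, entry_comp_twist]
  refine Finset.sum_congr rfl fun i _ => ?_
  have key : ∀ y, entry (η_ X Y) pt (pair i y) * (∑ j, entry f i j * phase (D.T (X.deg j)) *
      (phase (D.R (X.deg j) (Y.deg y)) * entry (ε_ X Y) (pair y j) pt)) =
      ∑ j, entry f i j * phase (D.F (X.deg j) (-X.deg j) (X.deg j)) *
        (entry (η_ X Y) pt (pair i y) * entry (ε_ X Y) (pair y j) pt) := by
    intro y
    rw [Finset.mul_sum]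
    refine Finset.sum_congr rfl fun j _ => ?_
    by_cases hy : entry (ε_ X Y) (pair y j) pt = 0
    · simp [hy]
    · have hdy : Y.deg y + X.deg j = 0 := deg_eq_of_entry hy
      rw [eq_neg_of_add_eq_zero_left hdy, ← hD, phase_add]
      ring
  rw [Finset.sum_congr rfl fun y _ => key y, Finset.sum_comm]
  simp only [← Finset.mul_sum, pairing_sum]
  rw [Finset.sum_eq_single i]
  · rw [if_pos rfl, mul_assoc, phase_mul_neg, mul_one]
  · intro j _ hj
    rw [if_neg hj.symm, mul_zero]
  · exact fun h => absurd (Finset.mem_univ _) h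

end AnyonCat

end Pointed

namespace Modular

theorem eq_rightAdjointMate {C : Type u} [Category.{v} C] [MonoidalCategory C] {X Y : C}
    [HasRightDual X] [HasRightDual Y] {f : X ⟶ Y} {g : Yᘁ ⟶ Xᘁ}
    (h : η_ Y Yᘁ ≫ Y ◁ g = η_ X Xᘁ ≫ f ▷ Xᘁ) : g = fᘁ := by
  rw [← coevaluation_comp_rightAdjointMate] at h
  have key : ∀ g : Yᘁ ⟶ Xᘁ, tensorLeftHomEquiv (𝟙_ C) Y Yᘁ Xᘁ ((ρ_ _).hom ≫ g) =
      η_ Y Yᘁ ≫ Y ◁ g := by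
    intro g
    simp [tensorLeftHomEquiv, unitors_inv_equal]
  rw [← key, ← key] at h
  simpa using (tensorLeftHomEquiv (𝟙_ C) Y Yᘁ Xᘁ).injective h

end Modular

namespace Pointed

namespace AnyonCat

variable {G : Type} [AddCommGroup G] {D : AnyonData G}

/-! ## The ribbon structure -/

theorem comp_twist {X Y : AnyonCat D} (f : X ⟶ Y) :
    f ≫ (twist D Y).hom = (twist D X).hom ≫ f := by
  apply entry_ext
  intro i j
  rw [entry_comp_twist, entry_twist_comp]
  by_cases h : entry f i j = 0
  · rw [h, zero_mul, mul_zero]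
  · rw [deg_eq_of_entry h, mul_comm]

theorem twist_tensor (X Y : AnyonCat D) :
    (twist D (X ⊗ Y)).hom =
      ((twist D X).hom ⊗ₘ (twist D Y).hom) ≫ (β_ X Y).hom ≫ (β_ Y X).hom := by
  rw [MonoidalCategory.tensorHom_def]
  exact IsMonomial.ext (isMonomial_twist _)
    ((((isMonomial_twist X).whiskerRight Y).comp ((isMonomial_twist Y).whiskerLeft X)).comp
      ((isMonomial_braiding X Y).comp (isMonomial_braiding Y X)))
    (fun _ => rfl) (fun p => (D.balancing (X.deg p.1) (Y.deg p.2)).trans (add_assoc _ _ _))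

theorem isRibbonTwist (hT : ∀ g, D.T (-g) = D.T g) : IsRibbonTwist (twist D) where
  natural := comp_twist
  unit := by
    rw [end_unit_eq (twist D (𝟙_ (AnyonCat D))).hom, entry_twist, if_pos rfl, deg_pt, D.T_zero,
      phase_zero, one_smul]
  tensor := twist_tensor
  dual X := by
    apply eq_rightAdjointMate
    apply entry_ext
    rw [forall_pt]
    intro p
    revert p
    change ∀ p : (X ⊗ dual X).idx, entry (coev X ≫ X ◁ (twist D (dual X)).hom) pt p =
      entry (coev X ≫ (twist D X).hom ▷ dual X) pt p
    simp only [forall_pair, forall_dualIdx]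
    intro i j
    rw [entry_comp, entry_comp, sum_pair, sum_pair]
    simp only [sum_dualIdx, entry_coev, entry_whiskerLeft, entry_whiskerRight, entry_twist,
      dualIdx_inj, deg_dualIdx, hT]
    rw [Finset.sum_eq_single i, Finset.sum_eq_single j]
    · by_cases h : i = j
      · subst h
        rw [Finset.sum_eq_single i, Finset.sum_eq_single i] <;> simp +contextual [eq_comm]
      · rw [if_neg h, zero_mul, Finset.sum_eq_zero]
        intro k _
        refine Finset.sum_eq_zero fun l _ => ?_
        by_cases hkl : k = l
        · subst hkl
          by_cases hk : k = j
          · subst hk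
            simp [Ne.symm h]
          · simp [hk]
        · simp [hkl]
    · intro k _ hk
      simp [hk]
    · exact fun h => absurd (Finset.mem_univ _) h
    · intro k _ hk
      simp [hk]
    · exact fun h => absurd (Finset.mem_univ _) h

/-! ## Modularity -/

theorem finrank_end_of_simple (X : AnyonCat D) [Simple X] : Module.finrank ℂ (X ⟶ X) = 1 := by
  obtain ⟨g, ⟨e⟩⟩ := exists_iso_simpleObj X
  rw [(Linear.homCongr ℂ e e).finrank_eq]
  refine finrank_eq_one (𝟙 (simpleObj D g)) (id_simpleObj_ne_zero g) fun f =>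
    ⟨entry f (only g) (only g), simpleObj_hom_ext ?_⟩
  simp [entry_id]

theorem hom_eq_zero_of_simple (X Y : AnyonCat D) [Simple X] [Simple Y] (h : IsEmpty (X ≅ Y))
    (f : X ⟶ Y) : f = 0 := by
  obtain ⟨g, ⟨e⟩⟩ := exists_iso_simpleObj X
  obtain ⟨g', ⟨e'⟩⟩ := exists_iso_simpleObj Y
  have hg : g ≠ g' := by
    rintro rfl
    exact h.false (e ≪≫ e'.symm)
  have h0 := hom_simpleObj_eq_zero hg (e.inv ≫ f ≫ e'.hom)
  rw [← cancel_epi e.inv, ← cancel_mono e'.hom, Category.assoc, h0, comp_zero, zero_comp]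

theorem isUnit_det_monodromy [Fintype G] [DecidableEq G] (hD : D.IsNondegenerate) :
    IsUnit (Matrix.of fun g h => phase (D.monodromy g h) : Matrix G G ℂ).det := by
  have hadd : ∀ g h h', D.monodromy g (h + h') = D.monodromy g h + D.monodromy g h' := by
    intro g h h'
    rw [D.monodromy_comm, hD.monodromy_add, D.monodromy_comm h, D.monodromy_comm h']
  have hneg : ∀ g h, D.monodromy (-g) h = -D.monodromy g h := by
    intro g h
    have h0 : D.monodromy 0 h = 0 := by simpa using hD.monodromy_add 0 0 h
    exact eq_neg_of_add_eq_zero_left (by rw [← hD.monodromy_add, neg_add_cancel, h0])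
  have hsum : ∀ g, g ≠ 0 → ∑ h, phase (D.monodromy g h) = 0 := by
    intro g hg
    obtain ⟨h₀, hh₀⟩ : ∃ h, D.monodromy g h ≠ 0 := by
      by_contra! hall
      exact hg (hD.nondegenerate g hall)
    have hs : ∑ h, phase (D.monodromy g h) =
        phase (D.monodromy g h₀) * ∑ h, phase (D.monodromy g h) := by
      rw [Finset.mul_sum, ← Equiv.sum_comp (Equiv.addLeft h₀)]
      exact Finset.sum_congr rfl fun h _ => by
        rw [Equiv.coe_addLeft, hadd, phase_add]
    have hne : 1 - phase (D.monodromy g h₀) ≠ 0 :=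
      sub_ne_zero.2 fun h => hh₀ ((phase_eq_one_iff _).1 h.symm)
    exact (mul_eq_zero.1 (by linear_combination hs :
      (1 - phase (D.monodromy g h₀)) * ∑ h, phase (D.monodromy g h) = 0)).resolve_left hne
  have hmul : (Matrix.of fun g h => phase (D.monodromy g h) : Matrix G G ℂ) *
      (Matrix.of fun g h => phase (-D.monodromy g h)) = (Fintype.card G : ℂ) • 1 := by
    ext g g'
    rw [Matrix.mul_apply]
    have hterm : ∀ h, phase (D.monodromy g h) * phase (-D.monodromy h g') =
        phase (D.monodromy (g + -g') h) := fun h => by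
      rw [← phase_add, D.monodromy_comm h, ← hneg, ← hD.monodromy_add]
    simp only [Matrix.of_apply, hterm]
    by_cases h : g = g'
    · subst h
      have h0 : ∀ h, D.monodromy 0 h = 0 := fun h => by simpa using hD.monodromy_add 0 0 h
      simp [h0, phase_zero]
    · rw [hsum _ (by rwa [← sub_eq_add_neg, sub_ne_zero])]
      simp [h]
  have hdet := congrArg Matrix.det hmul
  rw [Matrix.det_mul, Matrix.det_smul, Matrix.det_one, mul_one] at hdet
  refine isUnit_iff_ne_zero.2 fun h0 => ?_
  rw [h0, zero_mul] at hdet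
  exact pow_ne_zero _ (Nat.cast_ne_zero.2 Fintype.card_ne_zero) hdet.symm

theorem isModular [Finite G] (hD : D.IsNondegenerate) : IsModular (AnyonCat D) (twist D) where
  monoidalPreadditive := inferInstance
  monoidalLinear := inferInstance
  finiteDimensional _ _ := inferInstance
  hasFiniteBiproducts := inferInstance
  semisimple := exists_iso_biproduct
  schur_self X _ := finrank_end_of_simple X
  schur_ne X Y _ _ h f := hom_eq_zero_of_simple X Y h f
  simple_unit := simple_simpleObj 0
  ribbon_nondegenerate := by
    classical
    have := Fintype.ofFinite G
    let e : Fin (Fintype.card G) ≃ G := (Fintype.equivFin G).symm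
    refine ⟨inferInstance, isRibbonTwist hD.twist_neg, Fintype.card G,
      fun i => simpleObj D (e i), Matrix.of fun i j => phase (D.monodromy (e i) (e j)),
      isListOfSimples e, fun i j => ?_, ?_⟩
    · rw [qtrace_eq hD.dim, sum_pair, sum_only, sum_only, entry_braiding_comp, entry_braiding,
        if_pos ⟨rfl, rfl⟩, ← phase_add]
      rfl
    · have h := isUnit_det_monodromy hD
      rwa [← Matrix.det_submatrix_equiv_self e] at h

/-! ## Unitarity -/

/-- The conjugate transpose. -/
def dagger {X Y : AnyonCat D} (f : X ⟶ Y) : Y ⟶ X :=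
  ⟨f.mat.conjTranspose, fun i j h => (f.deg_eq j i fun h0 => h (by
    rw [Matrix.conjTranspose_apply, h0, star_zero])).symm⟩

theorem entry_dagger {X Y : AnyonCat D} (f : X ⟶ Y) (i j) :
    entry (dagger f) i j = (starRingEnd ℂ) (entry f j i) := rfl

theorem dagger_comp {X Y Z : AnyonCat D} (f : X ⟶ Y) (g : Y ⟶ Z) :
    dagger (f ≫ g) = dagger g ≫ dagger f := by
  apply entry_ext
  intro i j
  simp only [entry_comp, entry_dagger, map_sum, map_mul]
  exact Finset.sum_congr rfl fun _ _ => mul_comm _ _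

theorem dagger_monomial {X Y : AnyonCat D} (e : X.idx ≃ Y.idx) (he : ∀ i, X.deg i = Y.deg (e i))
    (φ : X.idx → ZMod 4) : dagger (monomial e he φ).hom = (monomial e he φ).inv := by
  apply entry_ext
  intro j i
  rw [entry_dagger]
  change (starRingEnd ℂ) (if e i = j then phase (φ i) else 0) =
    if e i = j then phase (-φ i) else 0
  split_ifs
  · exact conj_phase _
  · exact map_zero _

theorem eq_zero_of_comp_dagger {X Y : AnyonCat D} (f : X ⟶ Y) (h : f ≫ dagger f = 0) :
    f = 0 := by
  apply entry_ext
  intro i j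
  have hi := congrArg (fun g => entry g i i) h
  simp only [entry_comp, entry_dagger, Complex.mul_conj, entry_zero] at hi
  rw [← Complex.ofReal_sum, Complex.ofReal_eq_zero,
    Finset.sum_eq_zero_iff_of_nonneg fun _ _ => Complex.normSq_nonneg _] at hi
  exact Complex.normSq_eq_zero.1 (hi j (Finset.mem_univ _))

/-- The unitary structure given by the conjugate transpose. -/
def unitaryStructure (hD : ∀ g, D.T g + D.R g (-g) = D.F g (-g) g) :
    UnitaryStructure (AnyonCat D) (twist D) where
  dag := dagger
  dag_dag f := entry_ext fun i j => by simp [entry_dagger]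
  dag_id X := entry_ext fun i j => by
    rw [entry_dagger, entry_id, entry_id]
    by_cases h : i = j <;> simp [h, eq_comm]
  dag_comp := dagger_comp
  dag_add f g := entry_ext fun i j => by simp [entry_dagger]
  dag_smul c f := entry_ext fun i j => by simp [entry_dagger]
  dag_pos := eq_zero_of_comp_dagger
  dag_tensor f g := by
    apply entry_ext
    simp only [forall_pair]
    intro i i' j j'
    simp [entry_dagger, entry_tensorHom]
  dag_associator _ _ _ := dagger_monomial _ _ _
  dag_leftUnitor _ := dagger_monomial _ _ _
  dag_rightUnitor _ := dagger_monomial _ _ _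
  dag_braiding _ _ := dagger_monomial _ _ _
  dag_twist _ := dagger_monomial _ _ _
  dag_coevaluation X := by
    refine ⟨dual X, exactPairingDual X, ?_⟩
    change dagger (coev X) = _ ≫ _ ≫ ev X
    apply entry_ext
    simp only [forall_pair, forall_pt, forall_dualIdx]
    intro i j
    rw [entry_dagger, entry_coev, entry_whiskerRight_comp, Finset.sum_eq_single i]
    · rw [entry_twist, if_pos rfl, entry_braiding_comp, entry_ev, deg_dualIdx]
      by_cases h : i = j
      · subst h
        rw [if_pos rfl, if_pos rfl, ← phase_add, ← phase_add, ← add_assoc, hD, add_neg_cancel,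
          phase_zero, map_one]
      · rw [if_neg h, if_neg (Ne.symm h), map_zero, mul_zero, mul_zero]
    · intro k _ hk
      rw [entry_twist, if_neg hk.symm, zero_mul]
    · exact fun h => absurd (Finset.mem_univ _) h

end AnyonCat

end Pointed

namespace Modular

/-! ## Transport along equivalences -/

section

variable {C : Type u₁} [Category.{v₁} C] {D : Type u₂} [Category.{v₂} D]

theorem IsListOfSimples.of_iso [HasZeroMorphisms C] {n : ℕ} {S S' : Fin n → C}
    (h : IsListOfSimples S) (e : ∀ i, Nonempty (S' i ≅ S i)) : IsListOfSimples S' where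
  simple i := by
    have := h.simple i
    exact Simple.of_iso (e i).some
  distinct i j hij := h.distinct i j ⟨(e i).some.symm ≪≫ hij.some ≪≫ (e j).some⟩
  complete X hX := by
    obtain ⟨i, ⟨f⟩⟩ := h.complete X hX
    exact ⟨i, ⟨f ≪≫ (e i).some.symm⟩⟩

theorem IsListOfSimples.map [HasZeroMorphisms C] [HasZeroMorphisms D] {n : ℕ} {S : Fin n → C}
    (h : IsListOfSimples S) (F : C ⥤ D) [F.IsEquivalence] :
    IsListOfSimples (fun i => F.obj (S i)) where
  simple i := by
    have := h.simple i
    exact simple_obj F (S i)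
  distinct i j hij := h.distinct i j ⟨F.preimageIso hij.some⟩
  complete X hX := by
    obtain ⟨i, ⟨f⟩⟩ := h.complete (F.objPreimage X) (by
      rw [← simple_obj_iff F]
      exact Simple.of_iso (F.objObjPreimageIso X))
    exact ⟨i, ⟨(F.objObjPreimageIso X).symm ≪≫ F.mapIso f⟩⟩

variable [MonoidalCategory C] [MonoidalCategory D]

/-- A monoidal functor preserves exact pairings. -/
@[reducible]
def mapExactPairing (F : C ⥤ D) [F.Monoidal] (X Y : C) [ExactPairing X Y] :
    ExactPairing (F.obj X) (F.obj Y) where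
  coevaluation' := Functor.LaxMonoidal.ε F ≫ F.map (η_ X Y) ≫ Functor.OplaxMonoidal.δ F X Y
  evaluation' := Functor.LaxMonoidal.μ F Y X ≫ F.map (ε_ X Y) ≫ Functor.OplaxMonoidal.η F
  coevaluation_evaluation' := by
    have h := congrArg F.map (ExactPairing.coevaluation_evaluation X Y)
    simp only [Functor.map_comp, Functor.Monoidal.map_whiskerLeft,
      Functor.Monoidal.map_whiskerRight, Functor.Monoidal.map_associator_inv,
      Functor.Monoidal.map_rightUnitor, Functor.Monoidal.map_leftUnitor_inv, Category.assoc,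
      Functor.Monoidal.μ_δ_assoc] at h
    rw [cancel_epi] at h
    simp only [← Category.assoc, cancel_mono] at h
    simp only [Category.assoc] at h
    simp only [MonoidalCategory.whiskerLeft_comp, comp_whiskerRight, Category.assoc]
    rw [reassoc_of% h]
    simp [← comp_whiskerRight, ← MonoidalCategory.whiskerLeft_comp_assoc]
  evaluation_coevaluation' := by
    have h := congrArg F.map (ExactPairing.evaluation_coevaluation X Y)
    simp only [Functor.map_comp, Functor.Monoidal.map_whiskerLeft,
      Functor.Monoidal.map_whiskerRight, Functor.Monoidal.map_associator,
      Functor.Monoidal.map_leftUnitor, Functor.Monoidal.map_rightUnitor_inv, Category.assoc,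
      Functor.Monoidal.μ_δ_assoc] at h
    rw [cancel_epi] at h
    simp only [← Category.assoc, cancel_mono] at h
    simp only [Category.assoc] at h
    simp only [MonoidalCategory.whiskerLeft_comp, comp_whiskerRight, Category.assoc]
    rw [reassoc_of% h]
    simp [← comp_whiskerRight_assoc, ← MonoidalCategory.whiskerLeft_comp]

variable [BraidedCategory C] [BraidedCategory D]

theorem map_qtrace (F : C ⥤ D) [F.Braided] {θ : ∀ X : C, X ≅ X} {θ' : ∀ X : D, X ≅ X}
    (hθ : ∀ X, F.map (θ X).hom = (θ' (F.obj X)).hom) (X Y : C) [ExactPairing X Y] (f : X ⟶ X) :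
    letI := mapExactPairing F X Y
    F.map (qtrace θ X Y f) = Functor.OplaxMonoidal.η F ≫
      qtrace θ' (F.obj X) (F.obj Y) (F.map f) ≫ Functor.LaxMonoidal.ε F := by
  change _ = Functor.OplaxMonoidal.η F ≫ ((Functor.LaxMonoidal.ε F ≫ F.map (η_ X Y) ≫
    Functor.OplaxMonoidal.δ F X Y) ≫ _ ≫ _ ≫ Functor.LaxMonoidal.μ F Y X ≫ F.map (ε_ X Y) ≫
      Functor.OplaxMonoidal.η F) ≫ _
  simp only [qtrace, F.map_comp, Functor.Monoidal.map_whiskerRight, Functor.map_braiding, hθ,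
    Category.assoc, Functor.Monoidal.μ_δ_assoc, Functor.Monoidal.η_ε, Functor.Monoidal.η_ε_assoc,
    Category.comp_id]

end

section

variable {C : Type u₁} [Category.{v₁} C] [Preadditive C] [Linear ℂ C] [MonoidalCategory C]
  [BraidedCategory C] {D : Type u₂} [Category.{v₂} D] [Preadditive D] [Linear ℂ D]
  [MonoidalCategory D] [BraidedCategory D]

/-- Transport of a unitary structure along an equivalence whose structure isomorphisms are
unitary. -/
def UnitaryStructure.ofEquivalence {θ' : ∀ X : D, X ≅ X} (U : UnitaryStructure D θ')
    (θ : ∀ X : C, X ≅ X) (F : C ⥤ D) [F.Braided] [F.Additive] [F.Linear ℂ] [F.IsEquivalence]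
    (hθ : ∀ X, F.map (θ X).hom = (θ' (F.obj X)).hom)
    (hε : U.dag (Functor.LaxMonoidal.ε F) = Functor.OplaxMonoidal.η F)
    (hμ : ∀ X Y, U.dag (Functor.LaxMonoidal.μ F X Y) = Functor.OplaxMonoidal.δ F X Y)
    (hF : ∀ Y : D, ∃ (X : C) (e : F.obj X ≅ Y), U.dag e.hom = e.inv) :
    UnitaryStructure C θ :=
  have hη : U.dag (Functor.OplaxMonoidal.η F) = Functor.LaxMonoidal.ε F := by
    rw [← hε, U.dag_dag]
  have hδ : ∀ X Y, U.dag (Functor.OplaxMonoidal.δ F X Y) = Functor.LaxMonoidal.μ F X Y := by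
    intro X Y
    rw [← hμ, U.dag_dag]
  have hid := U.dag_id
  have hwl : ∀ (X : D) {Y Z : D} (f : Y ⟶ Z), U.dag (X ◁ f) = X ◁ U.dag f := by
    intro X Y Z f
    rw [← id_tensorHom, U.dag_tensor, hid, id_tensorHom]
  have hwr : ∀ {Y Z : D} (f : Y ⟶ Z) (X : D), U.dag (f ▷ X) = U.dag f ▷ X := by
    intro Y Z f X
    rw [← tensorHom_id, U.dag_tensor, hid, tensorHom_id]
  { dag := fun f => F.preimage (U.dag (F.map f))
    dag_dag := fun f => F.map_injective (by simp [U.dag_dag])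
    dag_id := fun X => F.map_injective (by simp [U.dag_id])
    dag_comp := fun f g => F.map_injective (by simp [U.dag_comp])
    dag_add := fun f g => F.map_injective (by simp [U.dag_add, F.map_add])
    dag_smul := fun c f => F.map_injective (by simp [U.dag_smul, F.map_smul])
    dag_pos := fun f h => F.map_injective (by
      have h' := congrArg F.map h
      rw [F.map_comp, F.map_preimage, F.map_zero] at h'
      rw [U.dag_pos _ h', F.map_zero])
    dag_tensor := fun f g => F.map_injective (by
      simp only [Functor.Monoidal.map_tensor, U.dag_comp, U.dag_tensor, hμ, hδ, F.map_preimage,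
        Category.assoc])
    dag_associator := fun X Y Z => F.map_injective (by
      simp only [Functor.Monoidal.map_associator, Functor.Monoidal.map_associator_inv,
        U.dag_comp, F.map_preimage, Category.assoc,
        hwl, hwr, hμ, hδ, U.dag_associator])
    dag_leftUnitor := fun X => F.map_injective (by
      simp only [Functor.Monoidal.map_leftUnitor, Functor.Monoidal.map_leftUnitor_inv,
        U.dag_comp, F.map_preimage, Category.assoc,
        hwr, hδ, hη, U.dag_leftUnitor])
    dag_rightUnitor := fun X => F.map_injective (by
      simp only [Functor.Monoidal.map_rightUnitor, Functor.Monoidal.map_rightUnitor_inv,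
        U.dag_comp, F.map_preimage, Category.assoc,
        hwl, hδ, hη, U.dag_rightUnitor])
    dag_braiding := fun X Y => F.map_injective (by
      rw [F.map_preimage, ← cancel_epi (F.map (β_ X Y).hom), ← F.map_comp, Iso.hom_inv_id]
      simp [U.dag_comp, hμ, hδ, U.dag_braiding])
    dag_twist := fun X => F.map_injective (by
      rw [F.map_preimage, hθ, U.dag_twist, ← cancel_epi (F.map (θ X).hom), ← F.map_comp,
        Iso.hom_inv_id, hθ, Iso.hom_inv_id, F.map_id])
    dag_coevaluation := fun X => by
      obtain ⟨Y', p, hp⟩ := U.dag_coevaluation (F.obj X)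
      obtain ⟨Y, e, he⟩ := hF Y'
      have he' : U.dag e.inv = e.hom := by rw [← he, U.dag_dag]
      let q : ExactPairing (F.obj X) (F.obj Y) := exactPairingCongrRight e
      refine ⟨Y, ExactPairing.ofFullyFaithful F X Y, ?_⟩
      apply F.map_injective
      rw [F.map_preimage]
      change U.dag (F.map (F.preimage (Functor.OplaxMonoidal.η F ≫
        (η_ (F.obj X) Y' ≫ F.obj X ◁ e.inv) ≫ Functor.LaxMonoidal.μ F X Y))) =
        F.map (_ ≫ _ ≫ F.preimage (Functor.OplaxMonoidal.δ F Y X ≫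
        (e.hom ▷ F.obj X ≫ ε_ (F.obj X) Y') ≫ Functor.LaxMonoidal.ε F))
      rw [F.map_preimage]
      simp only [F.map_comp, F.map_preimage, U.dag_comp, hμ, hη, hwl, he', hp,
        Functor.Monoidal.map_whiskerRight, Functor.map_braiding, hθ, Category.assoc,
        Functor.Monoidal.μ_δ_assoc, BraidedCategory.braiding_naturality_right_assoc,
        whisker_exchange_assoc] }

end

end Modular

namespace Pointed

namespace AnyonCat

variable {G : Type} [AddCommGroup G] {D : AnyonData G}

/-- The trace of the matrix of an endomorphism. -/
def tr {X : AnyonCat D} (f : X ⟶ X) : ℂ := ∑ i, entry f i i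

theorem tr_comm {X Y : AnyonCat D} (f : X ⟶ Y) (g : Y ⟶ X) : tr (f ≫ g) = tr (g ≫ f) := by
  simp only [tr, entry_comp]
  rw [Finset.sum_comm]
  exact Finset.sum_congr rfl fun _ _ => Finset.sum_congr rfl fun _ _ => mul_comm _ _

theorem tr_eq_of_iso {X Y : AnyonCat D} (e : X ≅ Y) {f : X ⟶ X} {g : Y ⟶ Y}
    (h : f ≫ e.hom = e.hom ≫ g) : tr f = tr g := by
  have h' : f = e.hom ≫ g ≫ e.inv := by rw [← Category.assoc, ← h]; simp
  rw [h', tr_comm]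
  simp

theorem tr_monodromy (g h : G) :
    tr ((β_ (simpleObj D g) (simpleObj D h)).hom ≫ (β_ (simpleObj D h) (simpleObj D g)).hom) =
      phase (D.monodromy g h) := by
  rw [tr, sum_pair, sum_only, sum_only, entry_braiding_comp, entry_braiding,
        if_pos ⟨rfl, rfl⟩, ← phase_add]
  rfl

theorem coevaluation_twist (hT : ∀ g, D.T (-g) = D.T g) (X Y : AnyonCat D) [ExactPairing X Y] :
    η_ X Y ≫ X ◁ (twist D Y).hom = η_ X Y ≫ (twist D X).hom ▷ Y := by
  apply entry_ext
  simp only [forall_pt, forall_pair]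
  intro i y
  rw [entry_comp, entry_comp, Finset.sum_eq_single (pair i y), Finset.sum_eq_single (pair i y)]
  · rw [entry_whiskerLeft, entry_whiskerRight, if_pos rfl, if_pos rfl, entry_twist, entry_twist,
      if_pos rfl, if_pos rfl]
    by_cases hy : entry (η_ X Y) pt (pair i y) = 0
    · simp [hy]
    · have hdy : (0 : G) = X.deg i + Y.deg y := deg_eq_of_entry hy
      rw [eq_neg_of_add_eq_zero_right hdy.symm, hT]
  · rw [forall_pair]
    intro i' y' _ h
    rw [entry_whiskerRight, entry_twist]
    split_ifs with h₁ h₂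
    · exact absurd (by rw [h₁, h₂]) h
    · rw [mul_zero]
    · rw [mul_zero]
  · exact fun h => absurd (Finset.mem_univ _) h
  · rw [forall_pair]
    intro i' y' _ h
    rw [entry_whiskerLeft, entry_twist]
    split_ifs with h₁ h₂
    · exact absurd (by rw [h₁, h₂]) h
    · rw [mul_zero]
    · rw [mul_zero]
  · exact fun h => absurd (Finset.mem_univ _) h

/-- A ribbon category that is equivalent to a nondegenerate pointed theory is modular. -/
theorem isModular_of_equivalence [Finite G] (hD : D.IsNondegenerate)
    {C : Type u₁} [Category.{v₁} C] [Preadditive C] [Linear ℂ C] [MonoidalCategory C]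
    [BraidedCategory C] (θ : ∀ X : C, X ≅ X) (F : C ⥤ AnyonCat D) [F.Braided] [F.Additive]
    [F.Linear ℂ] [F.IsEquivalence] (hθ : ∀ X, F.map (θ X).hom = (twist D (F.obj X)).hom) :
    IsModular C θ where
  monoidalPreadditive := monoidalPreadditive_of_faithful F
  monoidalLinear := by
    have := monoidalPreadditive_of_faithful F
    exact MonoidalLinear.ofFaithful ℂ F
  finiteDimensional X Y :=
    FiniteDimensional.of_injective (F.mapLinearMap ℂ (X := X) (Y := Y)) F.map_injective
  hasFiniteBiproducts := by
    have : HasFiniteProducts C := ⟨fun _ => Adjunction.hasLimitsOfShape_of_equivalence F⟩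
    exact HasFiniteBiproducts.of_hasFiniteProducts
  semisimple X := by
    have : HasFiniteProducts C := ⟨fun _ => Adjunction.hasLimitsOfShape_of_equivalence F⟩
    have : HasFiniteBiproducts C := HasFiniteBiproducts.of_hasFiniteProducts
    obtain ⟨n, S, hS, ⟨e⟩⟩ := exists_iso_biproduct (F.obj X)
    have : F.asEquivalence.functor.Additive := inferInstanceAs F.Additive
    have : F.inv.Additive := inferInstanceAs F.asEquivalence.inverse.Additive
    exact ⟨n, fun i => F.inv.obj (S i), fun i => by have := hS i; exact simple_obj _ _,
      ⟨F.asEquivalence.unitIso.app X ≪≫ F.inv.mapIso e ≪≫ F.inv.mapBiproduct S⟩⟩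
  schur_self X _ := by
    have := simple_obj F X
    rw [← finrank_end_of_simple (F.obj X)]
    exact (LinearEquiv.ofBijective (F.mapLinearMap ℂ (X := X) (Y := X))
      ⟨F.map_injective, F.map_surjective⟩).finrank_eq
  schur_ne X Y _ _ h f := by
    have := simple_obj F X
    have := simple_obj F Y
    exact (F.map_eq_zero_iff).1
      (hom_eq_zero_of_simple _ _ ⟨fun e => h.false (F.preimageIso e)⟩ (F.map f))
  simple_unit := by
    have : Simple (𝟙_ (AnyonCat D)) := simple_simpleObj 0
    rw [← simple_obj_iff F]
    exact Simple.of_iso (Functor.Monoidal.εIso F).symm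
  ribbon_nondegenerate := by
    classical
    have := Fintype.ofFinite G
    let _ : RigidCategory C :=
      rigidCategoryOfEquivalence (F := F) (G := F.inv) F.asEquivalence.toAdjunction
    let e : Fin (Fintype.card G) ≃ G := (Fintype.equivFin G).symm
    have hR := isRibbonTwist hD.twist_neg
    refine ⟨inferInstance, ⟨fun f => ?_, ?_, fun X Y => ?_, fun X => ?_⟩, Fintype.card G,
      fun i => F.objPreimage (simpleObj D (e i)),
      Matrix.of fun i j => phase (D.monodromy (e i) (e j)), ?_, fun i j => ?_, ?_⟩
    · apply F.map_injective
      rw [F.map_comp, F.map_comp, hθ, hθ, comp_twist]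
    · apply F.map_injective
      rw [hθ, F.map_id, ← cancel_epi (Functor.LaxMonoidal.ε F), comp_twist, hR.unit,
        Category.id_comp,
        Category.comp_id]
    · apply F.map_injective
      rw [hθ, ← cancel_epi (Functor.LaxMonoidal.μ F X Y), comp_twist, twist_tensor]
      simp [hθ, Functor.Monoidal.map_tensor]
    · apply eq_rightAdjointMate
      apply F.map_injective
      let _ := mapExactPairing F X Xᘁ
      have h := coevaluation_twist hD.twist_neg (F.obj X) (F.obj Xᘁ)
      change (Functor.LaxMonoidal.ε F ≫ F.map (η_ X Xᘁ) ≫ Functor.OplaxMonoidal.δ F X Xᘁ) ≫ _ =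
        (Functor.LaxMonoidal.ε F ≫ F.map (η_ X Xᘁ) ≫ Functor.OplaxMonoidal.δ F X Xᘁ) ≫ _ at h
      simp only [Category.assoc] at h
      rw [← cancel_epi (Functor.LaxMonoidal.ε F), F.map_comp, F.map_comp,
        Functor.Monoidal.map_whiskerLeft,
        Functor.Monoidal.map_whiskerRight, hθ, hθ, reassoc_of% h]
    · have hS := (isListOfSimples (D := D) e).map F.inv
      exact hS.of_iso fun i => ⟨F.preimageIso (F.objObjPreimageIso _ ≪≫
        (F.asEquivalence.counitIso.app (simpleObj D (e i))).symm)⟩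
    · apply F.map_injective
      rw [map_qtrace F hθ, qtrace_eq hD.dim, F.map_smul, F.map_id]
      rw [Linear.smul_comp, Linear.comp_smul, Category.id_comp, Functor.Monoidal.η_ε]
      congr 1
      rw [Matrix.of_apply, ← tr_monodromy]
      refine tr_eq_of_iso ((Functor.Monoidal.μIso F _ _).symm ≪≫
        (F.objObjPreimageIso (simpleObj D (e i)) ⊗ᵢ F.objObjPreimageIso (simpleObj D (e j)))) ?_
      simp
    · have h := isUnit_det_monodromy hD
      rwa [← Matrix.det_submatrix_equiv_self e] at h

end AnyonCat

open AnyonCat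

theorem isNondegenerate_toricData : toricData.IsNondegenerate where
  dim g := by simp [toricData]
  twist_neg g := by simp [toricData]
  monodromy_add g g' h := by simp [AnyonData.monodromy, toricData]; ring
  nondegenerate g h := by
    have h₁ := h (0, 1)
    have h₂ := h (1, 0)
    simp only [AnyonData.monodromy, toricData, mul_one, mul_zero, zero_mul, one_mul, zero_add,
      add_zero] at h₁ h₂
    exact Prod.ext h₁ h₂

theorem isNondegenerate_doubledSemionData : doubledSemionData.IsNondegenerate where
  dim := by decide
  twist_neg := by decide
  monodromy_add := by unfold AnyonData.monodromy; decide
  nondegenerate := by unfold AnyonData.monodromy; decide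

/-- An object with two summands is their biproduct. -/
theorem AnyonCat.nonempty_iso_biprod {G : Type} [AddCommGroup G] {D : AnyonData G}
    (X : AnyonCat D) {g h : G} {i j : X.idx} (hij : i ≠ j) (hall : ∀ k, k = i ∨ k = j)
    (hi : X.deg i = g) (hj : X.deg j = h) :
    Nonempty (X ≅ simpleObj D g ⊞ simpleObj D h) := by
  subst hi hj
  let b : BinaryBicone (simpleObj D (X.deg i)) (simpleObj D (X.deg j)) :=
    { pt := X
      fst := proj X i
      snd := proj X j
      inl := incl X i
      inr := incl X j
      inl_fst := incl_proj X i
      inl_snd := incl_proj_ne X hij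
      inr_fst := incl_proj_ne X hij.symm
      inr_snd := incl_proj X j }
  have hb : b.IsBilimit := isBinaryBilimitOfTotal b (by
    refine entry_ext (X := X) (Y := X) fun k l => ?_
    change entry (proj X i ≫ incl X i + proj X j ≫ incl X j) k l = entry (𝟙 X) k l
    rw [entry_add, entry_comp, entry_comp, sum_only, sum_only, entry_id, entry_proj, entry_proj,
      entry_incl, entry_incl]
    rcases hall k with rfl | rfl
    · simp [hij]
    · simp [hij.symm])
  exact ⟨biprod.uniqueUpToIso _ _ hb⟩

/-! ## The algebra `1 ⊕ e²m²` -/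

theorem zmod_two_cases (k : ZMod 2) : k = 0 ∨ k = 1 := by
  revert k
  decide

theorem sum_zmod_two (f : ZMod 2 → ℂ) : ∑ k, f k = f 0 + f 1 := Fin.sum_univ_two f

theorem entry_one (k : ZMod 2) : entry η[condensate] pt k = if 0 = k then 1 else 0 := by
  rw [← phase_zero]
  rfl

theorem entry_mul (i j k : ZMod 2) :
    entry μ[condensate] (pair i j) k = if i + j = k then 1 else 0 := by
  rw [← phase_zero]
  rfl

theorem condensate_deg_add (i j : ZMod 2) :
    condensate.deg (i + j : ZMod 2) = condensate.deg i + condensate.deg j := by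
  revert i j
  decide

theorem condensate_deg_self (i : ZMod 2) :
    condensate.deg i + condensate.deg i = 0 := by
  revert i
  decide

/-- The counit of `1 ⊕ e²m²`: twice the projection to `1`. -/
def condensateCounit : condensate ⟶ 𝟙_ ToricCode :=
  ⟨Matrix.of fun k _ => if k = 0 then 2 else 0, fun k _ h => by
    have hk : k = 0 := by
      by_contra hne
      exact h (if_neg hne)
    subst hk
    rfl⟩

/-- The comultiplication of `1 ⊕ e²m²`. -/
def condensateComul : condensate ⟶ condensate ⊗ condensate :=
  ⟨Matrix.of fun k p => if p.1 + p.2 = k then 2⁻¹ else 0, fun k p h => by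
    have hk : p.1 + p.2 = k := by
      by_contra hne
      exact h (if_neg hne)
    subst hk
    exact condensate_deg_add p.1 p.2⟩

theorem entry_condensateCounit (k : ZMod 2) :
    entry condensateCounit k pt = if k = 0 then 2 else 0 := rfl

theorem entry_condensateComul (i j k : ZMod 2) :
    entry condensateComul k (pair i j) = if i + j = k then 2⁻¹ else 0 := rfl

theorem toric_F (a b c : ZMod 4 × ZMod 4) : toricData.F a b c = 0 := rfl

theorem one_add_one_zmod_two : (1 : ZMod 2) + 1 = 0 := rfl

instance condensateComon : ComonObj condensate where
  counit := condensateCounit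
  comul := condensateComul
  counit_comul := by
    apply entry_ext
    simp only [forall_pair, forall_pt, entry_comp, sum_pair, 
      entry_whiskerRight, entry_condensateCounit, entry_condensateComul, entry_leftUnitor_inv,
      sum_zmod_two]
    intro i j
    rcases zmod_two_cases i with rfl | rfl <;> rcases zmod_two_cases j with rfl | rfl <;>
      simp [one_add_one_zmod_two]
  comul_counit := by
    apply entry_ext
    simp only [forall_pair, forall_pt, entry_comp, sum_pair, 
      entry_whiskerLeft, entry_condensateCounit, entry_condensateComul, entry_rightUnitor_inv,
      sum_zmod_two]
    intro i j
    rcases zmod_two_cases i with rfl | rfl <;> rcases zmod_two_cases j with rfl | rfl <;>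
      simp [one_add_one_zmod_two]
  comul_assoc := by
    rw [← cancel_mono (α_ _ _ _).inv]
    simp only [Category.assoc, Iso.hom_inv_id, Category.comp_id]
    apply entry_ext
    simp only [forall_pair]
    intro i j k l
    rw [entry_comp, entry_comp, sum_pair, sum_pair]
    simp only [entry_whiskerLeft_comp, sum_pair, entry_associator_inv, entry_whiskerRight,
      entry_condensateComul, sum_zmod_two, toric_F, neg_zero, phase_zero]
    rcases zmod_two_cases i with rfl | rfl <;> rcases zmod_two_cases j with rfl | rfl <;>
      rcases zmod_two_cases k with rfl | rfl <;> rcases zmod_two_cases l with rfl | rfl <;>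
      simp [one_add_one_zmod_two]

theorem entry_counit (k : ZMod 2) :
    entry ε[condensate] k pt = if k = 0 then 2 else 0 := rfl

theorem entry_comul (i j k : ZMod 2) :
    entry Δ[condensate] k (pair i j) = if i + j = k then 2⁻¹ else 0 := rfl

theorem isFrobenius_condensate : IsFrobenius condensate where
  left := by
    apply entry_ext
    simp only [forall_pair]
    intro i j k l
    rw [entry_whiskerRight_comp, sum_pair, entry_comp]
    simp only [entry_associator_comp, entry_whiskerLeft, sum_zmod_two, entry_mul, entry_comul,
      toric_F, phase_zero]
    rcases zmod_two_cases i with rfl | rfl <;> rcases zmod_two_cases j with rfl | rfl <;>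
      rcases zmod_two_cases k with rfl | rfl <;> rcases zmod_two_cases l with rfl | rfl <;>
      simp [one_add_one_zmod_two]
  right := by
    apply entry_ext
    simp only [forall_pair]
    intro i j k l
    rw [entry_whiskerLeft_comp, sum_pair, entry_comp]
    simp only [entry_associator_inv_comp, entry_whiskerRight, sum_zmod_two, entry_mul, entry_comul,
      toric_F, neg_zero, phase_zero]
    rcases zmod_two_cases i with rfl | rfl <;> rcases zmod_two_cases j with rfl | rfl <;>
      rcases zmod_two_cases k with rfl | rfl <;> rcases zmod_two_cases l with rfl | rfl <;>
      simp [one_add_one_zmod_two]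

theorem entry_mul_counit (i j : ZMod 2) :
    entry (μ[condensate] ≫ ε[condensate]) (pair i j) pt =
      if i + j = 0 then 2 else 0 := by
  simp only [entry_comp,  sum_zmod_two, entry_mul]
  change _ * entry condensateCounit 0 pt + _ * entry condensateCounit 1 pt = _
  simp [entry_condensateCounit]

theorem twist_condensate : (AnyonCat.twist toricData condensate).hom = 𝟙 condensate := by
  have h : ∀ i, toricData.T (condensate.deg i) = 0 := by decide
  exact IsMonomial.ext (isMonomial_twist _) (isMonomial_id _) (fun _ => rfl) h

theorem condensate_commutative :
    (β_ condensate condensate).hom ≫ μ[condensate] = μ[condensate] := by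
  have h : ∀ i j, toricData.R (condensate.deg i) (condensate.deg j) = 0 := by decide
  exact IsMonomial.ext ((isMonomial_braiding _ _).comp isMonomial_condensateMul)
    isMonomial_condensateMul (fun p => add_comm (p.2 : ZMod 2) p.1)
    (fun p => (add_zero _).trans (h p.1 p.2))

theorem coevaluation_braiding (Y : ToricCode) [ExactPairing condensate Y] :
    ∀ (y : Y.idx) (j : ZMod 2), entry (η_ condensate Y ≫ (β_ condensate Y).hom) pt
      (pair y j) = entry (η_ condensate Y) pt (pair j y) := by
  intro y j
  rw [entry_comp, Finset.sum_eq_single (pair j y)]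
  · rw [entry_braiding, if_pos ⟨rfl, rfl⟩]
    by_cases hy : entry (η_ condensate Y) pt (pair j y) = 0
    · simp [hy]
    · have hdy : 0 = condensate.deg j + Y.deg y := deg_eq_of_entry hy
      rw [eq_neg_of_add_eq_zero_right hdy.symm]
      have h0 : ∀ j, toricData.R (condensate.deg j) (-condensate.deg j) = 0 := by
        decide
      rw [h0, phase_zero, mul_one]
  · rw [forall_pair]
    intro k y' _ h
    rw [entry_braiding, if_neg, mul_zero]
    rintro ⟨rfl, rfl⟩
    exact h rfl
  · exact fun h => absurd (Finset.mem_univ _) h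

theorem isCondensable_condensate : IsCondensable (AnyonCat.twist toricData) condensate where
  connected := by
    refine finrank_eq_one condensateUnit (fun h => ?_) fun f => ⟨entry f pt 0, entry_ext ?_⟩
    · have h' : entry η[condensate] pt 0 = 0 := congrArg (fun f => entry f pt (0 : ZMod 2)) h
      rw [entry_one, if_pos rfl] at h'
      exact one_ne_zero h'
    · rw [forall_pt]
      intro k
      rw [entry_smul]
      change _ * entry η[condensate] pt k = _
      rw [entry_one]
      rcases zmod_two_cases k with rfl | rfl
      · simp
      · rw [entry_eq_zero f (i := pt) (j := (1 : ZMod 2)) (by decide)]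
        simp
  commutative := condensate_commutative
  frobenius := by
    refine ⟨condensateComon, isFrobenius_condensate, fun Y _ => ?_, ?_, fun Y _ => ?_⟩
    · rw [twist_condensate, MonoidalCategory.whiskerLeft_id, Category.comp_id]
      apply entry_ext
      intro i y
      rw [entry_rightUnitor_inv_comp, entry_whiskerLeft_comp, entry_leftUnitor_inv_comp,
        entry_whiskerRight_comp, sum_pair, sum_pair, Finset.sum_comm]
      refine Finset.sum_congr rfl fun y' _ => Finset.sum_congr rfl ?_
      simp only [entry_associator_inv_comp, entry_associator_comp,
        entry_whiskerRight_comp, entry_whiskerLeft_comp, sum_pt, entry_leftUnitor,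
        entry_rightUnitor, coevaluation_braiding, entry_mul_counit]
      intro j _
      rw [add_comm j i, toric_F, toric_F, neg_zero]
    · apply entry_ext
      intro i j
      simp only [entry_comp, sum_pair, sum_zmod_two, entry_mul, entry_comul, entry_id]
      rcases zmod_two_cases i with rfl | rfl <;> rcases zmod_two_cases j with rfl | rfl <;>
        simp [one_add_one_zmod_two] <;> norm_num
    · rw [qtrace_eq isNondegenerate_toricData.dim, end_unit_eq (η[condensate] ≫ ε[condensate])]
      congr 1
      simp only [entry_comp, sum_zmod_two, entry_one, entry_counit, entry_id]
      simp [one_add_one_eq_two]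

end Pointed

namespace Modular.RMod

section

variable {C : Type u} [Category.{v} C] [MonoidalCategory C]

/-- The free module on an object. -/
@[simps]
def free (A : C) [MonObj A] : C ⥤ RMod A where
  obj X :=
    { X := X ⊗ A
      act := (α_ X A A).hom ≫ X ◁ μ[A]
      act_one := by simp [← MonoidalCategory.whiskerLeft_comp]
      act_assoc := by
        simp only [comp_whiskerRight, Category.assoc, associator_naturality_right_assoc,
          associator_naturality_middle_assoc, ← MonoidalCategory.whiskerLeft_comp,
          MonObj.mul_assoc]
        rw [MonoidalCategory.whiskerLeft_comp, pentagon_assoc] }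
  map f := ⟨f ▷ A, by simp [whisker_exchange]⟩

variable {A : C} [MonObj A]

/-- The module map from a free module that extends a morphism. -/
def freeDesc {X : C} (M : RMod A) (f : X ⟶ M.X) : (free A).obj X ⟶ M where
  hom := f ▷ A ≫ M.act
  linear := by
    change ((α_ X A A).hom ≫ X ◁ μ[A]) ≫ f ▷ A ≫ M.act = (f ▷ A ≫ M.act) ▷ A ≫ M.act
    rw [comp_whiskerRight, Category.assoc, Category.assoc, M.act_assoc,
      associator_naturality_left_assoc, ← whisker_exchange_assoc]

/-- A module map whose underlying morphism has an inverse is an isomorphism. -/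
def isoMk {M N : RMod A} (f : M ⟶ N) (g : N.X ⟶ M.X) (h : f.hom ≫ g = 𝟙 _)
    (h' : g ≫ f.hom = 𝟙 _) : M ≅ N where
  hom := f
  inv := ⟨g, by
    have hl := f.linear
    have h1 : N.act = (g ▷ A) ≫ (f.hom ▷ A) ≫ N.act := by
      rw [← comp_whiskerRight_assoc, h']; simp
    rw [h1, ← hl]
    simp [h]⟩
  hom_inv_id := hom_ext h
  inv_hom_id := hom_ext h'

end

end Modular.RMod

namespace Pointed

open AnyonCat

/-! ## Modules over the condensate -/

section

variable (M : RMod condensate)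

theorem entry_act_zero (i j : M.X.idx) :
    entry M.act (pair i (0 : ZMod 2)) j = if i = j then 1 else 0 := by
  have h := congrArg (fun f => entry f (pair i pt) j) M.act_one
  rw [entry_whiskerLeft_comp, sum_zmod_two, entry_rightUnitor, entry_one, entry_one] at h
  simpa using h

theorem sum_entry_act (k l : ZMod 2) (i j : M.X.idx) :
    ∑ m, entry M.act (pair i k) m * entry M.act (pair m l) j =
      entry M.act (pair i (k + l : ZMod 2)) j := by
  have h := congrArg (fun f => entry f (pair (pair i k) l) j) M.act_assoc
  rw [entry_whiskerRight_comp, entry_associator_comp, entry_whiskerLeft_comp, sum_zmod_two,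
    entry_mul, entry_mul, toric_F, phase_zero, one_mul] at h
  rw [h]
  rcases zmod_two_cases (k + l) with h | h <;> simp [h]

theorem entry_linear {M N : RMod condensate} (f : M ⟶ N) (k : ZMod 2) (i : M.X.idx)
    (j : N.X.idx) : ∑ m, entry M.act (pair i k) m * entry f.hom m j =
      ∑ m, entry f.hom i m * entry N.act (pair m k) j := by
  have h := congrArg (fun f => entry f (pair i k) j) f.linear
  rwa [entry_comp, entry_whiskerRight_comp] at h

end

/-- A choice of representatives for a set `G` of classes of charges modulo `e²m²`. -/
structure ChargeSection (G : Type) where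
  rep : G → ZMod 4 × ZMod 4
  label : ZMod 4 × ZMod 4 → G
  label_rep : ∀ g, label (rep g) = g
  label_add : ∀ d, label (d + (2, 2)) = label d

theorem condensate_deg_cases (k : ZMod 2) : condensate.deg k = 0 ∨ condensate.deg k = (2, 2) := by
  revert k
  decide

theorem condensate_deg_injective {k l : ZMod 2} (h : condensate.deg k = condensate.deg l) :
    k = l := by
  revert k l
  decide

namespace ChargeSection

variable {G : Type} (s : ChargeSection G)

theorem label_add_deg (d : ZMod 4 × ZMod 4) (k : ZMod 2) :
    s.label (d + condensate.deg k) = s.label d := by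
  rcases condensate_deg_cases k with h | h
  · rw [h, add_zero]
  · rw [h, s.label_add]

/-- The charges that are chosen as representatives. -/
def IsRep (d : ZMod 4 × ZMod 4) : Prop := s.rep (s.label d) = d

instance : DecidablePred s.IsRep := fun _ => inferInstanceAs (Decidable (_ = _))

theorem isRep_rep (g : G) : s.IsRep (s.rep g) := by rw [IsRep, s.label_rep]

theorem eq_zero_of_isRep {d : ZMod 4 × ZMod 4} {k : ZMod 2} (h : s.IsRep d)
    (h' : s.IsRep (d + condensate.deg k)) : k = 0 := by
  rw [IsRep, label_add_deg, h] at h'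
  exact condensate_deg_injective (l := 0) ((left_eq_add.1 h').trans rfl)

variable [AddCommGroup G] {D : AnyonData G}

/-- Replace labels by their representatives. -/
def relabel (D : AnyonData G) : AnyonCat D ⥤ ToricCode where
  obj X := { idx := X.idx, deg := fun i => s.rep (X.deg i) }
  map f := ⟨f.mat, fun i j h => congrArg s.rep (f.deg_eq i j h)⟩

/-- A summand of the relabelled object. -/
def rl {X : AnyonCat D} (i : X.idx) : ((s.relabel D).obj X).idx := i

theorem forall_rl {X : AnyonCat D} {p : ((s.relabel D).obj X).idx → Prop} :
    (∀ q, p q) ↔ ∀ i : X.idx, p (s.rl i) := Iff.rfl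

theorem sum_rl {X : AnyonCat D} (f : ((s.relabel D).obj X).idx → ℂ) :
    ∑ q, f q = ∑ i : X.idx, f (s.rl i) := rfl

theorem rl_inj {X : AnyonCat D} {i j : X.idx} : s.rl i = s.rl j ↔ i = j := Iff.rfl

theorem deg_rl {X : AnyonCat D} (i : X.idx) :
    ((s.relabel D).obj X).deg (s.rl i) = s.rep (X.deg i) := rfl

theorem entry_relabel {X Y : AnyonCat D} (f : X ⟶ Y) (i j) :
    entry ((s.relabel D).map f) (s.rl i) (s.rl j) = entry f i j := rfl

/-- The free module with the given representatives. -/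
def induce (D : AnyonData G) : AnyonCat D ⥤ RMod condensate := s.relabel D ⋙ RMod.free condensate

/-- The summands whose charges are representatives. -/
def restrictObj (D : AnyonData G) (X : ToricCode) : AnyonCat D where
  idx := {i : X.idx // s.IsRep (X.deg i)}
  deg i := s.label (X.deg i.1)

/-- A summand of the restricted object as a summand of the original one. -/
def val {X : ToricCode} (q : (s.restrictObj D X).idx) : X.idx := Subtype.val q

/-- A summand whose charge is a representative. -/
def mkIdx {X : ToricCode} (i : X.idx) (h : s.IsRep (X.deg i)) : (s.restrictObj D X).idx := ⟨i, h⟩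

theorem val_injective {X : ToricCode} :
    Function.Injective (s.val : (s.restrictObj D X).idx → X.idx) := Subtype.val_injective

theorem isRep_val {X : ToricCode} (q : (s.restrictObj D X).idx) : s.IsRep (X.deg (s.val q)) := q.2

theorem deg_restrictObj {X : ToricCode} (q : (s.restrictObj D X).idx) :
    (s.restrictObj D X).deg q = s.label (X.deg (s.val q)) := rfl

theorem rep_deg_restrictObj {X : ToricCode} (q : (s.restrictObj D X).idx) :
    s.rep ((s.restrictObj D X).deg q) = X.deg (s.val q) := s.isRep_val q

theorem sum_val {X : ToricCode} (f : X.idx → ℂ) (hf : ∀ i, ¬ s.IsRep (X.deg i) → f i = 0) :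
    ∑ q : (s.restrictObj D X).idx, f (s.val q) = ∑ i, f i := by
  refine Fintype.sum_of_injective s.val s.val_injective _ _ (fun i hi => hf i fun h => ?_)
    fun _ => rfl
  exact hi ⟨s.mkIdx i h, rfl⟩

/-- The restriction of a morphism to the summands whose charges are representatives. -/
def restrictMap (D : AnyonData G) {X Y : ToricCode} (f : X ⟶ Y) :
    s.restrictObj D X ⟶ s.restrictObj D Y :=
  ⟨Matrix.of fun p q => entry f (s.val p) (s.val q), fun _ _ h =>
    congrArg s.label (deg_eq_of_entry (f := f) h)⟩

theorem entry_restrictMap {X Y : ToricCode} (f : X ⟶ Y) (p q) :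
    entry (s.restrictMap D f) p q = entry f (s.val p) (s.val q) := rfl

/-- Restriction to the summands whose charges are representatives. -/
def restrict (D : AnyonData G) : RMod condensate ⥤ AnyonCat D where
  obj M := s.restrictObj D M.X
  map f := s.restrictMap D f.hom
  map_id M := by
    apply entry_ext
    intro p q
    rw [entry_restrictMap, RMod.id_hom, entry_id, entry_id]
    exact if_congr s.val_injective.eq_iff rfl rfl
  map_comp {M N P} f g := by
    apply entry_ext
    intro p q
    rw [entry_restrictMap, RMod.comp_hom, entry_comp, entry_comp]
    symm
    refine s.sum_val (fun i => entry f.hom (s.val p) i * entry g.hom i (s.val q)) fun i hi => ?_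
    rw [entry_eq_zero f.hom, zero_mul]
    exact fun h => hi (h ▸ s.isRep_val p)

theorem isRep_pair_iff {X : AnyonCat D} (i : X.idx) (k : ZMod 2) :
    s.IsRep (((s.relabel D).obj X ⊗ condensate).deg (pair (s.rl i) k)) ↔ k = 0 := by
  rw [deg_pair, deg_rl]
  constructor
  · exact s.eq_zero_of_isRep (s.isRep_rep _)
  · rintro rfl
    have h : condensate.deg (0 : ZMod 2) = 0 := rfl
    rw [h, add_zero]
    exact s.isRep_rep _

/-- The summands of an object as the summands of degree zero of the induced module. -/
def unitEquiv (X : AnyonCat D) :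
    X.idx ≃ (s.restrictObj D ((s.relabel D).obj X ⊗ condensate)).idx where
  toFun i := s.mkIdx (pair (s.rl i) (0 : ZMod 2)) ((s.isRep_pair_iff i 0).2 rfl)
  invFun q := (s.val q).1
  left_inv _ := rfl
  right_inv q := by
    obtain ⟨⟨i, k⟩, h⟩ := q
    obtain rfl := (s.isRep_pair_iff i k).1 h
    rfl

theorem val_unitEquiv (X : AnyonCat D) (i : X.idx) :
    s.val (s.unitEquiv X i) = pair (s.rl i) (0 : ZMod 2) := rfl

theorem unitEquiv_deg (X : AnyonCat D) (i : X.idx) :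
    X.deg i = (s.restrictObj D ((s.relabel D).obj X ⊗ condensate)).deg (s.unitEquiv X i) := by
  rw [deg_restrictObj, val_unitEquiv, deg_pair, label_add_deg, deg_rl, label_rep]

/-- The unit of the equivalence. -/
def unitIsoObj (X : AnyonCat D) :
    X ≅ s.restrictObj D ((s.relabel D).obj X ⊗ condensate) :=
  monomial (s.unitEquiv X) (s.unitEquiv_deg X) (fun _ => 0)

theorem entry_unitIsoObj (X : AnyonCat D) (i q) :
    entry (s.unitIsoObj X).hom i q = if s.unitEquiv X i = q then 1 else 0 := by
  rw [← phase_zero]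
  rfl

theorem entry_unitIsoObj_comp (X : AnyonCat D) {Y : AnyonCat D} (f : _ ⟶ Y) (i q) :
    entry ((s.unitIsoObj X).hom ≫ f) i q = entry f (s.unitEquiv X i) q :=
  ((isMonomial_hom (s.unitEquiv X) (s.unitEquiv_deg X) (fun _ => 0)).entry_comp f _ _).trans (by
    rw [phase_zero, one_mul])

/-- The unit of the equivalence. -/
def unitIso (D : AnyonData G) : 𝟭 (AnyonCat D) ≅ s.induce D ⋙ s.restrict D :=
  NatIso.ofComponents s.unitIsoObj (by
    intro X Y f
    change f ≫ (s.unitIsoObj Y).hom = (s.unitIsoObj X).hom ≫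
      s.restrictMap D ((s.relabel D).map f ▷ condensate)
    apply entry_ext
    intro i q
    obtain ⟨j, rfl⟩ := (s.unitEquiv Y).surjective q
    rw [entry_unitIsoObj_comp, entry_restrictMap, entry_comp, val_unitEquiv, val_unitEquiv,
      entry_whiskerRight, if_pos rfl, entry_relabel]
    simp only [entry_unitIsoObj, EmbeddingLike.apply_eq_iff_eq]
    simp)

/-- The inclusion of the summands whose charges are representatives. -/
def restrictIncl (D : AnyonData G) (X : ToricCode) : (s.relabel D).obj (s.restrictObj D X) ⟶ X :=
  ⟨Matrix.of fun q j => if s.val (D := D) q = j then 1 else 0, fun q j h => by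
    have hj : s.val (D := D) q = j := by
      by_contra hne
      exact h (if_neg hne)
    subst hj
    exact s.rep_deg_restrictObj q⟩

theorem entry_restrictIncl (X : ToricCode) (q : (s.restrictObj D X).idx) (j) :
    entry (s.restrictIncl D X) (s.rl q) j = if s.val q = j then 1 else 0 := rfl

/-- The counit of the equivalence. -/
def counit (D : AnyonData G) (M : RMod condensate) :
    (s.induce D).obj ((s.restrict D).obj M) ⟶ M :=
  RMod.freeDesc M (s.restrictIncl D M.X)

/-- The morphism that underlies the counit. -/
def counitHom (D : AnyonData G) (M : RMod condensate) :
    (s.relabel D).obj (s.restrictObj D M.X) ⊗ condensate ⟶ M.X :=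
  s.restrictIncl D M.X ▷ condensate ≫ M.act

theorem entry_counitHom (M : RMod condensate) (q : (s.restrictObj D M.X).idx) (k : ZMod 2) (j) :
    entry (s.counitHom D M) (pair (s.rl q) k) j = entry M.act (pair (s.val q) k) j := by
  rw [counitHom, entry_whiskerRight_comp]
  simp only [entry_restrictIncl]
  simp

theorem entry_relabel_counitHom (M : RMod condensate) {Y : AnyonCat D}
    (u : Y ⟶ s.restrictObj D M.X) (i : Y.idx) (k : ZMod 2) (j) :
    entry ((s.relabel D).map u ▷ condensate ≫ s.counitHom D M) (pair (s.rl i) k) j =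
      ∑ q, entry u i q * entry M.act (pair (s.val q) k) j := by
  rw [entry_whiskerRight_comp, sum_rl]
  simp only [entry_relabel, entry_counitHom]

theorem counit_naturality {M N : RMod condensate} (f : M ⟶ N) :
    (s.induce D).map ((s.restrict D).map f) ≫ s.counit D N = s.counit D M ≫ f := by
  apply RMod.hom_ext
  change (s.relabel D).map (s.restrictMap D f.hom) ▷ condensate ≫ s.counitHom D N =
    s.counitHom D M ≫ f.hom
  apply entry_ext
  simp only [forall_pair, forall_rl]
  intro q k j
  rw [entry_relabel_counitHom, entry_comp]
  simp only [entry_restrictMap, entry_counitHom]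
  rw [entry_linear f]
  refine s.sum_val (fun i => entry f.hom (s.val q) i * entry N.act (pair i k) j) fun i hi => ?_
  rw [entry_eq_zero f.hom, zero_mul]
  exact fun h => hi (h ▸ s.isRep_val q)

theorem entry_act_induce (X : AnyonCat D) (i j : X.idx) (k l m : ZMod 2) :
    entry (X := ((s.relabel D).obj X ⊗ condensate) ⊗ condensate)
      (Y := (s.relabel D).obj X ⊗ condensate) ((s.induce D).obj X).act
      (pair (pair (s.rl i) k) l) (pair (s.rl j) m) = if i = j ∧ k + l = m then 1 else 0 := by
  change entry ((α_ ((s.relabel D).obj X) condensate condensate).hom ≫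
    (s.relabel D).obj X ◁ μ[condensate]) _ _ = _
  rw [entry_associator_comp, toric_F, phase_zero, one_mul, entry_whiskerLeft, entry_mul]
  simp only [rl_inj, ite_and]

theorem triangle (X : AnyonCat D) :
    (s.induce D).map (s.unitIsoObj X).hom ≫ s.counit D ((s.induce D).obj X) = 𝟙 _ := by
  apply RMod.hom_ext
  refine entry_ext (X := (s.relabel D).obj X ⊗ condensate)
    (Y := (s.relabel D).obj X ⊗ condensate) ?_
  simp only [forall_pair, forall_rl]
  intro i k j l
  refine (s.entry_relabel_counitHom ((s.induce D).obj X) (s.unitIsoObj X).hom i k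
    (pair (s.rl j) l)).trans ?_
  refine (Finset.sum_eq_single (s.unitEquiv X i) (fun q _ hq => ?_)
    fun h => absurd (Finset.mem_univ _) h).trans ?_
  · exact (congrArg (· * _) ((s.entry_unitIsoObj X i q).trans (if_neg hq.symm))).trans (zero_mul _)
  · refine (congrArg₂ (· * ·) ((s.entry_unitIsoObj X i _).trans (if_pos rfl))
      (s.entry_act_induce X i j 0 k l)).trans ?_
    refine (one_mul _).trans ?_
    refine Eq.trans ?_ (entry_id ((s.relabel D).obj X ⊗ condensate) _ _).symm
    simp only [pair_inj, rl_inj, zero_add]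

/-- Every charge of the module is equivalent to a representative. -/
def Supports (M : RMod condensate) : Prop :=
  ∀ i, ∃ k : ZMod 2, s.IsRep (M.X.deg i + condensate.deg k)

theorem deg_eq_of_entry_act {M : RMod condensate} {j : M.X.idx} {k : ZMod 2}
    {q : (s.restrictObj D M.X).idx} (h : entry M.act (pair j k) (s.val q) ≠ 0) :
    M.X.deg j = s.rep ((s.restrictObj D M.X).deg q) + condensate.deg k := by
  rw [rep_deg_restrictObj, ← deg_eq_of_entry h, deg_pair, add_assoc, condensate_deg_self, add_zero]

/-- The inverse of the counit. -/
def counitInv (D : AnyonData G) (M : RMod condensate) :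
    M.X ⟶ (s.relabel D).obj (s.restrictObj D M.X) ⊗ condensate :=
  ⟨Matrix.of fun j p => entry M.act (pair j p.2) (s.val (D := D) p.1), fun _ _ h =>
    s.deg_eq_of_entry_act h⟩

theorem entry_counitInv (M : RMod condensate) (j) (q : (s.restrictObj D M.X).idx) (k : ZMod 2) :
    entry (s.counitInv D M) j (pair (s.rl q) k) = entry M.act (pair j k) (s.val q) := rfl

theorem zmod_two_add_self (k : ZMod 2) : k + k = 0 := by
  revert k
  decide

theorem zmod_two_eq_of_add {k l : ZMod 2} (h : k + l = 0) : k = l := by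
  revert k l
  decide

theorem counitHom_counitInv (M : RMod condensate) :
    s.counitHom D M ≫ s.counitInv D M = 𝟙 _ := by
  apply entry_ext
  simp only [forall_pair, forall_rl]
  intro q k q' k'
  rw [entry_comp]
  simp only [entry_counitHom, entry_counitInv]
  rw [sum_entry_act, entry_id]
  simp only [pair_inj, rl_inj]
  by_cases hk : k = k'
  · subst hk
    simp only [zmod_two_add_self, entry_act_zero, s.val_injective.eq_iff, and_true]
  · rw [if_neg fun h => hk h.2, entry_eq_zero M.act]
    rw [deg_pair]
    intro h
    apply hk
    exact zmod_two_eq_of_add (s.eq_zero_of_isRep (s.isRep_val q) (h.symm ▸ s.isRep_val q'))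

theorem counitInv_counitHom (M : RMod condensate) (hM : s.Supports M) :
    s.counitInv D M ≫ s.counitHom D M = 𝟙 _ := by
  apply entry_ext
  intro j j'
  rw [entry_comp, sum_pair, sum_rl, Finset.sum_comm]
  simp only [entry_counitHom, entry_counitInv]
  obtain ⟨k, hk⟩ := hM j
  rw [Finset.sum_eq_single k]
  · rw [s.sum_val (fun i => entry M.act (pair j k) i * entry M.act (pair i k) j')]
    · rw [sum_entry_act, zmod_two_add_self, entry_act_zero, entry_id]
    · intro i hi
      rw [entry_eq_zero M.act, zero_mul]
      exact fun h => hi (h ▸ hk)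
  · intro l _ hl
    refine Finset.sum_eq_zero fun q _ => ?_
    rw [entry_eq_zero M.act, zero_mul]
    rw [deg_pair]
    intro h
    apply hl
    refine (zmod_two_eq_of_add (s.eq_zero_of_isRep (d := M.X.deg j + condensate.deg k)
      (k := k + l) hk (by
      rw [condensate_deg_add, add_assoc, ← add_assoc (condensate.deg k), condensate_deg_self,
        zero_add, h]
      exact s.isRep_val q))).symm
  · exact fun h => absurd (Finset.mem_univ _) h

/-- The counit is an isomorphism on supported modules. -/
def counitIsoObj (D : AnyonData G) (M : RMod condensate) (hM : s.Supports M) :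
    (s.induce D).obj ((s.restrict D).obj M) ≅ M :=
  RMod.isoMk (s.counit D M) (s.counitInv D M) (s.counitHom_counitInv M)
    (s.counitInv_counitHom M hM)

end ChargeSection

/-! ## Simple modules -/

/-- The pointed theory with trivial associator, braiding and twist. -/
def trivialData (G : Type) [AddCommGroup G] : AnyonData G where
  F _ _ _ := 0
  R _ _ := 0
  T _ := 0
  triangle _ _ := rfl
  pentagon _ _ _ _ := rfl
  hexagon _ _ _ := rfl
  hexagon' _ _ _ := by simp
  balancing _ _ := by simp

/-- Representatives for all charges modulo `e²m²`. -/
def fullSection : ChargeSection (ZMod 4 × ZMod 2) where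
  rep g := (g.1 + g.2.val, g.2.val)
  label d := (d.1 - d.2, (d.2.val : ZMod 2))
  label_rep := by decide
  label_add := by decide

theorem supports_fullSection (M : RMod condensate) : fullSection.Supports M := by
  have h : ∀ d : ZMod 4 × ZMod 4, ∃ k : ZMod 2,
      fullSection.IsRep (d + condensate.deg k) := by decide
  exact fun i => h _

/-- Modules are equivalent to graded vector spaces. -/
def inducedEquivalence : AnyonCat (trivialData (ZMod 4 × ZMod 2)) ≌ RMod condensate where
  functor := fullSection.induce _
  inverse := fullSection.restrict _
  unitIso := fullSection.unitIso _
  counitIso := NatIso.ofComponents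
    (fun M => fullSection.counitIsoObj _ M (supports_fullSection M))
    fun f => fullSection.counit_naturality f
  functor_unitIso_comp := fullSection.triangle

/-- The module induced from a simple object. -/
def simpleModule (g : ZMod 4 × ZMod 2) : RMod condensate :=
  inducedEquivalence.functor.obj (simpleObj _ g)

/-- The list of the labels of simple modules. -/
def simpleLabel : Fin 8 ≃ ZMod 4 × ZMod 2 :=
  Equiv.ofBijective ![(0, 0), (1, 0), (2, 0), (3, 0), (3, 1), (0, 1), (1, 1), (2, 1)] (by decide)

theorem isListOfSimples_simpleModule :
    IsListOfSimples (fun i => simpleModule (simpleLabel i)) :=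
  (isListOfSimples simpleLabel).map inducedEquivalence.functor

/-- A summand of an induced simple module. -/
def simpleIdx {g : ZMod 4 × ZMod 2} (k : ZMod 2) : (simpleModule g).X.idx := ((), k)

theorem forall_simpleIdx {g : ZMod 4 × ZMod 2} {p : (simpleModule g).X.idx → Prop} :
    (∀ q, p q) ↔ ∀ k, p (simpleIdx k) :=
  ⟨fun h _ => h _, fun h q => h q.2⟩

theorem simpleModule_iso {g : ZMod 4 × ZMod 2} (k : ZMod 2) {c d : ZMod 4 × ZMod 4}
    (hc : fullSection.rep g + condensate.deg k = c)
    (hd : fullSection.rep g + condensate.deg (k + 1 : ZMod 2) = d) :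
    Nonempty ((simpleModule g).X ≅ simpleObj toricData c ⊞ simpleObj toricData d) := by
  refine nonempty_iso_biprod _ (i := simpleIdx k) (j := simpleIdx (k + 1)) ?_ ?_ hc hd
  · intro h
    have h' : k = k + 1 := congrArg Prod.snd h
    exact one_ne_zero (left_eq_add.1 h')
  · rw [forall_simpleIdx]
    intro l
    have h : ∀ k l : ZMod 2, l = k ∨ l = k + 1 := by decide
    exact (h k l).imp (congrArg _) (congrArg _)

/-- The free module on the unit is the regular module. -/
def freeUnitIso {C : Type u} [Category.{v} C] [MonoidalCategory C] (A : C) [MonObj A] :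
    (RMod.free A).obj (𝟙_ C) ≅ RMod.regular A :=
  RMod.isoMk ⟨(λ_ A).hom, by
    change ((α_ (𝟙_ C) A A).hom ≫ 𝟙_ C ◁ μ[A]) ≫ (λ_ A).hom = (λ_ A).hom ▷ A ≫ μ[A]
    simp⟩ (λ_ A).inv (λ_ A).hom_inv_id (λ_ A).inv_hom_id

theorem simpleModule_zero : Nonempty (RMod.regular condensate ≅ simpleModule 0) :=
  ⟨(freeUnitIso condensate).symm⟩

/-! ## Local modules -/

/-- The charges that braid trivially with `e²m²`. -/
def IsLocalCharge (d : ZMod 4 × ZMod 4) : Prop := 2 * (d.1 + d.2) = 0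

instance : DecidablePred IsLocalCharge := fun _ => inferInstanceAs (Decidable (_ = _))

theorem entry_monodromy_act (M : RMod condensate) (i : M.X.idx) (k : ZMod 2) (j : M.X.idx) :
    entry ((β_ M.X condensate).hom ≫ (β_ condensate M.X).hom ≫ M.act) (pair i k) j =
      phase (toricData.monodromy (M.X.deg i) (condensate.deg k)) * entry M.act (pair i k) j := by
  rw [entry_braiding_comp, entry_braiding_comp, ← mul_assoc, ← phase_add]
  rfl

theorem isLocal_iff (M : RMod condensate) :
    RMod.IsLocal condensate M ↔ ∀ i, IsLocalCharge (M.X.deg i) := by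
  constructor
  · intro h i
    obtain ⟨j, hj⟩ : ∃ j, entry M.act (pair i (1 : ZMod 2)) j ≠ 0 := by
      by_contra! hall
      have h1 := sum_entry_act M 1 1 i i
      simp only [hall, zero_mul, Finset.sum_const_zero, one_add_one_zmod_two,
        entry_act_zero, if_true] at h1
      exact zero_ne_one h1
    have h2 := entry_monodromy_act M i 1 j
    rw [show (β_ M.X condensate).hom ≫ (β_ condensate M.X).hom ≫ M.act = M.act from h] at h2
    have h3 := (phase_eq_one_iff _).1 (mul_right_cancel₀ hj (h2.symm.trans (one_mul _).symm))
    have h4 : ∀ d, toricData.monodromy d (condensate.deg (1 : ZMod 2)) = 0 →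
        IsLocalCharge d := by decide
    exact h4 _ h3
  · intro h
    apply entry_ext
    simp only [forall_pair]
    intro i k j
    refine (entry_monodromy_act M i k j).trans ?_
    have h1 : ∀ d, IsLocalCharge d → ∀ k : ZMod 2,
        toricData.monodromy d (condensate.deg k) = 0 := by decide
    rw [h1 _ (h i) k, phase_zero, one_mul]

theorem isLocalCharge_add (d : ZMod 4 × ZMod 4) (k : ZMod 2) :
    IsLocalCharge (d + condensate.deg k) ↔ IsLocalCharge d := by
  revert d k
  decide

theorem isLocal_simpleModule (g : ZMod 4 × ZMod 2) :
    RMod.IsLocal condensate (simpleModule g) ↔ IsLocalCharge (fullSection.rep g) := by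
  rw [isLocal_iff, forall_simpleIdx]
  exact ⟨fun h => (isLocalCharge_add _ 0).1 (h 0), fun h k => (isLocalCharge_add _ k).2 h⟩

/-- Representatives for the local charges modulo `e²m²`, labelled by the anyons of the doubled
semion theory. -/
def localSection : ChargeSection (ZMod 2 × ZMod 2) where
  rep g := ((g.1.val : ZMod 4) - g.2.val, (g.1.val : ZMod 4) + g.2.val)
  label d := (((d.1 + d.2).val / 2 : ℕ), ((d.2 - d.1).val / 2 : ℕ))
  label_rep := by decide
  label_add := by decide

theorem supports_localSection {M : RMod condensate} (hM : RMod.IsLocal condensate M) :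
    localSection.Supports M := by
  have h : ∀ d : ZMod 4 × ZMod 4, IsLocalCharge d → ∃ k : ZMod 2,
      localSection.IsRep (d + condensate.deg k) := by decide
  exact fun i => h _ ((isLocal_iff M).1 hM i)

theorem isLocalCharge_rep (g : ZMod 2 × ZMod 2) : IsLocalCharge (localSection.rep g) := by
  revert g
  decide

theorem isLocal_induce (X : DoubledSemion) :
    RMod.IsLocal condensate ((localSection.induce doubledSemionData).obj X) :=
  (isLocal_iff _).2 fun _ => (isLocalCharge_add _ _).2 (isLocalCharge_rep _)

/-- Local modules are equivalent to the objects of the doubled semion category. -/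
def localEquivalence : DoubledSemion ≌ LocMod condensate where
  functor := (RMod.IsLocal condensate).lift (localSection.induce _) isLocal_induce
  inverse := (RMod.IsLocal condensate).ι ⋙ localSection.restrict _
  unitIso := NatIso.ofComponents localSection.unitIsoObj
    fun f => (localSection.unitIso doubledSemionData).hom.naturality f
  counitIso := NatIso.ofComponents
    (fun M => (RMod.IsLocal condensate).isoMk
      (localSection.counitIsoObj _ M.obj (supports_localSection M.property)))
    fun f => ObjectProperty.hom_ext _ (localSection.counit_naturality f.hom)
  functor_unitIso_comp X := ObjectProperty.hom_ext _ (localSection.triangle X)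

/-- The list of the labels of simple local modules. -/
def localLabel : Fin 4 ≃ ZMod 2 × ZMod 2 :=
  Equiv.ofBijective ![(0, 0), (1, 0), (1, 1), (0, 1)] (by decide)

/-- The local module induced from a simple object. -/
def simpleLocal (g : ZMod 2 × ZMod 2) : LocMod condensate :=
  localEquivalence.functor.obj (simpleObj _ g)

theorem isListOfSimples_simpleLocal : IsListOfSimples (fun i => simpleLocal (localLabel i)) :=
  (isListOfSimples localLabel).map localEquivalence.functor

theorem isMonomial_free_act (X : ToricCode) :
    IsMonomial ((RMod.free condensate).obj X).act
      (fun p => (p.1.1, (p.1.2 + p.2 : ZMod 2))) (fun _ => 0) := by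
  have h := (isMonomial_associator X condensate condensate).comp
    (isMonomial_condensateMul.whiskerLeft X)
  simp only [toric_F, add_zero] at h
  exact h

/-- Translation of the summands of a free module. -/
def translateEquiv (c d : ZMod 4 × ZMod 4) (k : ZMod 2) :
    (simpleObj toricData d ⊗ condensate).idx ≃ (simpleObj toricData c ⊗ condensate).idx :=
  (Equiv.refl Unit).prodCongr (Equiv.addLeft k)

theorem translateEquiv_deg {c d : ZMod 4 × ZMod 4} {k : ZMod 2} (h : d = c + condensate.deg k) (i) :
    (simpleObj toricData d ⊗ condensate).deg i =
      (simpleObj toricData c ⊗ condensate).deg (translateEquiv c d k i) := by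
  subst h
  exact (add_assoc _ _ _).trans (congrArg (c + ·) (condensate_deg_add _ _).symm)

/-- Free modules on charges that differ by the charge of a summand of the algebra are
isomorphic. -/
def freeTranslate {c d : ZMod 4 × ZMod 4} {k : ZMod 2} (h : d = c + condensate.deg k) :
    (RMod.free condensate).obj (simpleObj toricData d) ≅
      (RMod.free condensate).obj (simpleObj toricData c) :=
  RMod.isoMk ⟨(monomial (translateEquiv c d k) (translateEquiv_deg h) (fun _ => 0)).hom,
    IsMonomial.ext ((isMonomial_free_act _).comp (isMonomial_hom _ _ _))
      (((isMonomial_hom _ _ _).whiskerRight _).comp (isMonomial_free_act _))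
      (fun p => congrArg (Prod.mk ()) (add_assoc k p.1.2 p.2).symm) (fun _ => rfl)⟩
    (monomial (translateEquiv c d k) (translateEquiv_deg h) (fun _ => 0)).inv
    (Iso.hom_inv_id _) (Iso.inv_hom_id _)

theorem simpleLocal_iso {g : ZMod 2 × ZMod 2} {h : ZMod 4 × ZMod 2} (k : ZMod 2)
    (hgh : localSection.rep g = fullSection.rep h + condensate.deg k) :
    Nonempty ((simpleLocal g).obj ≅ simpleModule h) :=
  ⟨freeTranslate hgh⟩

namespace AnyonCat

variable {G : Type} [AddCommGroup G] {D : AnyonData G}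

/-- The morphism that maps the summand `i` to the summand `e i`, with the scalar `i ^ φ`. -/
def ofFun {X Y : AnyonCat D} (e : X.idx → Y.idx) (he : ∀ i, X.deg i = Y.deg (e i))
    (φ : X.idx → ZMod 4) : X ⟶ Y :=
  ⟨Matrix.of fun i j => if e i = j then phase (φ i) else 0, fun i j h => by
    have h' : e i = j := by
      by_contra hne
      exact h (if_neg hne)
    rw [he, h']⟩

theorem isMonomial_ofFun {X Y : AnyonCat D} (e : X.idx → Y.idx) (he : ∀ i, X.deg i = Y.deg (e i))
    (φ : X.idx → ZMod 4) : IsMonomial (ofFun e he φ) e φ := fun _ _ => rfl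

end AnyonCat

/-! ## The lax braided structure of induction -/

/-- The summand of the algebra that appears in the fusion of two representatives. -/
def fusionShift (g h : ZMod 2 × ZMod 2) : ZMod 2 := g.1 * h.1 + g.2 * h.2

/-- The phase of the fusion of two induced modules. -/
def fusionPhase (k : ZMod 2) (g h : ZMod 2 × ZMod 2) : ZMod 4 :=
  2 * k.val * (h.1.val + h.2.val) + g.1.val * h.2.val +
    2 * g.2.val * h.2.val * (g.1.val + h.1.val)

theorem rep_add_rep (g h : ZMod 2 × ZMod 2) (k l : ZMod 2) :
    localSection.rep g + condensate.deg k + (localSection.rep h + condensate.deg l) =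
      localSection.rep (g + h) + condensate.deg (k + l + fusionShift g h) := by
  revert g h k l
  decide

theorem fusionShift_assoc (a b c : ZMod 2 × ZMod 2) (k l m : ZMod 2) :
    k + l + fusionShift a b + m + fusionShift (a + b) c =
      k + (l + m + fusionShift b c) + fusionShift a (b + c) := by
  simp only [fusionShift, Prod.fst_add, Prod.snd_add]
  ring

theorem fusionPhase_assoc (a b c : ZMod 2 × ZMod 2) (k l : ZMod 2) :
    fusionPhase k a b + (fusionPhase (k + l + fusionShift a b) (a + b) c +
      doubledSemionData.F a b c) = fusionPhase l b c + fusionPhase k a (b + c) := by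
  revert a b c k l
  decide

theorem fusionPhase_braiding (a b : ZMod 2 × ZMod 2) (k l : ZMod 2) :
    fusionPhase k a b + doubledSemionData.R a b =
      toricData.R (localSection.rep a + condensate.deg k)
        (localSection.rep b + condensate.deg l) + fusionPhase l b a := by
  revert a b k l
  decide

theorem fusionPhase_balanced (a b : ZMod 2 × ZMod 2) (k l m : ZMod 2) :
    fusionPhase (k + m) a b =
      toricData.R (condensate.deg m) (localSection.rep b + condensate.deg l) +
        fusionPhase k a b := by
  revert a b k l m
  decide

theorem fusionPhase_zero_left (b : ZMod 2 × ZMod 2) : fusionPhase 0 0 b = 0 := by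
  revert b
  decide

theorem fusionPhase_zero_right (a : ZMod 2 × ZMod 2) (k : ZMod 2) : fusionPhase k a 0 = 0 := by
  revert a k
  decide

/-- The object that underlies an induced module. -/
abbrev induced (X : DoubledSemion) : ToricCode :=
  (localSection.relabel doubledSemionData).obj X ⊗ condensate

/-- The morphism that underlies a morphism of induced modules. -/
abbrev inducedMap {X Y : DoubledSemion} (f : X ⟶ Y) : induced X ⟶ induced Y :=
  (localSection.relabel doubledSemionData).map f ▷ condensate

/-- A summand of the object that underlies an induced module. -/
def indIdx {X : DoubledSemion} (i : X.idx) (k : ZMod 2) : (induced X).idx := (i, k)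

theorem sum_indIdx {X : DoubledSemion} (f : (induced X).idx → ℂ) :
    ∑ q, f q = ∑ i, ∑ k, f (indIdx i k) := Fintype.sum_prod_type f

theorem entry_inducedMap {X Y : DoubledSemion} (f : X ⟶ Y) (i : X.idx) (j : Y.idx)
    (k l : ZMod 2) :
    entry (inducedMap f) (indIdx i k) (indIdx j l) = if k = l then entry f i j else 0 :=
  entry_whiskerRight ((localSection.relabel doubledSemionData).map f) condensate i j k l

theorem isMonomial_inducedMap {X Y : DoubledSemion} {f : X ⟶ Y} {e φ} (hf : IsMonomial f e φ) :
    IsMonomial (inducedMap f) (fun p => (e p.1, p.2)) (fun p => φ p.1) :=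
  IsMonomial.whiskerRight (f := (localSection.relabel doubledSemionData).map f) hf condensate

/-- The unit of the algebra as a morphism to the induced module. -/
def induceUnit : 𝟙_ ToricCode ⟶ induced (𝟙_ DoubledSemion) :=
  ofFun (fun _ => ((), (0 : ZMod 2))) (fun _ => rfl) (fun _ => 0)

theorem isMonomial_induceUnit :
    IsMonomial induceUnit (fun _ => ((), (0 : ZMod 2))) (fun _ => 0) := isMonomial_ofFun _ _ _

/-- The projection from the tensor product of induced modules to the relative tensor product. -/
def fuse (X Y : DoubledSemion) : induced X ⊗ induced Y ⟶ induced (X ⊗ Y) :=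
  ofFun (fun p => ((p.1.1, p.2.1),
      (p.1.2 + p.2.2 + fusionShift (X.deg p.1.1) (Y.deg p.2.1) : ZMod 2)))
    (fun p => rep_add_rep (X.deg p.1.1) (Y.deg p.2.1) p.1.2 p.2.2)
    (fun p => fusionPhase p.1.2 (X.deg p.1.1) (Y.deg p.2.1))

theorem isMonomial_fuse (X Y : DoubledSemion) : IsMonomial (fuse X Y)
    (fun p => ((p.1.1, p.2.1), (p.1.2 + p.2.2 + fusionShift (X.deg p.1.1) (Y.deg p.2.1) : ZMod 2)))
    (fun p => fusionPhase p.1.2 (X.deg p.1.1) (Y.deg p.2.1)) := isMonomial_ofFun _ _ _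

theorem entry_fuse_comp (X Y : DoubledSemion) {W : ToricCode} (f : induced (X ⊗ Y) ⟶ W)
    (i : X.idx) (j : Y.idx) (k l : ZMod 2) (q) :
    entry (fuse X Y ≫ f) (pair (indIdx i k) (indIdx j l)) q =
      phase (fusionPhase k (X.deg i) (Y.deg j)) *
        entry f (indIdx (pair i j) (k + l + fusionShift (X.deg i) (Y.deg j))) q :=
  (isMonomial_fuse X Y).entry_comp f _ _

theorem entry_fuse (X Y : DoubledSemion) (i i' : X.idx) (j j' : Y.idx) (k l m : ZMod 2) :
    entry (fuse X Y) (pair (indIdx i k) (indIdx j l)) (indIdx (pair i' j') m) =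
      if (i = i' ∧ j = j') ∧ k + l + fusionShift (X.deg i) (Y.deg j) = m then
        phase (fusionPhase k (X.deg i) (Y.deg j)) else 0 := by
  change (if ((i, j), k + l + fusionShift (X.deg i) (Y.deg j)) = ((i', j'), m) then
    phase (fusionPhase k (X.deg i) (Y.deg j)) else 0) = _
  simp only [Prod.mk_inj]

theorem induced_hom_ext {X Y X' Y' : DoubledSemion}
    {f g : induced X ⊗ induced Y ⟶ induced (X' ⊗ Y')}
    (h : ∀ i k j l i' j' m, entry f (pair (indIdx i k) (indIdx j l)) (indIdx (pair i' j') m) =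
      entry g (pair (indIdx i k) (indIdx j l)) (indIdx (pair i' j') m)) : f = g :=
  entry_ext fun p q => h p.1.1 p.1.2 p.2.1 p.2.2 q.1.1 q.1.2 q.2

theorem fuse_natural_left {X X' : DoubledSemion} (f : X ⟶ X') (Y : DoubledSemion) :
    inducedMap f ▷ induced Y ≫ fuse X' Y = fuse X Y ≫ inducedMap (f ▷ Y) := by
  apply induced_hom_ext
  intro i k j l i' j' m
  rw [entry_fuse_comp, entry_inducedMap, entry_whiskerRight, entry_whiskerRight_comp, sum_indIdx]
  simp only [entry_inducedMap, entry_fuse]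
  by_cases hd : X.deg i = X'.deg i'
  · rw [Finset.sum_eq_single i', Finset.sum_eq_single k]
    · rw [if_pos rfl, ← hd]
      by_cases hj : j = j' <;> by_cases hm : k + l + fusionShift (X.deg i) (Y.deg j) = m <;>
        simp [hj, hm, mul_comm]
    · intro b _ hb
      rw [if_neg hb.symm, zero_mul]
    · exact fun h => absurd (Finset.mem_univ _) h
    · intro b _ hb
      simp [hb]
    · exact fun h => absurd (Finset.mem_univ _) h
  · rw [entry_eq_zero f hd]
    simp only [ite_self, mul_zero]
    refine Finset.sum_eq_zero fun b _ => Finset.sum_eq_zero fun n _ => ?_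
    by_cases hb : b = i'
    · rw [hb, entry_eq_zero f hd]
      simp
    · simp [hb]

theorem fuse_natural_right (X : DoubledSemion) {Y Y' : DoubledSemion} (f : Y ⟶ Y') :
    induced X ◁ inducedMap f ≫ fuse X Y' = fuse X Y ≫ inducedMap (X ◁ f) := by
  apply induced_hom_ext
  intro i k j l i' j' m
  rw [entry_fuse_comp, entry_inducedMap, entry_whiskerLeft, entry_whiskerLeft_comp, sum_indIdx]
  simp only [entry_inducedMap, entry_fuse]
  by_cases hd : Y.deg j = Y'.deg j'
  · rw [Finset.sum_eq_single j', Finset.sum_eq_single l]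
    · rw [if_pos rfl, ← hd]
      by_cases hj : i = i' <;> by_cases hm : k + l + fusionShift (X.deg i) (Y.deg j) = m <;>
        simp [hj, hm, mul_comm]
    · intro b _ hb
      rw [if_neg hb.symm, zero_mul]
    · exact fun h => absurd (Finset.mem_univ _) h
    · intro b _ hb
      simp [hb]
    · exact fun h => absurd (Finset.mem_univ _) h
  · rw [entry_eq_zero f hd]
    simp only [ite_self, mul_zero]
    refine Finset.sum_eq_zero fun b _ => Finset.sum_eq_zero fun n _ => ?_
    by_cases hb : b = j'
    · rw [hb, entry_eq_zero f hd]
      simp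
    · simp [hb]

theorem fuse_associativity (X Y Z : DoubledSemion) :
    fuse X Y ▷ induced Z ≫ fuse (X ⊗ Y) Z ≫ inducedMap (α_ X Y Z).hom =
      (α_ (induced X) (induced Y) (induced Z)).hom ≫ induced X ◁ fuse Y Z ≫ fuse X (Y ⊗ Z) :=
  IsMonomial.ext
    (((isMonomial_fuse X Y).whiskerRight _).comp ((isMonomial_fuse (X ⊗ Y) Z).comp
      (isMonomial_inducedMap (isMonomial_associator X Y Z))))
    ((isMonomial_associator _ _ _).comp (((isMonomial_fuse Y Z).whiskerLeft _).comp
      (isMonomial_fuse X (Y ⊗ Z))))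
    (fun p => congrArg (Prod.mk (p.1.1.1, (p.1.2.1, p.2.1))) (fusionShift_assoc (X.deg p.1.1.1)
      (Y.deg p.1.2.1) (Z.deg p.2.1) p.1.1.2 p.1.2.2 p.2.2))
    (fun p => (fusionPhase_assoc (X.deg p.1.1.1) (Y.deg p.1.2.1) (Z.deg p.2.1) p.1.1.2
      p.1.2.2).trans (zero_add _).symm)

theorem fuse_left_unitality (X : DoubledSemion) :
    (λ_ (induced X)).hom =
      induceUnit ▷ induced X ≫ fuse (𝟙_ DoubledSemion) X ≫ inducedMap (λ_ X).hom :=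
  IsMonomial.ext (isMonomial_leftUnitor _)
    ((isMonomial_induceUnit.whiskerRight _).comp ((isMonomial_fuse _ X).comp
      (isMonomial_inducedMap (isMonomial_leftUnitor X))))
    (fun p => congrArg (Prod.mk p.2.1) (by
      change p.2.2 = 0 + p.2.2 + fusionShift 0 (X.deg p.2.1)
      simp [fusionShift]))
    (fun p => by
      change 0 = 0 + (fusionPhase 0 0 (X.deg p.2.1) + 0)
      rw [fusionPhase_zero_left]
      rfl)

theorem fuse_right_unitality (X : DoubledSemion) :
    (ρ_ (induced X)).hom =
      induced X ◁ induceUnit ≫ fuse X (𝟙_ DoubledSemion) ≫ inducedMap (ρ_ X).hom :=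
  IsMonomial.ext (isMonomial_rightUnitor _)
    ((isMonomial_induceUnit.whiskerLeft _).comp ((isMonomial_fuse X _).comp
      (isMonomial_inducedMap (isMonomial_rightUnitor X))))
    (fun p => congrArg (Prod.mk p.1.1) (by
      change p.1.2 = p.1.2 + 0 + fusionShift (X.deg p.1.1) 0
      simp [fusionShift]))
    (fun p => by
      change 0 = 0 + (fusionPhase p.1.2 (X.deg p.1.1) 0 + 0)
      rw [fusionPhase_zero_right]
      rfl)

theorem fuse_braiding (X Y : DoubledSemion) :
    fuse X Y ≫ inducedMap (β_ X Y).hom = (β_ (induced X) (induced Y)).hom ≫ fuse Y X :=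
  IsMonomial.ext
    ((isMonomial_fuse X Y).comp (isMonomial_inducedMap (isMonomial_braiding X Y)))
    ((isMonomial_braiding _ _).comp (isMonomial_fuse Y X))
    (fun p => congrArg (Prod.mk (p.2.1, p.1.1)) (by
      change p.1.2 + p.2.2 + fusionShift (X.deg p.1.1) (Y.deg p.2.1) =
        p.2.2 + p.1.2 + fusionShift (Y.deg p.2.1) (X.deg p.1.1)
      simp only [fusionShift]
      ring))
    (fun p => fusionPhase_braiding (X.deg p.1.1) (Y.deg p.2.1) p.1.2 p.2.2)

/-- Induction to the toric code. -/
def induction : DoubledSemion ⥤ ToricCode :=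
  localSection.induce doubledSemionData ⋙ RMod.forget condensate

instance : induction.LaxMonoidal :=
  Functor.LaxMonoidal.mk induceUnit fuse fuse_natural_left (fun X => fuse_natural_right X)
    fuse_associativity fuse_left_unitality fuse_right_unitality

instance : induction.LaxBraided where
  braided := fuse_braiding

end Pointed

namespace Modular

section

variable {C : Type u₁} [Category.{v₁} C] [MonoidalCategory C] {D : Type u₂} [Category.{v₂} D]
  [MonoidalCategory D]

/-- Transfer of a lax monoidal structure along a natural isomorphism. -/
@[reducible]
def laxMonoidalOfIso {F G : C ⥤ D} (i : F ≅ G) [F.LaxMonoidal] : G.LaxMonoidal :=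
  Functor.LaxMonoidal.ofTensorHom
    (Functor.LaxMonoidal.ε F ≫ i.hom.app (𝟙_ C))
    (fun X Y => (i.inv.app X ⊗ₘ i.inv.app Y) ≫ Functor.LaxMonoidal.μ F X Y ≫ i.hom.app (X ⊗ Y))
    (by
      intro X Y X' Y' f g
      have h := Functor.LaxMonoidal.μ_natural F f g
      simp only [Category.assoc, ← i.hom.naturality, ← reassoc_of% h,
        MonoidalCategory.tensorHom_comp_tensorHom_assoc, i.inv.naturality])
    (by
      intro X Y Z
      have h := Functor.LaxMonoidal.associativity F X Y Z
      have h₁ : ((i.inv.app X ⊗ₘ i.inv.app Y) ≫ Functor.LaxMonoidal.μ F X Y) ⊗ₘ i.inv.app Z =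
          ((i.inv.app X ⊗ₘ i.inv.app Y) ⊗ₘ i.inv.app Z) ≫
            Functor.LaxMonoidal.μ F X Y ▷ F.obj Z := by
        rw [← MonoidalCategory.tensorHom_id, MonoidalCategory.tensorHom_comp_tensorHom,
          Category.comp_id]
      have h₂ : i.inv.app X ⊗ₘ ((i.inv.app Y ⊗ₘ i.inv.app Z) ≫ Functor.LaxMonoidal.μ F Y Z) =
          (i.inv.app X ⊗ₘ (i.inv.app Y ⊗ₘ i.inv.app Z)) ≫
            F.obj X ◁ Functor.LaxMonoidal.μ F Y Z := by
        rw [← MonoidalCategory.id_tensorHom, MonoidalCategory.tensorHom_comp_tensorHom,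
          Category.comp_id]
      simp only [Category.assoc, MonoidalCategory.tensorHom_comp_tensorHom_assoc,
        Iso.hom_inv_id_app, Category.comp_id, Category.id_comp, ← i.hom.naturality]
      rw [h₁, h₂, Category.assoc, Category.assoc, reassoc_of% h,
        MonoidalCategory.associator_naturality_assoc])
    (by
      intro X
      have h := Functor.LaxMonoidal.left_unitality F X
      have h₁ : Functor.LaxMonoidal.ε F ⊗ₘ i.inv.app X =
          𝟙_ D ◁ i.inv.app X ≫ Functor.LaxMonoidal.ε F ▷ F.obj X := by
        rw [MonoidalCategory.tensorHom_def']
      simp only [Category.assoc, MonoidalCategory.tensorHom_comp_tensorHom_assoc,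
        Iso.hom_inv_id_app, Category.comp_id, Category.id_comp, ← i.hom.naturality]
      rw [h₁, Category.assoc, ← reassoc_of% h, leftUnitor_naturality_assoc,
        Iso.inv_hom_id_app, Category.comp_id])
    (by
      intro X
      have h := Functor.LaxMonoidal.right_unitality F X
      have h₁ : i.inv.app X ⊗ₘ Functor.LaxMonoidal.ε F =
          i.inv.app X ▷ 𝟙_ D ≫ F.obj X ◁ Functor.LaxMonoidal.ε F := by
        rw [MonoidalCategory.tensorHom_def]
      simp only [Category.assoc, MonoidalCategory.tensorHom_comp_tensorHom_assoc,
        Iso.hom_inv_id_app, Category.comp_id, Category.id_comp, ← i.hom.naturality]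
      rw [h₁, Category.assoc, ← reassoc_of% h, rightUnitor_naturality_assoc,
        Iso.inv_hom_id_app, Category.comp_id])

/-- Transfer of a lax braided structure along a natural isomorphism. -/
@[reducible]
def laxBraidedOfIso [BraidedCategory C] [BraidedCategory D] {F G : C ⥤ D} (i : F ≅ G)
    [F.LaxBraided] : G.LaxBraided where
  toLaxMonoidal := laxMonoidalOfIso i
  braided X Y := by
    change ((i.inv.app X ⊗ₘ i.inv.app Y) ≫ Functor.LaxMonoidal.μ F X Y ≫ i.hom.app (X ⊗ Y)) ≫ _ =
      _ ≫ (i.inv.app Y ⊗ₘ i.inv.app X) ≫ Functor.LaxMonoidal.μ F Y X ≫ i.hom.app (Y ⊗ X)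
    rw [← BraidedCategory.braiding_naturality_assoc, ← Functor.LaxBraided.braided_assoc]
    simp

end

section

variable {C : Type u} [Category.{v} C] [MonoidalCategory C] {A : C} [MonObj A]

theorem RMod.act_tensor_naturality {M M' N N' : RMod A} (f : M ⟶ M') (g : N ⟶ N') :
    (f.hom ⊗ₘ g.hom) ▷ A ≫ (α_ M'.X N'.X A).hom ≫ M'.X ◁ N'.act =
      ((α_ M.X N.X A).hom ≫ M.X ◁ N.act) ≫ (f.hom ⊗ₘ g.hom) := by
  have h := g.linear
  rw [MonoidalCategory.tensorHom_def, Category.assoc, whisker_exchange_assoc,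
    ← MonoidalCategory.whiskerLeft_comp, h]
  simp

theorem RMod.act_left_naturality {M M' N N' : RMod A} (f : M ⟶ M') (g : N ⟶ N') :
    (f.hom ▷ A ⊗ₘ g.hom) ≫ M'.act ▷ N'.X = M.act ▷ N.X ≫ (f.hom ⊗ₘ g.hom) := by
  rw [MonoidalCategory.tensorHom_def, MonoidalCategory.tensorHom_def, Category.assoc,
    whisker_exchange, ← comp_whiskerRight_assoc, ← f.linear, comp_whiskerRight_assoc]

theorem RMod.act_right_naturality [BraidedCategory C] {M M' N N' : RMod A} (f : M ⟶ M')
    (g : N ⟶ N') :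
    (f.hom ▷ A ⊗ₘ g.hom) ≫ (α_ M'.X A N'.X).hom ≫ M'.X ◁ ((β_ A N'.X).hom ≫ N'.act) =
      ((α_ M.X A N.X).hom ≫ M.X ◁ ((β_ A N.X).hom ≫ N.act)) ≫ (f.hom ⊗ₘ g.hom) := by
  have h := g.linear
  have h' : A ◁ g.hom ≫ (β_ A N'.X).hom ≫ N'.act = ((β_ A N.X).hom ≫ N.act) ≫ g.hom := by
    rw [BraidedCategory.braiding_naturality_right_assoc, Category.assoc, h]
  rw [← MonoidalCategory.tensorHom_id, MonoidalCategory.associator_naturality_assoc,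
    MonoidalCategory.id_tensorHom, MonoidalCategory.tensorHom_def, Category.assoc,
    ← MonoidalCategory.whiskerLeft_comp, h', MonoidalCategory.whiskerLeft_comp,
    ← whisker_exchange_assoc, MonoidalCategory.tensorHom_def, Category.assoc]

section

variable {M M' N N' P : RMod A} (f : M' ≅ M) (g : N' ≅ N) (p : M'.X ⊗ N'.X ⟶ P.X)

theorem RMod.act_tensor_of_iso
    (h : (α_ M'.X N'.X A).hom ≫ M'.X ◁ N'.act ≫ p = p ▷ A ≫ P.act) :
    (α_ M.X N.X A).hom ≫ M.X ◁ N.act ≫ (f.inv.hom ⊗ₘ g.inv.hom) ≫ p =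
      ((f.inv.hom ⊗ₘ g.inv.hom) ≫ p) ▷ A ≫ P.act := by
  have h' := RMod.act_tensor_naturality f.inv g.inv
  rw [Category.assoc] at h'
  rw [← reassoc_of% h', h, comp_whiskerRight, Category.assoc]

variable [BraidedCategory C]

theorem RMod.balanced_of_iso
    (h : M'.act ▷ N'.X ≫ p =
      ((α_ M'.X A N'.X).hom ≫ M'.X ◁ ((β_ A N'.X).hom ≫ N'.act)) ≫ p) :
    M.act ▷ N.X ≫ (f.inv.hom ⊗ₘ g.inv.hom) ≫ p =
      ((α_ M.X A N.X).hom ≫ M.X ◁ ((β_ A N.X).hom ≫ N.act)) ≫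
        (f.inv.hom ⊗ₘ g.inv.hom) ≫ p := by
  have h' := RMod.act_right_naturality f.inv g.inv
  rw [Category.assoc] at h'
  rw [← reassoc_of% RMod.act_left_naturality f.inv g.inv, h, Category.assoc, reassoc_of% h',
    Category.assoc]

/-- A split coequalizer of the two actions of an algebra on the tensor product of modules gives
one for isomorphic modules. -/
def RMod.splitCoequalizerOfIso
    (s : IsSplitCoequalizer (M'.act ▷ N'.X)
      ((α_ M'.X A N'.X).hom ≫ M'.X ◁ ((β_ A N'.X).hom ≫ N'.act)) p) :
    IsSplitCoequalizer (M.act ▷ N.X) ((α_ M.X A N.X).hom ≫ M.X ◁ ((β_ A N.X).hom ≫ N.act))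
      ((f.inv.hom ⊗ₘ g.inv.hom) ≫ p) :=
  have hf : f.hom.hom ≫ f.inv.hom = 𝟙 _ := congrArg Hom.hom f.hom_inv_id
  have hg : g.hom.hom ≫ g.inv.hom = 𝟙 _ := congrArg Hom.hom g.hom_inv_id
  have hf' : f.inv.hom ≫ f.hom.hom = 𝟙 _ := congrArg Hom.hom f.inv_hom_id
  have hg' : g.inv.hom ≫ g.hom.hom = 𝟙 _ := congrArg Hom.hom g.inv_hom_id
  { rightSection := s.rightSection ≫ (f.hom.hom ⊗ₘ g.hom.hom)
    leftSection := (f.inv.hom ⊗ₘ g.inv.hom) ≫ s.leftSection ≫ (f.hom.hom ▷ A ⊗ₘ g.hom.hom)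
    condition := RMod.balanced_of_iso f g p s.condition
    rightSection_π := by
      rw [Category.assoc, MonoidalCategory.tensorHom_comp_tensorHom_assoc, hf, hg,
        MonoidalCategory.id_tensorHom_id, Category.id_comp, s.rightSection_π]
    leftSection_bottom := by
      rw [Category.assoc, Category.assoc, RMod.act_right_naturality f.hom g.hom,
        ← Category.assoc s.leftSection, s.leftSection_bottom, Category.id_comp,
        MonoidalCategory.tensorHom_comp_tensorHom, hf', hg',
        MonoidalCategory.id_tensorHom_id]
    leftSection_top := by
      rw [Category.assoc, Category.assoc, RMod.act_left_naturality f.hom g.hom,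
        reassoc_of% s.leftSection_top, Category.assoc] }

end

end

end Modular

namespace Pointed

open AnyonCat

/-! ## The relative tensor product of induced modules -/

/-- The module induced from an object of the doubled semion category. -/
abbrev inducedModule (X : DoubledSemion) : RMod condensate :=
  (localSection.induce doubledSemionData).obj X

theorem isMonomial_induced_act (X : DoubledSemion) :
    IsMonomial (inducedModule X).act (fun p => (p.1.1, (p.1.2 + p.2 : ZMod 2))) (fun _ => 0) :=
  isMonomial_free_act _

theorem act_fuse (X Y : DoubledSemion) :
    (α_ (induced X) (induced Y) condensate).hom ≫ induced X ◁ (inducedModule Y).act ≫ fuse X Y =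
      fuse X Y ▷ condensate ≫ (inducedModule (X ⊗ Y)).act :=
  IsMonomial.ext
    ((isMonomial_associator _ _ _).comp (((isMonomial_induced_act Y).whiskerLeft _).comp
      (isMonomial_fuse X Y)))
    (((isMonomial_fuse X Y).whiskerRight _).comp (isMonomial_induced_act (X ⊗ Y)))
    (fun p => congrArg (Prod.mk (p.1.1.1, p.1.2.1)) (by
      change p.1.1.2 + (p.1.2.2 + p.2) + fusionShift (X.deg p.1.1.1) (Y.deg p.1.2.1) =
        p.1.1.2 + p.1.2.2 + fusionShift (X.deg p.1.1.1) (Y.deg p.1.2.1) + p.2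
      ring))
    (fun p => ((zero_add _).trans (zero_add _)).trans (add_zero _).symm)

theorem fuse_balanced (X Y : DoubledSemion) :
    (inducedModule X).act ▷ induced Y ≫ fuse X Y =
      ((α_ (induced X) condensate (induced Y)).hom ≫
        induced X ◁ ((β_ condensate (induced Y)).hom ≫ (inducedModule Y).act)) ≫ fuse X Y :=
  IsMonomial.ext
    (((isMonomial_induced_act X).whiskerRight _).comp (isMonomial_fuse X Y))
    (((isMonomial_associator _ _ _).comp (((isMonomial_braiding _ _).comp
      (isMonomial_induced_act Y)).whiskerLeft _)).comp (isMonomial_fuse X Y))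
    (fun p => congrArg (Prod.mk (p.1.1.1, p.2.1)) (by
      change p.1.1.2 + p.1.2 + p.2.2 + fusionShift (X.deg p.1.1.1) (Y.deg p.2.1) =
        p.1.1.2 + (p.2.2 + p.1.2) + fusionShift (X.deg p.1.1.1) (Y.deg p.2.1)
      ring))
    (fun p => by
      have h := fusionPhase_balanced (X.deg p.1.1.1) (Y.deg p.2.1) p.1.1.2 p.2.2 p.1.2
      refine (zero_add _).trans (h.trans (congrArg (· + _) ?_))
      exact ((add_zero _).symm.trans (zero_add _).symm))

/-- A section of the projection to the relative tensor product. -/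
def fuseSection (X Y : DoubledSemion) : induced (X ⊗ Y) ⟶ induced X ⊗ induced Y :=
  ofFun (fun p => ((p.1.1, (p.2 + fusionShift (X.deg p.1.1) (Y.deg p.1.2) : ZMod 2)),
      (p.1.2, (0 : ZMod 2))))
    (fun p => by
      have h : ∀ (g h : ZMod 2 × ZMod 2) (m : ZMod 2),
          localSection.rep (g + h) + condensate.deg m =
            localSection.rep g + condensate.deg (m + fusionShift g h) +
              (localSection.rep h + condensate.deg (0 : ZMod 2)) := by decide
      exact h (X.deg p.1.1) (Y.deg p.1.2) p.2)
    (fun p => -fusionPhase (p.2 + fusionShift (X.deg p.1.1) (Y.deg p.1.2)) (X.deg p.1.1)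
      (Y.deg p.1.2))

/-- The insertion of the summand of the algebra that appears in the second factor. -/
def fuseHomotopy (X Y : DoubledSemion) :
    induced X ⊗ induced Y ⟶ (induced X ⊗ condensate) ⊗ induced Y :=
  ofFun (fun p => ((p.1, p.2.2), (p.2.1, (0 : ZMod 2))))
    (fun p => by
      have h : ∀ (a b c : ZMod 4 × ZMod 4), a + (b + c) = a + c + (b + 0) := by
        intro a b c
        rw [add_zero, add_assoc, add_comm b]
      exact h _ _ _)
    (fun p => -toricData.R (condensate.deg p.2.2) (localSection.rep (Y.deg p.2.1) +
      condensate.deg (0 : ZMod 2)))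

theorem fuseSection_fuse (X Y : DoubledSemion) : fuseSection X Y ≫ fuse X Y = 𝟙 _ :=
  IsMonomial.ext ((isMonomial_ofFun _ _ _).comp (isMonomial_fuse X Y)) (isMonomial_id _)
    (fun p => congrArg (Prod.mk p.1) (by
      change p.2 + fusionShift (X.deg p.1.1) (Y.deg p.1.2) + 0 +
        fusionShift (X.deg p.1.1) (Y.deg p.1.2) = p.2
      rw [add_zero, add_assoc, ChargeSection.zmod_two_add_self, add_zero]))
    (fun _ => neg_add_cancel _)

theorem fuseHomotopy_right (X Y : DoubledSemion) :
    fuseHomotopy X Y ≫ (α_ (induced X) condensate (induced Y)).hom ≫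
        induced X ◁ ((β_ condensate (induced Y)).hom ≫ (inducedModule Y).act) = 𝟙 _ :=
  IsMonomial.ext ((isMonomial_ofFun _ _ _).comp ((isMonomial_associator _ _ _).comp
      (((isMonomial_braiding _ _).comp (isMonomial_induced_act Y)).whiskerLeft _)))
    (isMonomial_id _)
    (fun p => congrArg (fun k : ZMod 2 => (p.1, (p.2.1, k))) (zero_add (p.2.2 : ZMod 2)))
    (fun p => by
      refine (congrArg (_ + ·) ((zero_add _).trans (add_zero _))).trans ?_
      exact neg_add_cancel _)

theorem fuseHomotopy_left (X Y : DoubledSemion) :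
    fuseHomotopy X Y ≫ (inducedModule X).act ▷ induced Y = fuse X Y ≫ fuseSection X Y :=
  IsMonomial.ext ((isMonomial_ofFun _ _ _).comp ((isMonomial_induced_act X).whiskerRight _))
    ((isMonomial_fuse X Y).comp (isMonomial_ofFun _ _ _))
    (fun p => congrArg (fun k : ZMod 2 => ((p.1.1, k), (p.2.1, (0 : ZMod 2)))) (by
      change p.1.2 + p.2.2 = p.1.2 + p.2.2 + fusionShift (X.deg p.1.1) (Y.deg p.2.1) +
        fusionShift (X.deg p.1.1) (Y.deg p.2.1)
      rw [add_assoc (_ + _), ChargeSection.zmod_two_add_self, add_zero]))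
    (fun p => by
      have h : ∀ (a b : ZMod 2 × ZMod 2) (k l : ZMod 2),
          -toricData.R (condensate.deg l) (localSection.rep b + condensate.deg (0 : ZMod 2)) + 0 =
            fusionPhase k a b + -fusionPhase (k + l + fusionShift a b + fusionShift a b) a b := by
        decide
      exact h (X.deg p.1.1) (Y.deg p.2.1) p.1.2 p.2.2)

/-- The relative tensor product of induced modules is a split coequalizer. -/
def fuseSplit (X Y : DoubledSemion) :
    IsSplitCoequalizer ((inducedModule X).act ▷ induced Y)
      ((α_ (induced X) condensate (induced Y)).hom ≫
        induced X ◁ ((β_ condensate (induced Y)).hom ≫ (inducedModule Y).act)) (fuse X Y) where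
  rightSection := fuseSection X Y
  leftSection := fuseHomotopy X Y
  condition := fuse_balanced X Y
  rightSection_π := fuseSection_fuse X Y
  leftSection_bottom := fuseHomotopy_right X Y
  leftSection_top := fuseHomotopy_left X Y

/-! ## The braided category of local modules -/

instance : MonoidalCategory (LocMod condensate) := Monoidal.transport localEquivalence

instance : localEquivalence.inverse.Monoidal :=
  inferInstanceAs (Monoidal.equivalenceTransported localEquivalence).inverse.Monoidal

instance : BraidedCategory (LocMod condensate) :=
  inferInstanceAs (BraidedCategory (Monoidal.Transported localEquivalence))

instance : localEquivalence.inverse.Braided :=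
  inferInstanceAs (Monoidal.equivalenceTransported localEquivalence).inverse.Braided

/-- The counit, as an isomorphism of underlying objects. -/
def forgetIso : localEquivalence.inverse ⋙ induction ≅ LocMod.forget condensate :=
  Functor.isoWhiskerRight localEquivalence.counitIso (LocMod.forget condensate)

instance : (LocMod.forget condensate).LaxBraided := laxBraidedOfIso forgetIso

/-- The counit, as an isomorphism of modules. -/
def counitMod (M : LocMod condensate) : inducedModule (localEquivalence.inverse.obj M) ≅ M.obj :=
  localSection.counitIsoObj _ M.obj (supports_localSection M.property)

theorem forget_ε : Functor.LaxMonoidal.ε (LocMod.forget condensate) = induceUnit := by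
  have h := congrArg RMod.Hom.hom (localSection.triangle (𝟙_ DoubledSemion))
  refine (Category.assoc _ _ _).trans ?_
  exact (congrArg (induceUnit ≫ ·) h).trans (Category.comp_id _)

theorem forget_μ (M N : LocMod condensate) : Functor.LaxMonoidal.μ (LocMod.forget condensate) M N =
    ((counitMod M).inv.hom ⊗ₘ (counitMod N).inv.hom) ≫
      fuse (localEquivalence.inverse.obj M) (localEquivalence.inverse.obj N) := by
  have h := congrArg RMod.Hom.hom (localSection.triangle
    (localEquivalence.inverse.obj M ⊗ localEquivalence.inverse.obj N))
  refine congrArg (_ ≫ ·) ((Category.assoc _ _ _).trans ?_)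
  exact (congrArg (fuse _ _ ≫ ·) h).trans (Category.comp_id _)

/-- The twist of a local module. -/
def localTwist (M : LocMod condensate) : M ≅ M :=
  (RMod.IsLocal condensate).isoMk (RMod.isoMk ⟨(twist toricData M.obj.X).hom, by
    have h : (β_ M.obj.X condensate).hom ≫ (β_ condensate M.obj.X).hom ≫ M.obj.act =
      M.obj.act := M.property
    rw [comp_twist, twist_tensor, twist_condensate, tensorHom_id, Category.assoc, Category.assoc,
      h]⟩ (twist toricData M.obj.X).inv (Iso.hom_inv_id _) (Iso.inv_hom_id _))

theorem inverse_map_twist (M : LocMod condensate) :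
    localEquivalence.inverse.map (localTwist M).hom =
      (twist doubledSemionData (localEquivalence.inverse.obj M)).hom := by
  have h : ∀ g, toricData.T (localSection.rep g) = doubledSemionData.T g := by decide
  refine entry_ext (X := localSection.restrictObj doubledSemionData M.obj.X)
    (Y := localSection.restrictObj doubledSemionData M.obj.X) fun p q => ?_
  refine (entry_twist M.obj.X _ _).trans (Eq.trans ?_ (entry_twist _ _ _).symm)
  rw [← h, localSection.rep_deg_restrictObj]
  simp only [localSection.val_injective.eq_iff]

/-- The representative of the unit is the unit. -/
def relabelUnit : (localSection.relabel doubledSemionData).obj (𝟙_ DoubledSemion) ≅ 𝟙_ ToricCode :=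
  monomial (Equiv.refl Unit)
    (fun _ => (by decide : localSection.rep 0 = (0 : ZMod 4 × ZMod 4))) (fun _ => 0)

theorem isMonomial_relabelUnit : IsMonomial relabelUnit.hom (fun p => p) (fun _ => 0) :=
  isMonomial_hom _ _ _

/-- The unit object is the regular module. -/
def localUnitIso : (𝟙_ (LocMod condensate)).obj ≅ RMod.regular condensate :=
  (RMod.free condensate).mapIso relabelUnit ≪≫ freeUnitIso condensate

theorem localUnitIso_hom :
    localUnitIso.hom.hom = relabelUnit.hom ▷ condensate ≫ (λ_ condensate).hom :=
  rfl

theorem induceUnit_localUnitIso : induceUnit ≫ localUnitIso.hom.hom = η[condensate] := by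
  rw [localUnitIso_hom]
  have h := isMonomial_induceUnit.comp ((isMonomial_relabelUnit.whiskerRight condensate).comp
    (isMonomial_leftUnitor condensate))
  exact h.ext isMonomial_condensateUnit (fun _ => rfl) (fun _ => rfl)

/-- The braided monoidal structure and the twist of the category of local modules. -/
def localStructure : LocModStructure (twist toricData) condensate where
  monoidal := inferInstance
  braided := inferInstance
  twist := localTwist
  laxBraided := inferInstance
  act_tensor M N := by
    rw [forget_μ]
    exact RMod.act_tensor_of_iso (counitMod M) (counitMod N) _ (act_fuse _ _)
  balanced M N := by
    rw [forget_μ]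
    exact RMod.balanced_of_iso (counitMod M) (counitMod N) _ (fuse_balanced _ _)
  coequalizer M N := by
    have h : IsSplitCoequalizer (M.obj.act ▷ N.obj.X) ((α_ M.obj.X condensate N.obj.X).hom ≫
        M.obj.X ◁ ((β_ condensate N.obj.X).hom ≫ N.obj.act))
        (Functor.LaxMonoidal.μ (LocMod.forget condensate) M N) := by
      rw [forget_μ]
      exact RMod.splitCoequalizerOfIso (P := (M ⊗ N).obj) (counitMod M) (counitMod N) (fuse _ _)
        (fuseSplit (localEquivalence.inverse.obj M) (localEquivalence.inverse.obj N))
    exact ⟨h.isCoequalizer⟩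
  unitIso := localUnitIso
  unit_comp := by
    rw [forget_ε]
    exact induceUnit_localUnitIso
  twist_hom _ := rfl

/-! ## Equivalence with the doubled semion category -/

instance : localEquivalence.inverse.Additive where
  map_add := entry_ext fun _ _ => rfl

instance : localEquivalence.inverse.Linear ℂ where
  map_smul _ _ := entry_ext fun _ _ => rfl

theorem isModular_local : IsModular (LocMod condensate) localTwist :=
  isModular_of_equivalence isNondegenerate_doubledSemionData localTwist localEquivalence.inverse
    inverse_map_twist

theorem dagger_unitIsoObj (Y : DoubledSemion) :
    dagger (localSection.unitIsoObj Y).hom = (localSection.unitIsoObj Y).inv :=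
  dagger_monomial _ _ _

/-- The unitary structure of the category of local modules. -/
def localUnitaryStructure : UnitaryStructure (LocMod condensate) localTwist :=
  (unitaryStructure isNondegenerate_doubledSemionData.dim).ofEquivalence localTwist
    localEquivalence.inverse inverse_map_twist
    (dagger_unitIsoObj _)
    (fun _ _ => dagger_unitIsoObj _)
    (fun Y => ⟨localEquivalence.functor.obj Y, (localSection.unitIsoObj Y).symm, by
      change dagger (localSection.unitIsoObj Y).inv = (localSection.unitIsoObj Y).hom
      rw [← dagger_unitIsoObj]
      exact (unitaryStructure isNondegenerate_doubledSemionData.dim).dag_dag _⟩)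

theorem ribbonEquivalent_local : RibbonEquivalent (LocMod condensate) localTwist DoubledSemion
    (twist doubledSemionData) :=
  ⟨localEquivalence.inverse, inferInstance, inferInstance, inferInstance, inferInstance,
    inverse_map_twist⟩

theorem condensate_iso : Nonempty (condensate ≅ 𝟙_ ToricCode ⊞ anyon 2 2) :=
  nonempty_iso_biprod condensate (i := (0 : ZMod 2)) (j := (1 : ZMod 2)) zero_ne_one zmod_two_cases
    rfl rfl

end Pointed

end

theorem mainTheorem1 :
    -- the toric code is a unitary modular category
    (IsModular ToricCode (AnyonCat.twist toricData) ∧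
      Nonempty (UnitaryStructure ToricCode (AnyonCat.twist toricData))) ∧
    -- the object `1 ⊕ e²m²` is a boson and a 2d-condensable algebra
    (Nonempty (condensate ≅ 𝟙_ ToricCode ⊞ anyon 2 2) ∧
      (AnyonCat.twist toricData condensate).hom = 𝟙 condensate ∧
      IsCondensable (AnyonCat.twist toricData) condensate) ∧
    -- the simple right modules are `A` and seven others, three of which are local
    ∃ M : Fin 7 → RMod condensate,
      IsListOfSimples (Fin.cons (RMod.regular condensate) M : Fin 8 → RMod condensate) ∧
      (Nonempty ((M 0).X ≅ anyon 1 0 ⊞ anyon 3 2) ∧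
        Nonempty ((M 1).X ≅ anyon 2 0 ⊞ anyon 0 2) ∧
        Nonempty ((M 2).X ≅ anyon 3 0 ⊞ anyon 1 2) ∧
        Nonempty ((M 3).X ≅ anyon 2 3 ⊞ anyon 0 1) ∧
        Nonempty ((M 4).X ≅ anyon 1 1 ⊞ anyon 3 3) ∧
        Nonempty ((M 5).X ≅ anyon 0 3 ⊞ anyon 2 1) ∧
        Nonempty ((M 6).X ≅ anyon 3 1 ⊞ anyon 1 3)) ∧
      (∀ i, RMod.IsLocal condensate (M i) ↔ i = 1 ∨ i = 4 ∨ i = 6) ∧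
      -- the simple local modules
      (∃ N : Fin 4 → LocMod condensate, IsListOfSimples N ∧
        Nonempty ((N 0).obj ≅ RMod.regular condensate) ∧
        Nonempty ((N 1).obj ≅ M 4) ∧
        Nonempty ((N 2).obj ≅ M 1) ∧
        Nonempty ((N 3).obj ≅ M 6)) ∧
      -- the category of local modules is the doubled semion unitary modular category
      ∃ L : LocModStructure (AnyonCat.twist toricData) condensate,
        letI := L.monoidal
        letI := L.braided
        IsModular (LocMod condensate) L.twist ∧
          Nonempty (UnitaryStructure (LocMod condensate) L.twist) ∧
          RibbonEquivalent (LocMod condensate) L.twist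
            DoubledSemion (AnyonCat.twist doubledSemionData) := by
  refine ⟨⟨AnyonCat.isModular isNondegenerate_toricData,
    ⟨AnyonCat.unitaryStructure isNondegenerate_toricData.dim⟩⟩,
    ⟨condensate_iso, twist_condensate, isCondensable_condensate⟩,
    fun i => simpleModule (simpleLabel i.succ), ?_,
    ⟨simpleModule_iso 0 (by decide) (by decide), simpleModule_iso 0 (by decide) (by decide),
      simpleModule_iso 0 (by decide) (by decide), simpleModule_iso 1 (by decide) (by decide),
      simpleModule_iso 0 (by decide) (by decide), simpleModule_iso 1 (by decide) (by decide),
      simpleModule_iso 0 (by decide) (by decide)⟩, ?_,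
    ⟨fun i => simpleLocal (localLabel i), isListOfSimples_simpleLocal,
      ?_, simpleLocal_iso 0 (by decide), simpleLocal_iso 1 (by decide),
      simpleLocal_iso 0 (by decide)⟩,
    localStructure, isModular_local, ⟨localUnitaryStructure⟩, ribbonEquivalent_local⟩
  · refine isListOfSimples_simpleModule.of_iso fun i => ?_
    refine Fin.cases simpleModule_zero (fun j => ⟨Iso.refl _⟩) i
  · intro i
    rw [isLocal_simpleModule]
    revert i
    decide
  · obtain ⟨f⟩ := simpleModule_zero
    obtain ⟨g⟩ := simpleLocal_iso (g := 0) (h := 0) 0 (by decide)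
    exact ⟨g ≪≫ f.symm⟩
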